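/- Let $g\ge 1$. **Sullivan diagrams.** Consider fat graphs with one white vertex, which has a marked start half-edge, with trivalent black vertices otherwise, with $m$ labelled leaves, each the only labelled leaf in its boundary cycle (so that it marks an incoming closed boundary component), and possibly an unlabelled leaf at the start of the white vertex. Exceptional components consisting of a single labelled leaf without vertex are allowed. The degree of a graph is the valence of its white vertex minus one. A Sullivan diagram is a class of such graphs under isomorphism and under replacing one of the two trivalent blow-ups of a black vertex of valence four by the other. Let $\mathcal{SD}_*(m,1)$ be the chain complex freely generated by Sullivan diagrams, where $d$ is the alternating sum over all pairs of consecutive half-edges at the white vertex, which are pulled out to a new trivalent black vertex (joining an unlabelled start leaf to a neighbour just removes that leaf). Let $\mu_g\in\mathcal{SD}_{2g+1}(g+1,1)$ be the diagram with $2g+2$ half-edges $1,\dots,2g+2$ at the white vertex, start $1$, where $1,3,\dots,2g+1$ are connected by a planar tree outside of the white vertex and $2,4,\dots,2g+2$ are leaves, labelled $1,\dots,g+1$ in order. Let $t_g\in\mathcal{SD}_{2g+1}(1,1)$ be obtained from $\mu_g$ by connecting $2,4,\dots,2g+2$ by a second such tree, with one additional leaf (its root), which carries the label. The surface of $\mu_g$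 is connected of genus $0$ with $g+1$ incoming boundary components and one outgoing one (the white vertex); that of $t_g$ is connected of genus $g$ with one incoming and one outgoing boundary component. **Action.** For $R=\mathbb{Z}$ or $\mathbb{Q}$ let $A=R[x]/(x^2)$, concentrated in degree $0$, be the commutative Frobenius algebra with $\nu(1)=1\otimes x+x\otimes 1$, $\nu(x)=x\otimes x$, let $C_*(A,A)$ be its reduced Hochschild complex, $C_p(A,A)=A\otimes(A/R)^{\otimes p}$, and $HH_*(A,A)$ its homology. Let $F$ denote the action of Sullivan diagrams on $C_*(A,A)$. For $a_1,\dots,a_m\in A=C_0(A,A)$, $F(G\otimes a_1\otimes\cdots\otimes a_m)$ is obtained by placing $a_j$ at the leaf $j$ of $G$, reading the graph without its white vertex as a composition of operations of the Frobenius algebra $A$ whose outputs are the half-edges at the white vertex, and placing the outputs, in order from the start half-edge, into the tensor factors of a Hochschild chain (with $1$ as the output of an unlabelled start leaf). Then: 1. For $R=\mathbb{Z}$, $F(t_g\otimes x)=1\otimes x\otimes\cdots\otimes x\in C_{2g+1}(A,A)$. 2. $F(t_g\otimes -)$ induces a well-defined nonzero map $HH_0(A,A)\to HH_{2g+1}(A,A)$,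 for $R=\mathbb{Z}$ and for $R=\mathbb{Q}$. 3. $F(\mu_g\otimes -)$ induces a well-defined nonzero map $HH_0(A,A)^{\otimes (g+1)}\to HH_{2g+1}(A,A)$, for $R=\mathbb{Z}$ and for $R=\mathbb{Q}$. 4. $t_g$ and $\mu_g$ are cycles, and their classes in $H_{2g+1}(\mathcal{SD}_*(1,1))$ and $H_{2g+1}(\mathcal{SD}_*(g+1,1))$ are nonzero, with integral and with rational coefficients. 5. For every $N\ge 2$, the corresponding operations of $t_g$ and $\mu_g$ for the graded algebra $H^*(S^N;\mathbb{Q})=\mathbb{Q}[x]/(x^2)$, $|x|=N$, induce nonzero maps $HH_0\to HH_{2g+1}$ and $HH_0^{\otimes(g+1)}\to HH_{2g+1}$ on $HH_*(H^*(S^N;\mathbb{Q}),H^*(S^N;\mathbb{Q}))$ (the subscript is the Hochschild degree). This holds for every choice of the signs with which the summands of the composition of operations, expanded in the basis $1,x$, are counted. Via $HH_{-*}(H^*(S^N;\mathbb{Q}),H^*(S^N;\mathbb{Q}))\cong H^*(LS^N;\mathbb{Q})$ these are the resulting higher string topology operations. -/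

import Mathlib

open scoped TensorProduct

noncomputable section

namespace Sullivan

/-! ### Black and white graphs with one white vertex -/

/-- The half-edges of a graph with one white vertex, `k` half-edges at the white vertex and a set
`V` of trivalent black vertices. The half-edges at the white vertex are `0, …, k - 1` in their
cyclic order; the half-edges at the black vertex `v` are `(v, 0), (v, 1), (v, 2)` in their cyclic
order. -/
abbrev HalfEdge (k : ℕ) (V : Type) := Fin k ⊕ V × Fin 3

/-- The fat structure: the next half-edge in the cyclic order at the same vertex. -/
def nextPerm (k : ℕ) (V : Type) : Equiv.Perm (HalfEdge k V) :=
  Equiv.sumCongr (finRotate k) (Equiv.prodCongr (Equiv.refl V) (finRotate 3))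

/-- Black and white fat graphs with one white vertex, all of whose black vertices are trivalent,
with leaves labelled by `Fin m`. Here `k` counts the half-edges at the white vertex other than an
unlabelled start leaf (see `Gen`).
Two half-edges `h ≠ inv h` form an edge; the fixed points of `inv` are the leaves, each of which
carries exactly one label. A label `j` with `leaf j = none` sits on an exceptional component: a
single leaf without a vertex (a disc, with the leaf `j` on its boundary). -/
structure BWGraph (m k : ℕ) where
  V : Type
  [fin : Fintype V]
  [dec : DecidableEq V]
  inv : HalfEdge k V → HalfEdge k V
  inv_inv : Function.Involutive inv
  leaf : Fin m → Option (HalfEdge k V)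
  leaf_inj : ∀ i j h, leaf i = some h → leaf j = some h → i = j
  inv_eq_self_iff : ∀ h, inv h = h ↔ ∃ j, leaf j = some h

attribute [instance] BWGraph.fin BWGraph.dec

variable {m k : ℕ}

theorem BWGraph.ext_inv {V : Type} [Fintype V] [DecidableEq V]
    {i₁ i₂ : HalfEdge k V → HalfEdge k V} {l₁ l₂ : Fin m → Option (HalfEdge k V)}
    (a₁ : Function.Involutive i₁) (a₂ : Function.Involutive i₂)
    (b₁ : ∀ i j h, l₁ i = some h → l₁ j = some h → i = j)
    (b₂ : ∀ i j h, l₂ i = some h → l₂ j = some h → i = j)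
    (c₁ : ∀ h, i₁ h = h ↔ ∃ j, l₁ j = some h) (c₂ : ∀ h, i₂ h = h ↔ ∃ j, l₂ j = some h)
    (hi : i₁ = i₂) (hl : l₁ = l₂) :
    BWGraph.mk V i₁ a₁ l₁ b₁ c₁ = BWGraph.mk V i₂ a₂ l₂ b₂ c₂ := by
  subst hi; subst hl; rfl

/-- Rename the half-edges of a graph along a bijection onto another set of half-edges. -/
abbrev BWGraph.relabel {k' : ℕ} (G : BWGraph m k) (W : Type) [Fintype W] [DecidableEq W]
    (e : HalfEdge k G.V ≃ HalfEdge k' W) : BWGraph m k' where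
  V := W
  inv h := e (G.inv (e.symm h))
  inv_inv h := by simp [G.inv_inv (e.symm h)]
  leaf j := (G.leaf j).map e
  leaf_inj i j h hi hj := by
    obtain ⟨a, ha, rfl⟩ := Option.map_eq_some_iff.1 hi
    obtain ⟨b, hb, hab⟩ := Option.map_eq_some_iff.1 hj
    obtain rfl := e.injective hab
    exact G.leaf_inj _ _ _ ha hb
  inv_eq_self_iff h := by
    rw [← e.eq_symm_apply, G.inv_eq_self_iff]
    refine exists_congr fun j => ?_
    rw [Option.map_eq_some_iff]
    constructor
    · intro hj
      exact ⟨_, hj, by simp⟩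
    · rintro ⟨a, ha, rfl⟩
      simpa using ha

/-- Add a new edge: the old half-edges together with the two halves `false`, `true` of the new edge
are placed among the half-edges of a new graph by the bijection `e`. -/
abbrev BWGraph.addEdge {k' : ℕ} (G : BWGraph m k) (W : Type) [Fintype W] [DecidableEq W]
    (e : HalfEdge k G.V ⊕ Bool ≃ HalfEdge k' W) : BWGraph m k' where
  V := W
  inv h := e (Sum.map G.inv not (e.symm h))
  inv_inv h := by
    have : ∀ x : HalfEdge k G.V ⊕ Bool, Sum.map G.inv not (Sum.map G.inv not x) = x := by
      rintro (x | x)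
      · simp [G.inv_inv x]
      · simp
    simp [this]
  leaf j := (G.leaf j).map fun h => e (Sum.inl h)
  leaf_inj i j h hi hj := by
    obtain ⟨a, ha, rfl⟩ := Option.map_eq_some_iff.1 hi
    obtain ⟨b, hb, hab⟩ := Option.map_eq_some_iff.1 hj
    obtain rfl := Sum.inl_injective (e.injective hab)
    exact G.leaf_inj _ _ _ ha hb
  inv_eq_self_iff h := by
    rw [← e.eq_symm_apply]
    obtain ⟨x, rfl⟩ := e.surjective h
    rw [e.symm_apply_apply]
    rcases x with x | x
    · simp only [Sum.map_inl, Sum.inl.injEq, G.inv_eq_self_iff, Option.map_eq_some_iff,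
        EmbeddingLike.apply_eq_iff_eq, exists_eq_right]
    · simp [Option.map_eq_some_iff]

/-! ### Sullivan diagrams -/

/-- Let `u ≠ v` be black vertices joined by an edge with halves `(u, 0)` and `(v, 0)`. Collapsing
the edge gives a black vertex of valence four with cyclic order `(u, 1), (u, 2), (v, 1), (v, 2)`.
The other way of blowing it up has the half-edges `(u, 0), (u, 2), (v, 1)` at one vertex and
`(v, 0), (v, 2), (u, 1)` at the other. This permutation puts these half-edges in the
positions `0, 1, 2` at the vertices `u` and `v`. -/
def flipPerm (k : ℕ) {V : Type} [DecidableEq V] (u v : V) : Equiv.Perm (HalfEdge k V) :=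
  Equiv.sumCongr (Equiv.refl (Fin k))
    (Equiv.swap (u, 1) (v, 2) * Equiv.swap (v, 2) (v, 1) * Equiv.swap (v, 1) (u, 2))

/-- The relations among graphs: isomorphism of fat graphs (fixing the half-edges at the white
vertex), and replacing one of the two blow-ups of a black vertex of valence four by the other. -/
inductive Move : BWGraph m k → BWGraph m k → Prop
  | iso (G : BWGraph m k) (W : Type) [Fintype W] [DecidableEq W] (e : G.V × Fin 3 ≃ W × Fin 3)
      (he : ∀ v t, e (v, t + 1) = ((e (v, t)).1, (e (v, t)).2 + 1)) :
      Move G (G.relabel W (Equiv.sumCongr (Equiv.refl (Fin k)) e))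
  | flip (G : BWGraph m k) (u v : G.V) (huv : u ≠ v)
      (h : G.inv (Sum.inr (u, 0)) = Sum.inr (v, 0)) :
      Move G (G.relabel G.V (flipPerm k u v))

/-- Equivalence classes of graphs under the equivalence relation generated by `Move`. -/
def Diagram (m k : ℕ) : Type 1 := Quot (Move (m := m) (k := k))

/-- Rotate the enumeration of the half-edges at the white vertex: the last becomes the first. -/
abbrev BWGraph.rotate (G : BWGraph m k) : BWGraph m k :=
  G.relabel G.V (Equiv.sumCongr (finRotate k) (Equiv.refl _))

/-- The bookkeeping for `BWGraph.merge`: the half-edges `i` and `i + 1` at the white vertex go to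
the positions `1` and `2` of a new black vertex `none`; the new edge joins position `0` of
`none` to the white vertex, at the place `i`. -/
def mergeEquiv {V : Type} (i : Fin k) :
    HalfEdge (k + 1) V ⊕ Bool ≃ HalfEdge k (Option V) where
  toFun
    | Sum.inl (Sum.inl j) =>
      match finSuccEquiv' i.castSucc j with
      | none => Sum.inr (none, 1)
      | some j' => if j' = i then Sum.inr (none, 2) else Sum.inl j'
    | Sum.inl (Sum.inr (v, t)) => Sum.inr (some v, t)
    | Sum.inr false => Sum.inl i
    | Sum.inr true => Sum.inr (none, 0)
  invFun
    | Sum.inl j => if j = i then Sum.inr false else Sum.inl (Sum.inl (i.castSucc.succAbove j))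
    | Sum.inr (some v, t) => Sum.inl (Sum.inr (v, t))
    | Sum.inr (none, t) =>
      if t = 0 then Sum.inr true
      else if t = 1 then Sum.inl (Sum.inl i.castSucc) else Sum.inl (Sum.inl i.succ)
  left_inv := by
    rintro ((j | ⟨v, t⟩) | (_ | _))
    · rcases hj : finSuccEquiv' i.castSucc j with _ | j'
      · rw [finSuccEquiv'_eq_none] at hj
        simp [← hj]
      · rw [finSuccEquiv'_eq_some] at hj
        subst hj
        by_cases h : j' = i
        · subst h
          have h2 : finSuccEquiv' j'.castSucc j'.succ = some j' := by
            rw [finSuccEquiv'_eq_some]; simp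
          simp [h2]
        · simp [h]
    · rfl
    · simp
    · simp
  right_inv := by
    rintro (j | ⟨_ | v, t⟩)
    · by_cases h : j = i <;> simp [h]
    · have h2 : finSuccEquiv' i.castSucc i.succ = some i := by
        rw [finSuccEquiv'_eq_some]; simp
      fin_cases t
      · simp
      · simp
      · simp [h2]
    · rfl

/-- The blow-up of the white vertex that pulls the half-edges `i` and `i + 1` out to a new
trivalent black vertex. -/
abbrev BWGraph.merge (G : BWGraph m (k + 1)) (i : Fin k) : BWGraph m k :=
  G.addEdge (Option G.V) (mergeEquiv i)

theorem BWGraph.relabel_relabel {k' k'' : ℕ} (G : BWGraph m k) (W : Type) [Fintype W]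
    [DecidableEq W] (W' : Type) [Fintype W'] [DecidableEq W']
    (e : HalfEdge k G.V ≃ HalfEdge k' W) (e' : HalfEdge k' W ≃ HalfEdge k'' W') :
    (G.relabel W e).relabel W' e' = G.relabel W' (e.trans e') := by
  refine BWGraph.ext_inv _ _ _ _ _ _ ?_ ?_
  · funext h; simp
  · funext j; simp [Function.comp_def]

theorem BWGraph.relabel_addEdge {k' k'' : ℕ} (G : BWGraph m k) (W : Type) [Fintype W]
    [DecidableEq W] (W' : Type) [Fintype W'] [DecidableEq W']
    (e : HalfEdge k G.V ⊕ Bool ≃ HalfEdge k' W) (e' : HalfEdge k' W ≃ HalfEdge k'' W') :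
    (G.addEdge W e).relabel W' e' = G.addEdge W' (e.trans e') := by
  refine BWGraph.ext_inv _ _ _ _ _ _ ?_ ?_
  · funext h; simp
  · funext j; simp [Function.comp_def]

theorem BWGraph.addEdge_relabel {k' k'' : ℕ} (G : BWGraph m k) (W : Type) [Fintype W]
    [DecidableEq W] (W' : Type) [Fintype W'] [DecidableEq W']
    (e : HalfEdge k G.V ≃ HalfEdge k' W) (e' : HalfEdge k' W ⊕ Bool ≃ HalfEdge k'' W') :
    (G.relabel W e).addEdge W' e' =
      G.addEdge W' ((Equiv.sumCongr e (Equiv.refl Bool)).trans e') := by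
  refine BWGraph.ext_inv _ _ _ _ _ _ ?_ ?_
  · funext h
    obtain ⟨x, rfl⟩ := e'.surjective h
    rcases x with x | x <;> simp
  · funext j; simp [Function.comp_def]

/-- Extend a bijection between half-edges at black vertices by the identity on one more vertex. -/
def extendEquiv {V W : Type} (e : V × Fin 3 ≃ W × Fin 3) : Option V × Fin 3 ≃ Option W × Fin 3 where
  toFun
    | (none, t) => (none, t)
    | (some v, t) => (some (e (v, t)).1, (e (v, t)).2)
  invFun
    | (none, t) => (none, t)
    | (some v, t) => (some (e.symm (v, t)).1, (e.symm (v, t)).2)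
  left_inv := by rintro ⟨_ | v, t⟩ <;> simp
  right_inv := by rintro ⟨_ | v, t⟩ <;> simp

theorem mergeEquiv_comm {V W : Type} (i : Fin k) (e : V × Fin 3 ≃ W × Fin 3) :
    (Equiv.sumCongr (Equiv.sumCongr (Equiv.refl (Fin (k + 1))) e) (Equiv.refl Bool)).trans
        (mergeEquiv i) =
      (mergeEquiv i).trans (Equiv.sumCongr (Equiv.refl (Fin k)) (extendEquiv e)) := by
  ext1 x
  rcases x with ((j | ⟨v, t⟩) | (_ | _))
  · rcases hj : finSuccEquiv' i.castSucc j with _ | j'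
    · simp [mergeEquiv, hj, extendEquiv]
    · by_cases h : j' = i <;> simp [mergeEquiv, hj, h, extendEquiv]
  · rfl
  · rfl
  · rfl

theorem Move.rotate {G G' : BWGraph m k} (h : Move G G') : Move G.rotate G'.rotate := by
  cases h with
  | iso W e he =>
    have := Move.iso G.rotate W e he
    convert this using 1
    refine (BWGraph.relabel_relabel ..).trans (Eq.trans ?_ (BWGraph.relabel_relabel ..).symm)
    congr 1
    ext1 x; rcases x with x | x <;> rfl
  | flip u v huv h =>
    have := Move.flip G.rotate u v huv (by
      change Equiv.sumCongr _ _ (G.inv _) = _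
      rw [show (Equiv.sumCongr (finRotate k) (Equiv.refl (G.V × Fin 3))).symm (Sum.inr (u, 0))
        = Sum.inr (u, 0) from rfl, h]
      rfl)
    convert this using 1
    refine (BWGraph.relabel_relabel ..).trans (Eq.trans ?_ (BWGraph.relabel_relabel ..).symm)
    congr 1
    ext1 x; rcases x with x | x <;> rfl

theorem extendEquiv_swap {V : Type} [DecidableEq V] (a b : V × Fin 3) :
    extendEquiv (Equiv.swap a b) = Equiv.swap (some a.1, a.2) (some b.1, b.2) := by
  ext1 x
  rcases x with ⟨_ | v, t⟩
  · rw [Equiv.swap_apply_of_ne_of_ne (by simp) (by simp)]; rfl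
  · change (some (Equiv.swap a b (v, t)).1, (Equiv.swap a b (v, t)).2) = _
    simp only [Equiv.swap_apply_def, Prod.ext_iff, Option.some.injEq]
    split_ifs <;> simp_all

theorem extendEquiv_mul {V : Type} (e f : Equiv.Perm (V × Fin 3)) :
    extendEquiv (e * f) = extendEquiv e * extendEquiv f := by
  ext1 x
  rcases x with ⟨_ | v, t⟩ <;> rfl

theorem Move.merge {G G' : BWGraph m (k + 1)} (h : Move G G') (i : Fin k) :
    Move (G.merge i) (G'.merge i) := by
  cases h with
  | iso W e he =>
    have := Move.iso (G.merge i) (Option W) (extendEquiv e) (by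
      rintro (_ | v) t
      · rfl
      · simp [extendEquiv, he])
    convert this using 1
    refine (BWGraph.addEdge_relabel ..).trans (Eq.trans ?_ (BWGraph.relabel_addEdge ..).symm)
    rw [mergeEquiv_comm]
  | flip u v huv h =>
    have := Move.flip (G.merge i) (some u) (some v) (by simpa using huv) (by
      change mergeEquiv i (Sum.map G.inv not ((mergeEquiv i).symm _)) = _
      rw [show (mergeEquiv i).symm (Sum.inr (some u, 0)) = Sum.inl (Sum.inr (u, 0)) from rfl]
      simp only [Sum.map_inl, h]
      rfl)
    convert this using 1
    refine (BWGraph.addEdge_relabel ..).trans (Eq.trans ?_ (BWGraph.relabel_addEdge ..).symm)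
    rw [flipPerm, mergeEquiv_comm, flipPerm]
    simp only [extendEquiv_mul, extendEquiv_swap]

/-- The rotation of the white vertex on diagrams. -/
def Diagram.rotate : Diagram m k → Diagram m k :=
  Quot.map BWGraph.rotate fun _ _ h => h.rotate

/-- The blow-up of the white vertex on diagrams. -/
def Diagram.merge (i : Fin k) : Diagram m (k + 1) → Diagram m k :=
  Quot.map (fun G => G.merge i) fun _ _ h => h.merge i

/-- The boundary cycles of the fat graph are the orbits of this permutation. -/
def BWGraph.boundaryPerm (G : BWGraph m k) : Equiv.Perm (HalfEdge k G.V) :=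
  nextPerm k G.V * G.inv_inv.toPerm

/-- Every labelled leaf is the only labelled leaf in its boundary cycle, so that the leaves mark
`m` different incoming closed boundary components. -/
def BWGraph.IsClosed (G : BWGraph m k) : Prop :=
  ∀ i j h h', G.leaf i = some h → G.leaf j = some h' → G.boundaryPerm.SameCycle h h' → i = j

/-- The generators in degree `p`: the white vertex has valence `p + 1`, and its start half-edge is
either the half-edge `0` of a diagram with `p + 1` half-edges at the white vertex (`Sum.inl`), or
an additional unlabelled leaf, which comes before the `p` half-edges of a diagram (`Sum.inr`). -/
abbrev Gen (m p : ℕ) : Type 1 := Diagram m (p + 1) ⊕ Diagram m p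

/-- The boundary of a generator: the alternating sum over all pairs of half-edges that follow each
other in the cyclic order at the white vertex, which are pulled out to a trivalent black vertex.
Pairing the unlabelled start leaf with a neighbour removes this leaf and makes the
neighbour the start half-edge. -/
def boundaryGen (R : Type*) [CommRing R] {m : ℕ} (p : ℕ) : Gen m (p + 1) → (Gen m p →₀ R)
  | Sum.inl D =>
    ∑ i : Fin (p + 1), Finsupp.single (Sum.inl (D.merge i)) ((-1) ^ (i : ℕ))
      + Finsupp.single (Sum.inl (D.rotate.merge 0)) ((-1) ^ (p + 1))
  | Sum.inr D =>
    Finsupp.single (Sum.inl D) 1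
      + ∑ i : Fin p, Finsupp.single (Sum.inr (D.merge i)) ((-1) ^ ((i : ℕ) + 1))
      + Finsupp.single (Sum.inl D.rotate) ((-1) ^ (p + 1))

/-- The differential on linear combinations of diagrams with one white vertex. -/
def boundary (R : Type*) [CommRing R] {m : ℕ} : ∀ p : ℕ, (Gen m p →₀ R) →ₗ[R] (Gen m (p - 1) →₀ R)
  | 0 => 0
  | p + 1 => Finsupp.linearCombination R (boundaryGen R p)

/-- The generators all of whose labelled leaves mark incoming closed boundary components. -/
def closedGen (m p : ℕ) : Set (Gen m p) :=
  {γ | (∃ G : BWGraph m (p + 1), G.IsClosed ∧ γ = Sum.inl (Quot.mk _ G)) ∨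
    ∃ G : BWGraph m p, G.IsClosed ∧ γ = Sum.inr (Quot.mk _ G)}

/-- The degree `p` part of the complex of Sullivan diagrams with `m` incoming closed boundary
components and one outgoing closed boundary component (the white vertex). -/
def SD (R : Type*) [CommRing R] (m p : ℕ) : Submodule R (Gen m p →₀ R) :=
  Submodule.span R ((fun γ => Finsupp.single γ 1) '' closedGen m p)

/-- The cycles of the complex of Sullivan diagrams. -/
def SD.cycles (R : Type*) [CommRing R] (m p : ℕ) : Submodule R (Gen m p →₀ R) :=
  SD R m p ⊓ LinearMap.ker (boundary R p)

/-- The boundaries of the complex of Sullivan diagrams. -/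
def SD.boundaries (R : Type*) [CommRing R] (m p : ℕ) : Submodule R (Gen m p →₀ R) :=
  (SD R m (p + 1)).map (boundary R (p + 1))

/-- The chain `c` is a cycle of the complex of Sullivan diagrams, and its homology class is not
zero. -/
def SD.IsNonzeroClass {R : Type*} [CommRing R] {m p : ℕ} (c : Gen m p →₀ R) : Prop :=
  c ∈ SD.cycles R m p ∧ c ∉ SD.boundaries R m p

/-! ### The reduced Hochschild complex -/

/-- The tensor power `A ⊗ A ⊗ … ⊗ A` with `p + 1` factors. -/
abbrev TPow (R A : Type*) [CommRing R] [CommRing A] [Algebra R A] (p : ℕ) :=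
  ⨂[R] _ : Fin (p + 1), A

section Hochschild

variable (R A : Type*) [CommRing R] [CommRing A] [Algebra R A]

variable {A} in
/-- Multiply the entries `i` and `i + 1`. -/
def contractFun {p : ℕ} (i : Fin (p + 1)) (a : Fin (p + 2) → A) : Fin (p + 1) → A := fun j =>
  if j = i then a i.castSucc * a i.succ else a (i.castSucc.succAbove j)

variable {A} in
theorem contractFun_update {p : ℕ} (i : Fin (p + 1)) (a : Fin (p + 2) → A) (l : Fin (p + 2)) :
    ∃ (j : Fin (p + 1)) (f : A →ₗ[R] A),
      ∀ v, contractFun i (Function.update a l v) =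
        Function.update (contractFun i a) j (f v) := by
  by_cases h1 : l = i.castSucc
  · subst h1
    refine ⟨i, LinearMap.mulRight R (a i.succ), fun v => ?_⟩
    funext j
    by_cases hj : j = i
    · subst hj; simp [contractFun, Fin.castSucc_lt_succ.ne']
    · simp [contractFun, hj, Fin.succAbove_ne]
  · obtain ⟨j', rfl⟩ := Fin.exists_succAbove_eq h1
    by_cases h2 : j' = i
    · subst h2
      refine ⟨j', LinearMap.mulLeft R (a j'.castSucc), fun v => ?_⟩
      funext j
      by_cases hj : j = j'
      · subst hj; simp [contractFun, Fin.castSucc_lt_succ.ne]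
      · simp only [contractFun, hj, if_false, ne_eq, not_false_eq_true, Function.update_of_ne]
        rw [Function.update_of_ne]
        exact fun h => hj (Fin.succAbove_right_injective h)
    · refine ⟨j', LinearMap.id, fun v => ?_⟩
      funext j
      by_cases hj : j = i
      · subst hj
        have e2 : j.succ ≠ j.castSucc.succAbove j' := by
          intro h
          rw [← Fin.succAbove_castSucc_self] at h
          exact h2 (Fin.succAbove_right_injective h).symm
        simp [contractFun, Function.update_of_ne e2,
          Function.update_of_ne (Ne.symm h2)]
      · by_cases hj' : j = j'
        · subst hj'; simp [contractFun, hj]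
        · simp only [contractFun, hj, if_false, ne_eq, hj', not_false_eq_true,
            Function.update_of_ne]
          rw [Function.update_of_ne]
          exact fun h => hj' (Fin.succAbove_right_injective h)

/-- `a₀ ⊗ … ⊗ a_{p+1} ↦ a₀ ⊗ … ⊗ aᵢaᵢ₊₁ ⊗ … ⊗ a_{p+1}`. -/
def contract {p : ℕ} (i : Fin (p + 1)) : TPow R A (p + 1) →ₗ[R] TPow R A p :=
  PiTensorProduct.lift
    { toFun := fun a => PiTensorProduct.tprod R (contractFun i a)
      map_update_add' := by
        intro _ a l v w
        obtain rfl : ‹DecidableEq (Fin (p + 2))› = instDecidableEqFin _ := Subsingleton.elim _ _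
        obtain ⟨j, f, hf⟩ := contractFun_update R i a l
        simp only [hf, map_add, MultilinearMap.map_update_add]
      map_update_smul' := by
        intro _ a l c v
        obtain rfl : ‹DecidableEq (Fin (p + 2))› = instDecidableEqFin _ := Subsingleton.elim _ _
        obtain ⟨j, f, hf⟩ := contractFun_update R i a l
        simp only [hf, map_smul, MultilinearMap.map_update_smul] }

theorem contract_tprod {p : ℕ} (i : Fin (p + 1)) (a : Fin (p + 2) → A) :
    contract R A i (PiTensorProduct.tprod R a) = PiTensorProduct.tprod R (contractFun i a) := by
  simp [contract]

/-- The span of the tensors with a unit at a position other than the first. -/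
def degenerate (p : ℕ) : Submodule R (TPow R A p) :=
  Submodule.span R {t | ∃ a : Fin (p + 1) → A, ∃ i, i ≠ 0 ∧ a i = 1 ∧
    t = PiTensorProduct.tprod R a}

/-- The reduced Hochschild chains `A ⊗ (A/R)^{⊗p}`. -/
abbrev RedChain (p : ℕ) := TPow R A p ⧸ degenerate R A p

/-- The class of `a₀ ⊗ … ⊗ a_p` in the reduced Hochschild chains. -/
def RedChain.of {p : ℕ} (a : Fin (p + 1) → A) : RedChain R A p :=
  (degenerate R A p).mkQ (PiTensorProduct.tprod R a)

/-- A cyclic rotation of the tensor factors, which moves the last one to the front, possibly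
with signs as in a graded algebra. -/
structure Rotation where
  map : ∀ p, TPow R A p →ₗ[R] TPow R A p
  map_last : ∀ p (a : Fin (p + 1) → A), a (Fin.last p) = 1 →
    map p (PiTensorProduct.tprod R a) =
      PiTensorProduct.tprod R fun j => a ((finRotate (p + 1)).symm j)
  map_mem : ∀ p (a : Fin (p + 1) → A) (i : Fin p), a i.castSucc = 1 →
    map p (PiTensorProduct.tprod R a) ∈
      Submodule.span R {t | ∃ b : Fin (p + 1) → A, b i.succ = 1 ∧ t = PiTensorProduct.tprod R b}

theorem finRotate_symm_succ {p : ℕ} (i : Fin p) :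
    (finRotate (p + 1)).symm i.succ = i.castSucc := by
  rw [Equiv.symm_apply_eq]; simp

theorem finRotate_symm_zero {p : ℕ} : (finRotate (p + 1)).symm 0 = Fin.last p := by
  rw [Equiv.symm_apply_eq]; simp

/-- The rotation without signs: `a₀ ⊗ … ⊗ a_p ↦ a_p ⊗ a₀ ⊗ … ⊗ a_{p-1}`. -/
def plainRotation : Rotation R A where
  map p := (PiTensorProduct.reindex R (fun _ => A) (finRotate (p + 1))).toLinearMap
  map_last p a _ := by simp
  map_mem p a i h := by
    refine Submodule.subset_span ⟨fun j => a ((finRotate (p + 1)).symm j), ?_, by simp⟩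
    change a ((finRotate (p + 1)).symm i.succ) = 1
    rw [finRotate_symm_succ, h]

variable {R A} (ρ : Rotation R A)

/-- The Hochschild differential on `A^{⊗(p+2)}`. -/
def hochPre (p : ℕ) : TPow R A (p + 1) →ₗ[R] TPow R A p :=
  ∑ i : Fin (p + 1), (-1 : R) ^ (i : ℕ) • contract R A i
    + (-1 : R) ^ (p + 1) • contract R A 0 ∘ₗ ρ.map (p + 1)

theorem hochPre_degenerate (p : ℕ) :
    degenerate R A (p + 1) ≤ (degenerate R A p).comap (hochPre ρ p) := by
  classical
  rw [degenerate, Submodule.span_le]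
  rintro _ ⟨a, i, hi, ha, rfl⟩
  simp only [Submodule.comap_coe, Set.mem_preimage, SetLike.mem_coe, hochPre, LinearMap.add_apply,
    LinearMap.sum_apply, LinearMap.smul_apply, contract_tprod, LinearMap.comp_apply]
  obtain ⟨i', rfl⟩ := Fin.exists_succ_eq.2 hi
  -- the faces that do not involve the unit are degenerate
  have key : ∀ l : Fin (p + 1), l ≠ i' → l.castSucc ≠ i'.succ →
      PiTensorProduct.tprod R (contractFun l a) ∈ degenerate R A p := by
    intro l h1 h2
    obtain ⟨j, hj⟩ := Fin.exists_succAbove_eq h2.symm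
    have hjl : j ≠ l := by
      rintro rfl
      rw [Fin.succAbove_castSucc_self] at hj
      exact h1 (Fin.succ_injective _ hj)
    refine Submodule.subset_span ⟨_, j, ?_, ?_, rfl⟩
    · rintro rfl
      by_cases hl : l = 0
      · exact hjl hl.symm
      · rw [Fin.succAbove_of_castSucc_lt _ _
          (Fin.castSucc_lt_castSucc_iff.2 (Fin.pos_of_ne_zero hl))] at hj
        exact (Fin.succ_ne_zero _ hj.symm).elim
    · simp [contractFun, hjl, hj, ha]
  rcases Fin.eq_castSucc_or_eq_last i'.succ with ⟨i'', hi''⟩ | hlast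
  · -- the unit is not at the last position
    have hne : i' ≠ i'' := by
      rintro rfl
      exact Fin.castSucc_lt_succ.ne' hi''
    have hval : (i'' : ℕ) = i' + 1 := by
      simpa using (congrArg Fin.val hi'').symm
    have heq : contractFun i' a = contractFun i'' a := by
      funext j
      simp only [contractFun, ha, ← hi'', one_mul, mul_one]
      rcases lt_trichotomy (j : ℕ) (i' : ℕ) with h | h | h
      · have e1 : j ≠ i' := fun e => by omega
        have e2 : j ≠ i'' := fun e => by subst e; omega
        rw [if_neg e1, if_neg e2, Fin.succAbove_of_castSucc_lt _ _ (Fin.lt_def.2 (by simpa using h)),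
          Fin.succAbove_of_castSucc_lt _ _ (Fin.lt_def.2 (by simp; omega))]
      · have e1 : j = i' := Fin.ext h
        subst e1
        rw [if_pos rfl, if_neg hne, Fin.succAbove_of_castSucc_lt _ _ (Fin.lt_def.2 (by simp))]
      · have e1 : j ≠ i' := fun e => by subst e; omega
        rw [if_neg e1, Fin.succAbove_of_le_castSucc _ _ (Fin.le_def.2 (by simpa using h.le))]
        by_cases e2 : j = i''
        · rw [if_pos e2, e2]
        · have : (j : ℕ) ≠ i'' := fun e => e2 (Fin.ext e)
          rw [if_neg e2, Fin.succAbove_of_le_castSucc _ _ (Fin.le_def.2 (by simp; omega))]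
    refine Submodule.add_mem _ ?_ (Submodule.smul_mem _ _ ?_)
    · rw [← Finset.add_sum_erase _ _ (Finset.mem_univ i'),
        ← Finset.add_sum_erase _ _ (Finset.mem_erase.2 ⟨hne.symm, Finset.mem_univ i''⟩),
        ← add_assoc, heq, hval, pow_succ, ← add_smul]
      rw [show (-1 : R) ^ (i' : ℕ) + (-1) ^ (i' : ℕ) * -1 = 0 by ring, zero_smul, zero_add]
      refine Submodule.sum_mem _ fun l hl => Submodule.smul_mem _ _ (key l ?_ ?_)
      · exact (Finset.mem_erase.1 (Finset.mem_erase.1 hl).2).1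
      · rw [hi'']
        exact fun h => (Finset.mem_erase.1 hl).1 (Fin.castSucc_injective _ h)
    · have h1 := ρ.map_mem (p + 1) a i'' (by rw [← hi'', ha])
      refine (Submodule.map_span_le _ _ (degenerate R A p)).2 ?_
        (Submodule.mem_map_of_mem (f := contract R A (0 : Fin (p + 1))) h1)
      rintro _ ⟨b, hb, rfl⟩
      rw [contract_tprod]
      have hi0 : i'' ≠ 0 := by
        rintro rfl
        simp at hval
      refine Submodule.subset_span ⟨_, i'', hi0, ?_, rfl⟩
      simp [contractFun, hi0, Fin.succAbove_of_le_castSucc, hb]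
  · -- the unit is at the last position
    rw [ρ.map_last _ _ (by rw [← hlast, ha]), contract_tprod]
    have hi' : i' = Fin.last p := by
      rw [← Fin.succ_last] at hlast
      exact Fin.succ_injective _ hlast
    subst hi'
    have heq : contractFun (Fin.last p) a =
        contractFun 0 (fun j => a ((finRotate (p + 2)).symm j)) := by
      funext j
      have e0 : ∀ l : Fin (p + 1), (finRotate (p + 2)).symm l.succ = l.castSucc :=
        fun l => finRotate_symm_succ l
      have e1 : (finRotate (p + 2)).symm (Fin.castSucc (0 : Fin (p + 1))) = Fin.last (p + 1) :=
        finRotate_symm_zero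
      simp only [contractFun, e0, e1, ← hlast, ha, one_mul, mul_one]
      by_cases hj : j = Fin.last p
      · subst hj
        by_cases h0 : Fin.last p = 0
        · simp [h0]
        · rw [if_pos rfl, if_neg h0, Fin.succAbove_of_le_castSucc _ _ (by simp), e0]
      · have hlt : j.castSucc < (Fin.last p).castSucc :=
          Fin.castSucc_lt_castSucc_iff.2 (lt_of_le_of_ne (Fin.le_last j) hj)
        rw [if_neg hj, Fin.succAbove_of_castSucc_lt _ _ hlt]
        by_cases h0 : j = 0
        · simp [h0]
        · rw [if_neg h0, Fin.succAbove_of_le_castSucc _ _ (by simp), e0]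
    rw [← Finset.add_sum_erase _ _ (Finset.mem_univ (Fin.last p)), ← heq, add_right_comm,
      Fin.val_last, pow_succ, ← add_smul,
      show (-1 : R) ^ p + (-1) ^ p * -1 = 0 by ring, zero_smul, zero_add]
    refine Submodule.sum_mem _ fun l hl => Submodule.smul_mem _ _ (key l ?_ ?_)
    · exact (Finset.mem_erase.1 hl).1
    · rw [Fin.succ_last]
      exact (Fin.castSucc_lt_last l).ne

/-- The differential of the reduced Hochschild complex. -/
def hoch : ∀ p : ℕ, RedChain R A p →ₗ[R] RedChain R A (p - 1)
  | 0 => 0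
  | p + 1 => Submodule.mapQ _ _ (hochPre ρ p) (hochPre_degenerate ρ p)

/-- The cycles of the reduced Hochschild complex. -/
def hochCycles (p : ℕ) : Submodule R (RedChain R A p) := LinearMap.ker (hoch ρ p)

/-- The boundaries of the reduced Hochschild complex. -/
def hochBoundaries (p : ℕ) : Submodule R (RedChain R A p) := LinearMap.range (hoch ρ (p + 1))

/-- Hochschild homology `HH_p(A, A)`. -/
abbrev HH (p : ℕ) := hochCycles ρ p ⧸ (hochBoundaries ρ p).submoduleOf (hochCycles ρ p)

/-- The homology class of a cycle. -/
def HH.mk {p : ℕ} (c : RedChain R A p) (hc : c ∈ hochCycles ρ p) : HH ρ p :=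
  Submodule.Quotient.mk ⟨c, hc⟩

/-- The class of `a ∈ A = C₀(A, A)` in `HH₀(A, A)`. -/
def HH.zeroClass (a : A) : HH ρ 0 := HH.mk ρ (RedChain.of R A fun _ => a) (by
  simp [hochCycles, hoch])

end Hochschild

/-! ### Commutative Frobenius algebras -/

section Frobenius

variable (R A : Type*) [CommRing R] [CommRing A] [Algebra R A]

/-- A commutative Frobenius algebra structure on the algebra `A`: a coassociative, counital and
cocommutative coproduct which is a map of `A`-modules. -/
structure Frobenius where
  comul : A →ₗ[R] A ⊗[R] A
  counit : A →ₗ[R] R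
  coassoc : ∀ a, TensorProduct.assoc R A A A (comul.rTensor A (comul a)) =
    comul.lTensor A (comul a)
  counit_left : ∀ a, TensorProduct.lid R A (counit.rTensor A (comul a)) = a
  counit_right : ∀ a, TensorProduct.rid R A (counit.lTensor A (comul a)) = a
  comul_comm : ∀ a, TensorProduct.comm R A A (comul a) = comul a
  comul_mul : ∀ a b, comul (a * b) = (a ⊗ₜ[R] (1 : A)) * comul b

variable {R A} {ι : Type} (Φ : Frobenius R A) (b : Module.Basis ι R A)

/-- The coefficients of `ν(1)` in a basis: `ν(1) = ∑ κ i j • b i ⊗ b j`. -/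
def Frobenius.copairing (i j : ι) : R := (b.tensorProduct b).repr (Φ.comul 1) (i, j)

theorem Frobenius.copairing_symm (i j : ι) : Φ.copairing b i j = Φ.copairing b j i := by
  have h : ∀ t : A ⊗[R] A, (b.tensorProduct b).repr (TensorProduct.comm R A A t) (i, j) =
      (b.tensorProduct b).repr t (j, i) := by
    intro t
    induction t using TensorProduct.induction_on with
    | zero => simp
    | tmul x y => simp [mul_comm]
    | add x y hx hy => simp only [map_add, Finsupp.add_apply, hx, hy]
  rw [Frobenius.copairing, Frobenius.copairing, ← h, Φ.comul_comm]

theorem Frobenius.sum_copairing [Fintype ι] (z : A) :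
    ∑ i, ∑ j, (Φ.copairing b i j * Φ.counit (b i * z)) • b j = z := by
  have h1 : Φ.comul 1 = ∑ i, ∑ j, Φ.copairing b i j • (b i ⊗ₜ[R] b j) := by
    rw [← (b.tensorProduct b).sum_repr (Φ.comul 1), Fintype.sum_prod_type]
    simp [Frobenius.copairing]
  have h2 := Φ.counit_left z
  have h3 : Φ.comul z = (z ⊗ₜ[R] (1 : A)) * Φ.comul 1 := by rw [← Φ.comul_mul, mul_one]
  rw [h3, h1] at h2
  conv_rhs => rw [← h2]
  simp [Finset.mul_sum, mul_smul, mul_comm z]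

/-- `ε(abc)` for three basis elements: the operation of a trivalent black vertex. -/
def Frobenius.vertex (i j l : ι) : R := Φ.counit (b i * b j * b l)

end Frobenius

/-! ### The algebra `R[x]/(x²)` -/

section DualNumber

variable (R : Type*) [CommRing R]

/-- The class of `x` in `R[x]/(x²)`. -/
abbrev xElt : DualNumber R := DualNumber.eps

/-- The basis `1, x` of `R[x]/(x²)`; `true` is the index of `x`. -/
def dualBasis : Module.Basis Bool R (DualNumber R) :=
  Module.Basis.ofEquivFun
    { toFun := fun a i => if i then TrivSqZeroExt.snd a else TrivSqZeroExt.fst a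
      invFun := fun f => TrivSqZeroExt.inl (f false) + TrivSqZeroExt.inr (f true)
      map_add' := by intro a b; funext i; cases i <;> simp
      map_smul' := by intro c a; funext i; cases i <;> simp
      left_inv := by intro a; ext <;> simp
      right_inv := by intro f; funext i; cases i <;> simp }

/-- The Frobenius structure with `ν(1) = 1 ⊗ x + x ⊗ 1` and `ν(x) = x ⊗ x`, with counit
`1 ↦ 0`, `x ↦ 1`. -/
def dualFrobenius : Frobenius R (DualNumber R) where
  comul :=
    (TrivSqZeroExt.fstHom R R R).toLinearMap.smulRight
        ((1 : DualNumber R) ⊗ₜ[R] xElt R + xElt R ⊗ₜ[R] (1 : DualNumber R))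
      + (TrivSqZeroExt.sndHom R R).smulRight (xElt R ⊗ₜ[R] xElt R)
  counit := TrivSqZeroExt.sndHom R R
  coassoc a := by
    simp [TensorProduct.tmul_add, TensorProduct.add_tmul, add_assoc, add_comm, add_left_comm]
  counit_left a := by
    simp
    ext <;> simp
  counit_right a := by
    simp
    ext <;> simp
  comul_comm a := by
    simp [add_comm]
  comul_mul a b := by
    have h1 : a * xElt R = TrivSqZeroExt.fst a • xElt R := by ext <;> simp
    have h2 : a = TrivSqZeroExt.fst a • (1 : DualNumber R) + TrivSqZeroExt.snd a • xElt R := by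
      ext <;> simp
    have h3 : a ⊗ₜ[R] xElt R = TrivSqZeroExt.fst a • ((1 : DualNumber R) ⊗ₜ[R] xElt R)
        + TrivSqZeroExt.snd a • (xElt R ⊗ₜ[R] xElt R) := by
      conv_lhs => rw [h2]
      rw [TensorProduct.add_tmul, TensorProduct.smul_tmul', TensorProduct.smul_tmul']
    simp only [LinearMap.add_apply, LinearMap.smulRight_apply, AlgHom.toLinearMap_apply,
      TrivSqZeroExt.fstHom_apply, TrivSqZeroExt.sndHom_apply, TrivSqZeroExt.fst_mul,
      TrivSqZeroExt.snd_mul, mul_add, mul_smul_comm, Algebra.TensorProduct.tmul_mul_tmul, one_mul,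
      mul_one, h1, h3, ← TensorProduct.smul_tmul', MulOpposite.smul_eq_mul_unop,
      MulOpposite.unop_op, smul_eq_mul]
    module

end DualNumber

/-- The sign `x ↦ (-1)^N x`, `1 ↦ 1` on `R[x]/(x²)`. -/
def signMap (R : Type*) [CommRing R] (N : ℕ) : DualNumber R →ₗ[R] DualNumber R :=
  (TrivSqZeroExt.inlAlgHom R R R).toLinearMap ∘ₗ (TrivSqZeroExt.fstHom R R R).toLinearMap
   + (-1 : R) ^ N • TrivSqZeroExt.inrHom R R ∘ₗ TrivSqZeroExt.sndHom R R

/-- The rotation of the tensor factors of the graded algebra `R[x]/(x²)`, `x` in degree `N`. -/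
def sphereRotation (R : Type*) [CommRing R] (N : ℕ) : Rotation R (DualNumber R) where
  map p :=
    (PiTensorProduct.map (fun j : Fin (p + 1) => if j = 0 then
        (TrivSqZeroExt.inlAlgHom R R R).toLinearMap ∘ₗ (TrivSqZeroExt.fstHom R R R).toLinearMap
        else LinearMap.id)
      + PiTensorProduct.map (fun j : Fin (p + 1) => if j = 0 then
        TrivSqZeroExt.inrHom R R ∘ₗ TrivSqZeroExt.sndHom R R else signMap R N))
    ∘ₗ (plainRotation R (DualNumber R)).map p
  map_last p a h := by
    rw [LinearMap.comp_apply, (plainRotation R (DualNumber R)).map_last p a h, LinearMap.add_apply,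
      PiTensorProduct.map_tprod, PiTensorProduct.map_tprod]
    have h0 : a ((finRotate (p + 1)).symm 0) = 1 := by rw [finRotate_symm_zero, h]
    have hz : (PiTensorProduct.tprod R fun j : Fin (p + 1) =>
        (if j = 0 then TrivSqZeroExt.inrHom R R ∘ₗ TrivSqZeroExt.sndHom R R else signMap R N)
          (a ((finRotate (p + 1)).symm j))) = 0 :=
      MultilinearMap.map_coord_zero _ 0 (by rw [if_pos rfl, h0]; simp)
    rw [hz, add_zero]
    congr 1
    funext j
    by_cases hj : j = 0
    · subst hj
      simp only [if_true, h0]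
      simp
    · simp [hj]
  map_mem p a i h := by
    obtain ⟨b, hb, he⟩ : ∃ b : Fin (p + 1) → DualNumber R, b i.succ = 1 ∧
        (plainRotation R (DualNumber R)).map p (PiTensorProduct.tprod R a) =
          PiTensorProduct.tprod R b := by
      refine ⟨fun j => a ((finRotate (p + 1)).symm j), ?_, by simp [plainRotation]⟩
      change a ((finRotate (p + 1)).symm i.succ) = 1
      rw [finRotate_symm_succ, h]
    rw [LinearMap.comp_apply, he, LinearMap.add_apply, PiTensorProduct.map_tprod, PiTensorProduct.map_tprod]
    refine Submodule.add_mem _ (Submodule.subset_span ⟨_, ?_, rfl⟩)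
      (Submodule.subset_span ⟨_, ?_, rfl⟩)
    · simp [hb]
    · rw [if_neg (Fin.succ_ne_zero i), hb]
      simp [signMap]
/-! ### The action on Hochschild chains -/

/-- The edges of a graph, as unordered pairs of half-edges. -/
def BWGraph.edges (G : BWGraph m k) : Finset (Sym2 (HalfEdge k G.V)) :=
  (Finset.univ.filter fun h => G.inv h ≠ h).image fun h => s(h, G.inv h)

section Action

variable {R A : Type*} [CommRing R] [CommRing A] [Algebra R A] {ι : Type}
  (Φ : Frobenius R A) (b : Module.Basis ι R A)

/-- The coefficient of `ν(1)` belonging to an unordered pair of basis elements. -/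
def Frobenius.edgeCoeff : Sym2 ι → R :=
  Sym2.lift ⟨fun i j => Φ.copairing b i j, Φ.copairing_symm b⟩

/-- The product of the contributions of the edges, for a labelling `c` of the half-edges by basis
elements. -/
def edgeWeight (G : BWGraph m k) (c : HalfEdge k G.V → ι) : R :=
  ∏ e ∈ G.edges, Φ.edgeCoeff b (e.map c)

/-- The product of the contributions of the black vertices. -/
def vertexWeight {V : Type} [Fintype V] (β : V × Fin 3 → ι) : R :=
  ∏ v : V, Φ.vertex b (β (v, 0)) (β (v, 1)) (β (v, 2))

/-- The contribution of the labelled leaves, with `a j` placed at the leaf `j`. An exceptional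
component contributes the counit. -/
def leafWeight (G : BWGraph m k) (c : HalfEdge k G.V → ι) :
    MultilinearMap R (fun _ : Fin m => A) R :=
  (MultilinearMap.mkPiAlgebra R (Fin m) R).compLinearMap fun j =>
    (G.leaf j).elim Φ.counit fun h => b.coord (c h)

/-- The graph without its white vertex, read as a composition of operations of the Frobenius
algebra with inputs at the leaves: the coefficient of `b (μ 0) ⊗ … ⊗ b (μ (k - 1))` in the result,
where the output `i` is at the half-edge `i` of the white vertex. It is the sum over all labellings
of the half-edges by basis elements of the product of the contributions of edges (the copairing
`ν(1)`), black vertices (the form `ε(abc)`) and leaves. -/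
def amplitude [Fintype ι] (G : BWGraph m k) (μ : Fin k → ι) : MultilinearMap R (fun _ : Fin m => A) R :=
  ∑ β : G.V × Fin 3 → ι,
    (edgeWeight Φ b G (Sum.elim μ β) * vertexWeight Φ b β) • leafWeight Φ b G (Sum.elim μ β)

theorem edges_relabel (G : BWGraph m k) (W : Type) [Fintype W] [DecidableEq W]
    (e : HalfEdge k G.V ≃ HalfEdge k W) :
    (G.relabel W e).edges = G.edges.image (Sym2.map e) := by
  ext x
  simp only [BWGraph.edges, Finset.mem_image, Finset.mem_filter, Finset.mem_univ, true_and]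
  constructor
  · rintro ⟨h, hh, rfl⟩
    refine ⟨_, ⟨e.symm h, fun h' => hh ?_, rfl⟩, by simp⟩
    rw [h', e.apply_symm_apply]
  · rintro ⟨_, ⟨h, hh, rfl⟩, rfl⟩
    exact ⟨e h, by simpa using hh, by simp⟩

theorem edgeWeight_relabel (G : BWGraph m k) (W : Type) [Fintype W] [DecidableEq W]
    (e : HalfEdge k G.V ≃ HalfEdge k W) (c : HalfEdge k W → ι) :
    edgeWeight Φ b (G.relabel W e) c = edgeWeight Φ b G (c ∘ e) := by
  rw [edgeWeight, edges_relabel, Finset.prod_image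
    (fun x _ y _ h => Sym2.map.injective e.injective h)]
  simp [edgeWeight, Sym2.map_map]

theorem leafWeight_relabel (G : BWGraph m k) (W : Type) [Fintype W] [DecidableEq W]
    (e : HalfEdge k G.V ≃ HalfEdge k W) (c : HalfEdge k W → ι) :
    leafWeight Φ b (G.relabel W e) c = leafWeight Φ b G (c ∘ e) := by
  rw [leafWeight, leafWeight]
  congr 1
  funext j
  change ((G.leaf j).map e).elim _ _ = _
  rcases G.leaf j with _ | h <;> rfl

theorem amplitude_relabel [Fintype ι] (G : BWGraph m k) (W : Type) [Fintype W] [DecidableEq W]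
    (e : G.V × Fin 3 ≃ W × Fin 3) (μ : Fin k → ι) :
    amplitude Φ b (G.relabel W (Equiv.sumCongr (Equiv.refl (Fin k)) e)) μ =
      ∑ β : G.V × Fin 3 → ι, (edgeWeight Φ b G (Sum.elim μ β) * vertexWeight Φ b (β ∘ e.symm)) •
        leafWeight Φ b G (Sum.elim μ β) := by
  classical
  refine Fintype.sum_equiv (Equiv.arrowCongr e.symm (Equiv.refl ι)) _ _ fun β => ?_
  have h1 : Sum.elim μ (Equiv.arrowCongr e.symm (Equiv.refl ι) β) =
      Sum.elim μ β ∘ Equiv.sumCongr (Equiv.refl (Fin k)) e := by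
    funext x; rcases x with x | x <;> simp
  have h2 : Equiv.arrowCongr e.symm (Equiv.refl ι) β ∘ e.symm = β := by
    funext x; simp
  rw [h1, h2, edgeWeight_relabel, leafWeight_relabel]

theorem Frobenius.vertex_rotate (i j l : ι) : Φ.vertex b i j l = Φ.vertex b j l i := by
  rw [Frobenius.vertex, Frobenius.vertex]; congr 1; ring

theorem vertexWeight_comp {V W : Type} [Fintype V] [Fintype W] (e : V × Fin 3 ≃ W × Fin 3)
    (he : ∀ v t, e (v, t + 1) = ((e (v, t)).1, (e (v, t)).2 + 1)) (β : V × Fin 3 → ι) :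
    vertexWeight Φ b (β ∘ e.symm) = vertexWeight Φ b β := by
  have h1 : ∀ v s, e (v, s) = ((e (v, 0)).1, (e (v, 0)).2 + s) := by
    intro v s
    have e1 : e (v, 1) = ((e (v, 0)).1, (e (v, 0)).2 + 1) := he v 0
    have e2 : e (v, 2) = ((e (v, 1)).1, (e (v, 1)).2 + 1) := he v 1
    fin_cases s
    · simp
    · exact e1
    · change e (v, 2) = ((e (v, 0)).1, (e (v, 0)).2 + 2)
      rw [e2, e1]
      simp [add_assoc]
  refine (Fintype.prod_bijective (fun v => (e (v, 0)).1) ⟨?_, ?_⟩ _ _ ?_).symm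
  · intro v v' h
    have h2 := h1 v ((e (v', 0)).2 - (e (v, 0)).2)
    have h3 : e (v, (e (v', 0)).2 - (e (v, 0)).2) = e (v', 0) := by
      rw [h2]
      refine Prod.ext h ?_
      simp
    exact congrArg Prod.fst (e.injective h3)
  · intro w
    refine ⟨(e.symm (w, 0)).1, ?_⟩
    have h2 := h1 (e.symm (w, 0)).1 (e.symm (w, 0)).2
    rw [Prod.mk.eta, e.apply_symm_apply] at h2
    exact (congrArg Prod.fst h2).symm
  · intro v
    have h2 : ∀ s, e.symm ((e (v, 0)).1, s) = (v, s - (e (v, 0)).2) := by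
      intro s
      rw [Equiv.symm_apply_eq, h1 v (s - (e (v, 0)).2)]
      simp
    simp only [Function.comp_apply, h2]
    generalize (e (v, 0)).2 = t
    fin_cases t
    · rfl
    · exact (Φ.vertex_rotate b _ _ _).trans (Φ.vertex_rotate b _ _ _)
    · exact Φ.vertex_rotate b _ _ _

theorem amplitude_iso [Fintype ι] (G : BWGraph m k) (W : Type) [Fintype W] [DecidableEq W]
    (e : G.V × Fin 3 ≃ W × Fin 3) (he : ∀ v t, e (v, t + 1) = ((e (v, t)).1, (e (v, t)).2 + 1))
    (μ : Fin k → ι) :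
    amplitude Φ b (G.relabel W (Equiv.sumCongr (Equiv.refl (Fin k)) e)) μ =
      amplitude Φ b G μ := by
  rw [amplitude_relabel, amplitude]
  refine Finset.sum_congr rfl fun β _ => ?_
  rw [vertexWeight_comp Φ b e he]

/-- Two sums over functions agree if they agree after summing over two of the values. -/
theorem sum_congr_two {α M : Type*} [Fintype α] [DecidableEq α] [Fintype ι] [AddCommMonoid M]
    {x y : α} (hxy : x ≠ y) (f g : (α → ι) → M)
    (h : ∀ β, ∑ i, ∑ j, f (Function.update (Function.update β x i) y j) =
      ∑ i, ∑ j, g (Function.update (Function.update β x i) y j)) :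
    ∑ β, f β = ∑ β, g β := by
  classical
  let r : (α → ι) → ({a // a ≠ x ∧ a ≠ y} → ι) := fun β a => β a
  have key : ∀ (F : (α → ι) → M) (β₀ : α → ι),
      ∑ β with r β = r β₀, F β =
        ∑ i, ∑ j, F (Function.update (Function.update β₀ x i) y j) := by
    intro F β₀
    rw [← Fintype.sum_prod_type']
    refine Finset.sum_bij' (fun β _ => (β x, β y))
      (fun q _ => Function.update (Function.update β₀ x q.1) y q.2) ?_ ?_ ?_ ?_ ?_
    · simp
    · rintro ⟨i, j⟩ _
      simp only [Finset.mem_filter, Finset.mem_univ, true_and]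
      funext ⟨a, ha⟩
      simp [r, Function.update_of_ne ha.1, Function.update_of_ne ha.2]
    · intro β hβ
      simp only [Finset.mem_filter, Finset.mem_univ, true_and] at hβ
      funext a
      by_cases hy : a = y
      · subst hy; simp
      · by_cases hx : a = x
        · subst hx; simp [Function.update_of_ne hy]
        · simpa [r, Function.update_of_ne hy, Function.update_of_ne hx] using
            (congrFun hβ ⟨a, hx, hy⟩).symm
    · rintro ⟨i, j⟩ _
      simp [Function.update_of_ne hxy]
    · intro β hβ
      simp only [Finset.mem_filter, Finset.mem_univ, true_and] at hβ
      congr 1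
      funext a
      by_cases hy : a = y
      · subst hy; simp
      · by_cases hx : a = x
        · subst hx; simp [Function.update_of_ne hy]
        · simpa [r, Function.update_of_ne hy, Function.update_of_ne hx] using
            (congrFun hβ ⟨a, hx, hy⟩)
  rw [← Finset.sum_fiberwise (Finset.univ : Finset (α → ι)) r f,
    ← Finset.sum_fiberwise (Finset.univ : Finset (α → ι)) r g]
  refine Finset.sum_congr rfl fun q _ => ?_
  by_cases hq : ∃ β₀, r β₀ = q
  · obtain ⟨β₀, rfl⟩ := hq
    rw [key, key, h]
  · have : (Finset.univ.filter fun β => r β = q) = ∅ := by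
      ext β
      simp only [Finset.mem_filter, Finset.mem_univ, true_and, Finset.notMem_empty, iff_false]
      exact fun hβ => hq ⟨β, hβ⟩
    rw [this, Finset.sum_empty, Finset.sum_empty]

theorem Frobenius.sum_vertex [Fintype ι] (p q r s : ι) :
    ∑ i, ∑ j, Φ.copairing b i j * (Φ.vertex b i p q * Φ.vertex b j r s) =
      Φ.counit (b p * b q * b r * b s) := by
  have h := congrArg (fun z => Φ.counit (z * (b r * b s))) (Φ.sum_copairing b (b p * b q))
  simp only [Finset.sum_mul, map_sum, smul_mul_assoc, map_smul, smul_eq_mul] at h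
  rw [show b p * b q * b r * b s = b p * b q * (b r * b s) by ring, ← h]
  refine Finset.sum_congr rfl fun i _ => Finset.sum_congr rfl fun j _ => ?_
  rw [Frobenius.vertex, Frobenius.vertex, mul_assoc (b i), mul_assoc (b j), mul_assoc]

theorem amplitude_flip [Fintype ι] (G : BWGraph m k) (u v : G.V) (huv : u ≠ v)
    (h : G.inv (Sum.inr (u, 0)) = Sum.inr (v, 0)) (μ : Fin k → ι) :
    amplitude Φ b (G.relabel G.V (flipPerm k u v)) μ = amplitude Φ b G μ := by
  classical
  rw [flipPerm, amplitude_relabel, amplitude]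
  set π : Equiv.Perm (G.V × Fin 3) :=
    Equiv.swap (u, 1) (v, 2) * Equiv.swap (v, 2) (v, 1) * Equiv.swap (v, 1) (u, 2) with hπ
  have hne : ((u, 0) : G.V × Fin 3) ≠ (v, 0) := fun e => huv (congrArg Prod.fst e)
  refine sum_congr_two hne _ _ fun β => ?_
  set up : ι → ι → G.V × Fin 3 → ι := fun i j =>
    Function.update (Function.update β (u, 0) i) (v, 0) j with hup
  have up_of_ne : ∀ i j x, x ≠ (u, 0) → x ≠ (v, 0) → up i j x = β x := by
    intro i j x h1 h2
    simp [hup, Function.update_of_ne h1, Function.update_of_ne h2]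
  have up_u : ∀ i j, up i j (u, 0) = i := by
    intro i j; simp [hup, Function.update_of_ne hne]
  have up_v : ∀ i j, up i j (v, 0) = j := by
    intro i j; simp [hup]
  -- the leaves do not meet the edge
  have hleaf : ∀ i j, leafWeight Φ b G (Sum.elim μ (up i j)) = leafWeight Φ b G (Sum.elim μ β) := by
    intro i j
    rw [leafWeight, leafWeight]
    congr 1
    funext a
    rcases ha : G.leaf a with _ | x
    · rfl
    · have hx : G.inv x = x := (G.inv_eq_self_iff x).2 ⟨a, ha⟩
      change b.coord (Sum.elim μ (up i j) x) = b.coord (Sum.elim μ β x)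
      congr 1
      rcases x with x | x
      · rfl
      · refine up_of_ne i j x ?_ ?_
        · rintro rfl
          rw [h] at hx
          exact hne (Sum.inr_injective hx).symm
        · rintro rfl
          rw [← h, G.inv_inv] at hx
          exact hne (Sum.inr_injective (hx.trans h))
  -- the contribution of the edge factors out
  set e₀ : Sym2 (HalfEdge k G.V) := s(Sum.inr (u, 0), Sum.inr (v, 0)) with he₀
  have he₀mem : e₀ ∈ G.edges := by
    refine Finset.mem_image.2 ⟨Sum.inr (u, 0), ?_, by rw [h]⟩
    simp only [Finset.mem_filter, Finset.mem_univ, true_and, h]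
    exact fun e => hne (Sum.inr_injective e).symm
  have hedge : ∀ i j, edgeWeight Φ b G (Sum.elim μ (up i j)) =
      Φ.copairing b i j * ∏ e ∈ G.edges.erase e₀, Φ.edgeCoeff b (e.map (Sum.elim μ β)) := by
    intro i j
    rw [edgeWeight, ← Finset.mul_prod_erase _ _ he₀mem]
    congr 1
    · simp only [he₀, Sym2.map_mk, Sum.elim_inr, up_u, up_v]
      rfl
    · refine Finset.prod_congr rfl fun e he => ?_
      obtain ⟨hee, he⟩ := Finset.mem_erase.1 he
      obtain ⟨x, -, rfl⟩ := Finset.mem_image.1 he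
      have hx : ∀ y : HalfEdge k G.V, y ∈ s(x, G.inv x) →
          Sum.elim μ (up i j) y = Sum.elim μ β y := by
        intro y hy
        rcases y with y | y
        · rfl
        · refine up_of_ne i j y ?_ ?_
          · rintro rfl
            rcases Sym2.mem_iff.1 hy with rfl | hy
            · exact hee (by rw [h])
            · refine hee ?_
              rw [← hy, ← G.inv_inv x, ← hy, h, Sym2.eq_swap]
          · rintro rfl
            have h' : G.inv (Sum.inr (v, 0)) = Sum.inr (u, 0) := by rw [← h, G.inv_inv]
            rcases Sym2.mem_iff.1 hy with rfl | hy
            · exact hee (by rw [h', Sym2.eq_swap])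
            · refine hee ?_
              rw [← hy, ← G.inv_inv x, ← hy, h']
      congr 1
      exact Sym2.map_congr hx
  -- the contribution of the vertices
  have hvert : ∀ γ : G.V × Fin 3 → ι, vertexWeight Φ b γ =
      (Φ.vertex b (γ (u, 0)) (γ (u, 1)) (γ (u, 2)) *
        Φ.vertex b (γ (v, 0)) (γ (v, 1)) (γ (v, 2))) *
      ∏ w ∈ (Finset.univ.erase u).erase v, Φ.vertex b (γ (w, 0)) (γ (w, 1)) (γ (w, 2)) := by
    intro γ
    rw [vertexWeight, ← Finset.mul_prod_erase _ _ (Finset.mem_univ u),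
      ← Finset.mul_prod_erase _ _ (Finset.mem_erase.2 ⟨huv.symm, Finset.mem_univ v⟩), mul_assoc]
  have hvu := huv.symm
  have p1 : π.symm (u, 0) = (u, 0) := by
    rw [Equiv.symm_apply_eq]; simp [hπ, Equiv.swap_apply_def, huv]
  have p2 : π.symm (v, 0) = (v, 0) := by
    rw [Equiv.symm_apply_eq]; simp [hπ, Equiv.swap_apply_def, hvu]
  have p3 : π.symm (u, 1) = (u, 2) := by
    simp [hπ, Equiv.symm_apply_eq, Equiv.swap_apply_def, huv, hvu]
  have p4 : π.symm (u, 2) = (v, 1) := by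
    simp [hπ, Equiv.symm_apply_eq, Equiv.swap_apply_def, huv, hvu]
  have p5 : π.symm (v, 1) = (v, 2) := by
    simp [hπ, Equiv.symm_apply_eq, Equiv.swap_apply_def, huv, hvu]
  have p6 : π.symm (v, 2) = (u, 1) := by
    simp [hπ, Equiv.symm_apply_eq, Equiv.swap_apply_def, huv, hvu]
  have p7 : ∀ w t, w ≠ u → w ≠ v → π.symm (w, t) = (w, t) := by
    intro w t h1 h2
    rw [Equiv.symm_apply_eq]; simp [hπ, Equiv.swap_apply_def, h1, h2]
  have hrest : ∀ i j (σ : G.V × Fin 3 → G.V × Fin 3),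
      (∀ w t, w ≠ u → w ≠ v → σ (w, t) = (w, t)) →
      ∏ w ∈ (Finset.univ.erase u).erase v, Φ.vertex b ((up i j ∘ σ) (w, 0)) ((up i j ∘ σ) (w, 1))
          ((up i j ∘ σ) (w, 2)) =
        ∏ w ∈ (Finset.univ.erase u).erase v, Φ.vertex b (β (w, 0)) (β (w, 1)) (β (w, 2)) := by
    intro i j σ hσ
    refine Finset.prod_congr rfl fun w hw => ?_
    simp only [Finset.mem_erase, Finset.mem_univ, and_true] at hw
    have : ∀ t, (up i j ∘ σ) (w, t) = β (w, t) := by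
      intro t
      rw [Function.comp_apply, hσ w t hw.2 hw.1]
      exact up_of_ne i j _ (fun e => hw.2 (congrArg Prod.fst e))
        (fun e => hw.1 (congrArg Prod.fst e))
    rw [this, this, this]
  have n1 : ∀ i j w (t : Fin 3), t ≠ 0 → up i j (w, t) = β (w, t) := fun i j w t ht =>
    up_of_ne i j _ (fun e => ht (congrArg Prod.snd e)) (fun e => ht (congrArg Prod.snd e))
  have hl : ∀ i j, (edgeWeight Φ b G (Sum.elim μ (up i j)) *
      vertexWeight Φ b (up i j ∘ π.symm)) • leafWeight Φ b G (Sum.elim μ (up i j)) =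
      (Φ.copairing b i j * (Φ.vertex b i (β (u, 2)) (β (v, 1)) *
        Φ.vertex b j (β (v, 2)) (β (u, 1)))) •
      ((∏ e ∈ G.edges.erase e₀, Φ.edgeCoeff b (e.map (Sum.elim μ β))) *
        ∏ w ∈ (Finset.univ.erase u).erase v, Φ.vertex b (β (w, 0)) (β (w, 1)) (β (w, 2))) •
        leafWeight Φ b G (Sum.elim μ β) := by
    intro i j
    rw [hleaf, hedge, hvert, hrest i j π.symm p7, smul_smul]
    simp only [Function.comp_apply, p1, p2, p3, p4, p5, p6, up_u, up_v,
      n1 i j _ 1 (by decide), n1 i j _ 2 (by decide)]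
    congr 1
    ring
  have hr : ∀ i j, (edgeWeight Φ b G (Sum.elim μ (up i j)) *
      vertexWeight Φ b (up i j)) • leafWeight Φ b G (Sum.elim μ (up i j)) =
      (Φ.copairing b i j * (Φ.vertex b i (β (u, 1)) (β (u, 2)) *
        Φ.vertex b j (β (v, 1)) (β (v, 2)))) •
      ((∏ e ∈ G.edges.erase e₀, Φ.edgeCoeff b (e.map (Sum.elim μ β))) *
        ∏ w ∈ (Finset.univ.erase u).erase v, Φ.vertex b (β (w, 0)) (β (w, 1)) (β (w, 2))) •
        leafWeight Φ b G (Sum.elim μ β) := by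
    intro i j
    have := hrest i j id (fun _ _ _ _ => rfl)
    simp only [Function.comp_id] at this
    rw [hleaf, hedge, hvert, this, smul_smul]
    simp only [up_u, up_v, n1 i j _ 1 (by decide), n1 i j _ 2 (by decide)]
    congr 1
    ring
  refine (Finset.sum_congr rfl fun i _ => Finset.sum_congr rfl fun j _ => hl i j).trans
    (Eq.trans ?_ (Finset.sum_congr rfl fun i _ => Finset.sum_congr rfl fun j _ => hr i j).symm)
  simp only [← Finset.sum_smul]
  congr 1
  rw [Φ.sum_vertex, Φ.sum_vertex]
  congr 1
  ring

theorem amplitude_move [Fintype ι] {G G' : BWGraph m k} (h : Move G G') :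
    amplitude Φ b G = amplitude Φ b G' := by
  funext μ
  cases h with
  | iso W e he => exact (amplitude_iso Φ b G W e he μ).symm
  | flip u v huv h => exact (amplitude_flip Φ b G u v huv h μ).symm

/-- `amplitude` on diagrams. -/
def Diagram.amplitude [Fintype ι] (D : Diagram m k) :
    (Fin k → ι) → MultilinearMap R (fun _ : Fin m => A) R :=
  Quot.lift (Sullivan.amplitude Φ b) (fun _ _ h => amplitude_move Φ b h) D

/-- The action of a generator on Hochschild chains of degree zero, `a₀, …, a_{m-1} ∈ A = C₀(A, A)`:
the outputs of the diagram are placed in order into the tensor factors of the Hochschild chain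
given by the white vertex, with a unit in the first factor if the start is an unlabelled leaf. -/
def actionGen [Fintype ι] (p : ℕ) : Gen m p → MultilinearMap R (fun _ : Fin m => A) (RedChain R A p)
  | Sum.inl D => ∑ μ : Fin (p + 1) → ι,
      (D.amplitude Φ b μ).smulRight (RedChain.of R A fun i => b (μ i))
  | Sum.inr D => ∑ μ : Fin p → ι,
      (D.amplitude Φ b μ).smulRight (RedChain.of R A (Fin.cons 1 fun i => b (μ i)))

/-- The action `F(c ⊗ (a₀ ⊗ … ⊗ a_{m-1}))` of a chain `c` of degree `p` on Hochschild chains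
`a₀, …, a_{m-1} ∈ A = C₀(A, A)` of degree zero. -/
def action [Fintype ι] (p : ℕ) :
    (Gen m p →₀ R) →ₗ[R] MultilinearMap R (fun _ : Fin m => A) (RedChain R A p) :=
  Finsupp.linearCombination R (actionGen Φ b p)

end Action
/-! ### The graphs `μ_g` and `t_g` -/

/-- The involution of `muGraph n`. -/
def muInv (n : ℕ) : HalfEdge (2 * (n + 1) + 1 + 1) (Fin n) → HalfEdge (2 * (n + 1) + 1 + 1) (Fin n)
  | Sum.inl i =>
    if i.val % 2 = 1 then Sum.inl i
    else if i.val = 0 then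
      if hn : 0 < n then Sum.inr (⟨0, hn⟩, 0) else Sum.inl ⟨2 * n + 2, by omega⟩
    else if i.val = 2 * n + 2 then
      if hn : 0 < n then Sum.inr (⟨n - 1, by omega⟩, 1) else Sum.inl ⟨0, by omega⟩
    else if h : i.val / 2 - 1 < n then Sum.inr (⟨i.val / 2 - 1, h⟩, 2) else Sum.inl i
  | Sum.inr (v, t) =>
    if t = 0 then
      if v.val = 0 then Sum.inl ⟨0, by omega⟩ else Sum.inr (⟨v.val - 1, by omega⟩, 1)
    else if t = 1 then
      if h : v.val + 1 < n then Sum.inr (⟨v.val + 1, h⟩, 0) else Sum.inl ⟨2 * n + 2, by omega⟩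
    else Sum.inl ⟨2 * v.val + 2, by omega⟩

theorem muInv_muInv (n : ℕ) : Function.Involutive (muInv n) := by
  rintro (⟨i, hi⟩ | ⟨⟨v, hv⟩, t⟩)
  · simp only [muInv]
    split_ifs <;> simp [muInv] <;> grind
  · fin_cases t <;> simp only [muInv] <;> grind [muInv]

/-- The graph `μ_g` for `g = n + 1`: a white vertex with the `2g + 2` half-edges `0, …, 2g + 1`, of
which the half-edges `0, 2, …, 2g` are connected by a planar trivalent tree outside of the white
vertex, and the others are leaves, labelled in their cyclic order. -/
def muGraph (n : ℕ) : BWGraph (n + 2) (2 * (n + 1) + 1 + 1) where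
  V := Fin n
  inv := muInv n
  inv_inv := muInv_muInv n
  leaf j := some (Sum.inl ⟨2 * j.val + 1, by omega⟩)
  leaf_inj i j h hi hj := by
    rw [← hj] at hi
    simp at hi
    omega
  inv_eq_self_iff h := by
    rcases h with ⟨i, hi⟩ | ⟨⟨v, hv⟩, t⟩
    · constructor
      · intro h
        have : i % 2 = 1 := by
          simp only [muInv] at h
          grind
        exact ⟨⟨i / 2, by omega⟩, by simp; omega⟩
      · rintro ⟨j, hj⟩
        simp at hj
        simp only [muInv]
        grind
    · constructor
      · intro h
        simp only [muInv] at h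
        grind
      · rintro ⟨j, hj⟩
        simp at hj

/-- The involution of `tGraph n`. The black vertices of the first tree are `Sum.inl v`, those of
the second tree are `Sum.inr v`. -/
def tInv (n : ℕ) : HalfEdge (2 * (n + 1) + 1 + 1) (Fin n ⊕ Fin (n + 1)) →
    HalfEdge (2 * (n + 1) + 1 + 1) (Fin n ⊕ Fin (n + 1))
  | Sum.inl i =>
    if i.val % 2 = 1 then
      if h : i.val / 2 < n + 1 then Sum.inr (Sum.inr ⟨i.val / 2, h⟩, 2)
      else Sum.inr (Sum.inr ⟨n, by omega⟩, 1)
    else if i.val = 0 then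
      if hn : 0 < n then Sum.inr (Sum.inl ⟨0, hn⟩, 0) else Sum.inl ⟨2 * n + 2, by omega⟩
    else if i.val = 2 * n + 2 then
      if hn : 0 < n then Sum.inr (Sum.inl ⟨n - 1, by omega⟩, 1) else Sum.inl ⟨0, by omega⟩
    else if h : i.val / 2 - 1 < n then Sum.inr (Sum.inl ⟨i.val / 2 - 1, h⟩, 2) else Sum.inl i
  | Sum.inr (Sum.inl v, t) =>
    if t = 0 then
      if v.val = 0 then Sum.inl ⟨0, by omega⟩ else Sum.inr (Sum.inl ⟨v.val - 1, by omega⟩, 1)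
    else if t = 1 then
      if h : v.val + 1 < n then Sum.inr (Sum.inl ⟨v.val + 1, h⟩, 0)
      else Sum.inl ⟨2 * n + 2, by omega⟩
    else Sum.inl ⟨2 * v.val + 2, by omega⟩
  | Sum.inr (Sum.inr v, t) =>
    if t = 0 then
      if v.val = 0 then Sum.inr (Sum.inr v, 0) else Sum.inr (Sum.inr ⟨v.val - 1, by omega⟩, 1)
    else if t = 1 then
      if h : v.val + 1 < n + 1 then Sum.inr (Sum.inr ⟨v.val + 1, h⟩, 0)
      else Sum.inl ⟨2 * n + 3, by omega⟩
    else Sum.inl ⟨2 * v.val + 1, by omega⟩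

theorem tInv_tInv (n : ℕ) : Function.Involutive (tInv n) := by
  rintro (⟨i, hi⟩ | ⟨⟨v, hv⟩ | ⟨v, hv⟩, t⟩)
  · simp only [tInv]
    split_ifs <;> simp [tInv] <;> grind
  · fin_cases t <;> simp only [tInv] <;> grind [tInv]
  · fin_cases t <;> simp only [tInv] <;> grind [tInv]

/-- The graph `t_g` for `g = n + 1`: it is obtained from `μ_g` by connecting the half-edges
`1, 3, …, 2g + 1` at the white vertex by a second planar trivalent tree, which has in addition a
leaf (its root), labelled by the only label. -/
def tGraph (n : ℕ) : BWGraph 1 (2 * (n + 1) + 1 + 1) where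
  V := Fin n ⊕ Fin (n + 1)
  inv := tInv n
  inv_inv := tInv_tInv n
  leaf _ := some (Sum.inr (Sum.inr 0, 0))
  leaf_inj i j h hi hj := Subsingleton.elim i j
  inv_eq_self_iff h := by
    rcases h with ⟨i, hi⟩ | ⟨⟨v, hv⟩ | ⟨v, hv⟩, t⟩
    · simp only [tInv]
      grind
    · simp only [tInv]
      grind
    · simp only [tInv]
      grind

/-- The Sullivan diagram `μ_g`, `g = n + 1`, in degree `2g + 1`. -/
def muChain (R : Type*) [CommRing R] (n : ℕ) : Gen (n + 2) (2 * (n + 1) + 1) →₀ R :=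
  Finsupp.single (Sum.inl (Quot.mk _ (muGraph n))) 1

/-- The Sullivan diagram `t_g`, `g = n + 1`, in degree `2g + 1`. -/
def tChain (R : Type*) [CommRing R] (n : ℕ) : Gen 1 (2 * (n + 1) + 1) →₀ R :=
  Finsupp.single (Sum.inl (Quot.mk _ (tGraph n))) 1

/-- A graph whose surface (thicken the graph and put a boundary circle in place of the white
vertex) is connected of genus `g`, with `b` boundary components besides the one at the white
vertex. The Euler characteristic of the surface is the number of black vertices minus the number
of edges. -/
def BWGraph.HasType (G : BWGraph m k) (g b : ℕ) : Prop :=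
  (∀ h h', Relation.EqvGen (fun x y => y = nextPerm k G.V x ∨ y = G.inv x) h h') ∧
  (∀ j, G.leaf j ≠ none) ∧
  Nat.card (Quotient (Equiv.Perm.SameCycle.setoid G.boundaryPerm)) = b ∧
  (Fintype.card G.V : ℤ) - G.edges.card = 2 - 2 * g - (b + 1)

/-! ### Induced maps on Hochschild homology -/

/-- The action of chains of diagrams on `R[x]/(x²)`, on Hochschild chains of degree zero. -/
def dualAction (R : Type*) [CommRing R] {m p : ℕ} (c : Gen m p →₀ R) :
    MultilinearMap R (fun _ : Fin m => DualNumber R) (RedChain R (DualNumber R) p) :=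
  action (dualFrobenius R) (dualBasis R) p c

/-- The operation of a graph with `p + 1` half-edges at the white vertex on the graded Frobenius
algebra `R[x]/(x²)`, `x` in positive degree: as without a grading, but the summand of each
labelling `c` of the half-edges by the basis elements `1, x` comes with a sign `s c`. -/
def signedAction (R : Type*) [CommRing R] {m p : ℕ} (G : BWGraph m (p + 1))
    (s : (HalfEdge (p + 1) G.V → Bool) → ℤˣ) :
    MultilinearMap R (fun _ : Fin m => DualNumber R) (RedChain R (DualNumber R) p) :=
  ∑ μ : Fin (p + 1) → Bool, (∑ β : G.V × Fin 3 → Bool,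
    (((s (Sum.elim μ β) : ℤ) : R) * (edgeWeight (dualFrobenius R) (dualBasis R) G (Sum.elim μ β) *
      vertexWeight (dualFrobenius R) (dualBasis R) β)) •
        leafWeight (dualFrobenius R) (dualBasis R) G (Sum.elim μ β)).smulRight
    (RedChain.of R (DualNumber R) fun i => dualBasis R (μ i))

section Induced

variable {R A : Type*} [CommRing R] [CommRing A] [Algebra R A] (ρ : Rotation R A)

/-- `f` induces a well-defined nonzero map `HH₀ → HH_p`. -/
def InducesNonzero {p : ℕ} (f : MultilinearMap R (fun _ : Fin 1 => A) (RedChain R A p)) : Prop :=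
  ∃ T : HH ρ 0 →ₗ[R] HH ρ p,
    (∀ a : A, ∃ h : f (fun _ => a) ∈ hochCycles ρ p,
      T (HH.zeroClass ρ a) = HH.mk ρ (f fun _ => a) h) ∧ T ≠ 0

/-- `f` induces a well-defined nonzero map `HH₀^{⊗m} → HH_p`. -/
def InducesNonzeroTensor {m p : ℕ} (f : MultilinearMap R (fun _ : Fin m => A) (RedChain R A p)) :
    Prop :=
  ∃ T : (⨂[R] _ : Fin m, HH ρ 0) →ₗ[R] HH ρ p,
    (∀ a : Fin m → A, ∃ h : f a ∈ hochCycles ρ p,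
      T (PiTensorProduct.tprod R fun j => HH.zeroClass ρ (a j)) = HH.mk ρ (f a) h) ∧ T ≠ 0

end Induced

end Sullivan

end

noncomputable section

namespace Sullivan

variable {m k : ℕ}

/-! Everything rests on one coefficient, that of `1 ⊗ x ⊗ … ⊗ x`. In the basis `1, x`, the copairing
`1 ⊗ x + x ⊗ 1` and the form `ε(abc)` turn the value of a graph into a count of labellings of its
half-edges: each edge has exactly one half labelled `x`, each black vertex exactly one half-edge
labelled `x` (`weight_eq`). In the reduced complex only outputs `x` matter away from the start.
These labels propagate through the trees of `μ_g` and `t_g` and force all the others: the start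
carries `1`, every leaf carries `x` (`muGraph_hasStdLabel`, `tGraph_hasStdLabel`). Hence both graphs
send `a₁ ⊗ … ⊗ a_m` to the product of the `x`-coefficients of the `a_j` times `1 ⊗ x ⊗ … ⊗ x`. As a
single labelling survives, any choice of signs changes this only by a global sign
(`signedAction_eq`).

With an odd number of factors `x`, the chain `1 ⊗ x ⊗ … ⊗ x` is a cycle: its two outer faces cancel,
and its inner faces contain `x² = 0`. It is not a boundary, since its coefficient vanishes on
boundaries, where the faces contribute a telescoping sum (`sum_telescoping`).
`Rotation.IsSphereLike` isolates the facts about the last face that are needed here; the signs of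
the graded rotation are invisible in them, so spheres are covered by the same argument.

On the side of diagrams, the `2g + 2` faces of `μ_g` or `t_g` cancel in pairs. Pulled out together
with its left or its right neighbour, an odd half-edge becomes attached to one of two adjacent teeth
of the first tree, and the flip relation lets it slide from one to the other (`mk_attach_of_inv_eq`,
`BWGraph.HasComb.boundary_eq_zero`). The resulting class is nonzero because the coefficient of `1 ⊗
x ⊗ … ⊗ x`, with `x` at all leaves, is a functional on diagrams that vanishes on boundaries by the
same telescoping (`topAmplitude_boundaryGen`) and is `1` on `μ_g` and `t_g`.

The topological types follow by tracing the boundary cycles and counting half-edges. -/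

/-! ### Sliding a trivalent vertex past its neighbour -/

/-- Permute the vertices by `π`, and rotate the half-edges at `v` by `s v`. -/
def vertexPerm {V : Type} (π : Equiv.Perm V) (s : V → Fin 3) : Equiv.Perm (V × Fin 3) where
  toFun x := (π x.1, x.2 + s x.1)
  invFun x := (π.symm x.1, x.2 - s (π.symm x.1))
  left_inv x := by simp
  right_inv x := by simp

/-- The relabelling that moves the vertex `u`, which lies on the edge that ends at `(v, t)`, onto
the edge that starts at `(v, t + 2)`. -/
def slidePerm {V : Type} [DecidableEq V] (u v : V) (t : Fin 3) : Equiv.Perm (V × Fin 3) :=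
  Equiv.swap (u, 0) (v, t) * Equiv.swap (u, 1) (v, t + 2)

/-- A flip requires its edge to join the half-edges `0` of both vertices. The right factor rotates
`(u, 1)` and `(v, t)` there; the left factor exchanges the names of `u` and `v` and rotates, so that
`(u, 2)`, the half-edge carried along, is back in its place. -/
theorem slidePerm_eq {V : Type} [DecidableEq V] (u v : V) (huv : u ≠ v) (t : Fin 3) :
    vertexPerm (Equiv.swap u v) (fun w => if w = u then t + 2 else 0) *
      (Equiv.swap (u, 1) (v, 2) * Equiv.swap (v, 2) (v, 1) * Equiv.swap (v, 1) (u, 2)) *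
      vertexPerm 1 (fun w => if w = u then 2 else if w = v then -t else 0) =
    slidePerm u v t := by
  ext1 ⟨w, r⟩
  have hvu := huv.symm
  by_cases hu : w = u
  · subst hu
    fin_cases t <;> fin_cases r <;>
      simp +decide [vertexPerm, slidePerm, Equiv.swap_apply_def, huv, hvu]
  · by_cases hv : w = v
    · subst hv
      fin_cases t <;> fin_cases r <;>
        simp +decide [vertexPerm, slidePerm, Equiv.swap_apply_def, huv, hvu]
    · simp [vertexPerm, slidePerm, Equiv.swap_apply_def, hu, hv]

/-- Permuting vertices and rotating at each of them preserves the cyclic orders, so this is an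
isomorphism of fat graphs. -/
theorem mk_relabel_vertexPerm (G : BWGraph m k) (π : Equiv.Perm G.V) (s : G.V → Fin 3) :
    (Quot.mk Move (G.relabel G.V (Equiv.sumCongr (Equiv.refl (Fin k)) (vertexPerm π s))) :
      Diagram m k) = Quot.mk Move G := by
  refine (Quot.sound (Move.iso G G.V (vertexPerm π s) fun v t => ?_)).symm
  simp [vertexPerm, add_right_comm]

/-- Sliding a vertex past the next vertex does not change the Sullivan diagram. -/
theorem mk_relabel_slidePerm (G : BWGraph m k) (u v : G.V) (huv : u ≠ v) (t : Fin 3)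
    (h : G.inv (Sum.inr (u, 1)) = Sum.inr (v, t)) :
    (Quot.mk Move (G.relabel G.V (Equiv.sumCongr (Equiv.refl (Fin k)) (slidePerm u v t))) :
      Diagram m k) = Quot.mk Move G := by
  set s₁ : G.V → Fin 3 := fun w => if w = u then 2 else if w = v then -t else 0 with hs₁
  set s₂ : G.V → Fin 3 := fun w => if w = u then t + 2 else 0
  rw [← mk_relabel_vertexPerm G 1 s₁]
  set G₁ := G.relabel G.V (Equiv.sumCongr (Equiv.refl (Fin k)) (vertexPerm 1 s₁)) with hG₁
  have h₁ : G₁.inv (Sum.inr (u, 0)) = Sum.inr (v, 0) := by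
    have e1 : (vertexPerm 1 s₁).symm (u, 0) = (u, 1) := by
      rw [Equiv.symm_apply_eq]; simp +decide [vertexPerm, hs₁]
    have e2 : vertexPerm 1 s₁ (v, t) = (v, 0) := by simp [vertexPerm, hs₁, huv.symm]
    simp [G₁, e1, h, e2]
  rw [Quot.sound (Move.flip G₁ u v huv h₁)]
  rw [← mk_relabel_vertexPerm (G₁.relabel G₁.V (flipPerm k u v)) (Equiv.swap u v) s₂]
  congr 1
  refine Eq.trans ?_ (BWGraph.relabel_relabel ..).symm
  refine Eq.trans ?_ (BWGraph.relabel_relabel ..).symm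
  congr 1
  rw [← slidePerm_eq u v huv t]
  ext1 x; rcases x with x | x <;> rfl

/-! ### Attaching a half-edge of the white vertex to an edge -/

/-- The half-edges after the half-edge `z` has been pulled off the white vertex: it becomes the
half-edge `2` of a new black vertex, whose half-edges `0` and `1` are new. -/
def attachEquiv {V : Type} (z : Fin (k + 1)) :
    HalfEdge (k + 1) V ⊕ Bool ≃ HalfEdge k (Option V) where
  toFun
    | Sum.inl (Sum.inl j) => (finSuccEquiv' z j).elim (Sum.inr (none, 2)) Sum.inl
    | Sum.inl (Sum.inr (v, t)) => Sum.inr (some v, t)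
    | Sum.inr false => Sum.inr (none, 0)
    | Sum.inr true => Sum.inr (none, 1)
  invFun
    | Sum.inl j => Sum.inl (Sum.inl (z.succAbove j))
    | Sum.inr (some v, t) => Sum.inl (Sum.inr (v, t))
    | Sum.inr (none, t) =>
      if t = 0 then Sum.inr false else if t = 1 then Sum.inr true else Sum.inl (Sum.inl z)
  left_inv := by
    rintro ((j | ⟨v, t⟩) | (_ | _))
    · rcases hj : finSuccEquiv' z j with _ | j'
      · rw [finSuccEquiv'_eq_none] at hj
        simp [← hj]
      · rw [finSuccEquiv'_eq_some] at hj
        simp [hj]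
    · rfl
    · simp
    · simp
  right_inv := by
    rintro (j | ⟨_ | v, t⟩)
    · simp
    · fin_cases t <;> simp
    · rfl

/-- Pull the half-edge `z` off the white vertex, and attach it to the left hand side of the
edge that leads from `p` to `G.inv p`. -/
abbrev BWGraph.attach (G : BWGraph m (k + 1)) (z : Fin (k + 1)) (p : HalfEdge (k + 1) G.V) :
    BWGraph m k :=
  G.addEdge (Option G.V)
    ((Equiv.swap (Sum.inl (G.inv p)) (Sum.inr false)).trans (attachEquiv z))

/-- Two ways of adding an edge agree if they yield the same pairing and move the leaves to the
same places. -/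
theorem BWGraph.addEdge_congr {k' : ℕ} (G : BWGraph m k) {W : Type} [Fintype W] [DecidableEq W]
    (e₁ e₂ : HalfEdge k G.V ⊕ Bool ≃ HalfEdge k' W)
    (h : ∀ x, e₁.symm (e₂ (Sum.map G.inv not x)) = Sum.map G.inv not (e₁.symm (e₂ x)))
    (hl : ∀ x, G.inv x = x → e₁ (Sum.inl x) = e₂ (Sum.inl x)) :
    G.addEdge W e₁ = G.addEdge W e₂ := by
  refine BWGraph.ext_inv _ _ _ _ _ _ ?_ ?_
  · funext y
    obtain ⟨x, rfl⟩ := e₂.surjective y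
    rw [e₂.symm_apply_apply, ← h, e₁.apply_symm_apply]
  · funext j
    rcases hj : G.leaf j with _ | x
    · rfl
    · simp [hl x ((G.inv_eq_self_iff x).2 ⟨j, hj⟩)]

/-- A half-edge that is attached to an edge can slide around the end point of this edge. -/
theorem mk_attach_of_inv_eq (G : BWGraph m (k + 1)) (z : Fin (k + 1)) (p : HalfEdge (k + 1) G.V)
    (v : G.V) (t : Fin 3) (h : G.inv p = Sum.inr (v, t))
    (hw : G.inv (Sum.inr (v, t + 2)) ≠ Sum.inr (v, t + 2)) :
    (Quot.mk Move (G.attach z p) : Diagram m k) =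
      Quot.mk Move (G.attach z (Sum.inr (v, t + 2))) := by
  -- The half-edge `1` of the new vertex points away from `p`, hence to `(v, t)`; so the new vertex
  -- can slide past `v`.
  have h₁ : (G.attach z p).inv (Sum.inr (none, 1)) = Sum.inr (some v, t) := by
    have e : (attachEquiv z).symm (Sum.inr (none, 1)) = (Sum.inr true : HalfEdge (k + 1) G.V ⊕ Bool) :=
      rfl
    simp [e, h]
    rfl
  rw [← mk_relabel_slidePerm (G.attach z p) none (some v) (by simp) t h₁]
  congr 1
  refine (BWGraph.relabel_addEdge ..).trans ?_
  set w : HalfEdge (k + 1) G.V := Sum.inr (v, t + 2) with hwdef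
  -- Sliding closes the cut at `(v, t)` and opens the edge of `w` instead, with the half `true` now
  -- placed at `w`.
  have e₁ : (((Equiv.swap (Sum.inl (G.inv p)) (Sum.inr false)).trans (attachEquiv z)).trans
      (Equiv.sumCongr (Equiv.refl (Fin k)) (slidePerm none (some v) t)) :
        HalfEdge (k + 1) G.V ⊕ Bool ≃ HalfEdge k (Option G.V)) =
      (Equiv.swap (Sum.inl w) (Sum.inr true)).trans (attachEquiv z) := by
    have e : Equiv.sumCongr (Equiv.refl (Fin k)) (slidePerm none (some v) t) =
        Equiv.swap (attachEquiv z (Sum.inr false)) (attachEquiv z (Sum.inl (Sum.inr (v, t)))) *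
          Equiv.swap (attachEquiv z (Sum.inr true)) (attachEquiv z (Sum.inl w)) := by
      change _ = Equiv.swap (Sum.inr (none, 0)) (Sum.inr (some v, t)) *
        Equiv.swap (Sum.inr (none, 1)) (Sum.inr (some v, t + 2))
      rw [← Equiv.Perm.sumCongr_refl_swap, ← Equiv.Perm.sumCongr_refl_swap,
        Equiv.Perm.sumCongr_mul]
      rfl
    ext1 x
    simp only [e, Equiv.trans_apply, Equiv.Perm.mul_apply, h, (attachEquiv z).injective.swap_apply]
    congr 1
    have hne : (Sum.inr (v, t) : HalfEdge (k + 1) G.V) ≠ w := by simp [hwdef]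
    -- The two transpositions of `(v, t)` with `false` are disjoint from the middle one, so they
    -- commute past it and cancel.
    rw [← Equiv.Perm.mul_apply, ← Equiv.Perm.mul_apply, Equiv.swap_comm (Sum.inl (Sum.inr (v, t))),
      mul_assoc, (Equiv.Perm.disjoint_swap_swap (by simp [hne.symm])).commute.eq, ← mul_assoc,
      Equiv.swap_mul_self, one_mul, Equiv.swap_comm]
  -- Placing `true` at `w` or `false` at `G.inv w` gives the same pairing; no leaf moves
  -- differently, since neither `w` nor `G.inv w` is a leaf.
  refine (congrArg _ e₁).trans (BWGraph.addEdge_congr _ _ _ ?_ ?_)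
  · have hi := G.inv_inv
    rintro (x | (_ | _))
    · by_cases h1 : x = w
      · subst h1
        simp [Equiv.swap_apply_def, hw.symm]
      · by_cases h2 : x = G.inv w
        · subst h2
          simp [Equiv.swap_apply_def, hi w, hw.symm]
        · have h3 : G.inv x ≠ w := fun e => h2 (by rw [← e, hi x])
          have h4 : G.inv x ≠ G.inv w := fun e => h1 (hi.injective e)
          simp [Equiv.swap_apply_def, h1, h2, h3, h4]
    · simp [Equiv.swap_apply_def, hw, hi w]
    · simp [Equiv.swap_apply_def, hw]
  · intro x hx
    have h1 : x ≠ w := fun e => hw (e ▸ hx)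
    have h2 : x ≠ G.inv w := by
      rintro rfl
      rw [G.inv_inv] at hx
      exact hw hx.symm
    simp [Equiv.swap_apply_def, h1, h2]

theorem succ_succAbove_of_ne {i j : Fin k} (h : j ≠ i) :
    i.succ.succAbove j = i.castSucc.succAbove j := by
  rcases lt_or_gt_of_ne h with h | h
  · rw [Fin.succAbove_of_castSucc_lt _ _ (Fin.lt_def.2 (by simp; omega)),
      Fin.succAbove_of_castSucc_lt _ _ (Fin.lt_def.2 (by simpa using h))]
  · rw [Fin.succAbove_of_le_castSucc _ _ (Fin.le_def.2 (by simpa using h)),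
      Fin.succAbove_of_le_castSucc _ _ (Fin.le_def.2 (by simp; omega))]

/-- Both constructions put `i + 1` at the half-edge `2` of the new vertex. They differ by a 3-cycle
of `i` and the two halves of the new edge, which share the place `i` at the white vertex and the
half-edges `0` and `1` of the new one. -/
theorem mergeEquiv_symm_attachEquiv {V : Type} [DecidableEq V] (i : Fin k)
    (x : HalfEdge (k + 1) V ⊕ Bool) :
    (mergeEquiv i).symm (attachEquiv i.succ x) =
      (Equiv.swap (Sum.inl (Sum.inl i.castSucc)) (Sum.inr false) *
        Equiv.swap (Sum.inr false) (Sum.inr true) : Equiv.Perm (HalfEdge (k + 1) V ⊕ Bool)) x := by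
  rcases x with ((j | ⟨v, t⟩) | (_ | _))
  · rcases hj : finSuccEquiv' i.succ j with _ | j'
    · have hj' := hj
      rw [finSuccEquiv'_eq_none] at hj'
      subst hj'
      simp [attachEquiv, mergeEquiv, Equiv.swap_apply_def, Fin.castSucc_lt_succ.ne']
    · have hj' := hj
      rw [finSuccEquiv'_eq_some] at hj'
      by_cases h : j' = i
      · subst h
        have hj'' : j = j'.castSucc := by simpa using hj'
        simp only [attachEquiv, mergeEquiv, Equiv.coe_fn_mk, Equiv.coe_fn_symm_mk, hj]
        simp [hj'', Equiv.swap_apply_def]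
      · rw [succ_succAbove_of_ne h] at hj'
        subst hj'
        simp [attachEquiv, mergeEquiv, hj, h, Equiv.swap_apply_def, Fin.succAbove_ne]
  · simp [attachEquiv, mergeEquiv, Equiv.swap_apply_def]
  · simp [attachEquiv, mergeEquiv, Equiv.swap_apply_def]
  · simp [attachEquiv, mergeEquiv, Equiv.swap_apply_def]

/-- Pulling out two consecutive half-edges at the white vertex attaches the second of them to the
edge of the first. -/
theorem merge_eq_attach (G : BWGraph m (k + 1)) (i : Fin k)
    (h : G.inv (Sum.inl i.castSucc) ≠ Sum.inl i.castSucc) :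
    G.merge i = G.attach i.succ (Sum.inl i.castSucc) := by
  have hi := G.inv_inv
  set a : HalfEdge (k + 1) G.V := Sum.inl i.castSucc with ha
  refine BWGraph.addEdge_congr _ _ _ ?_ ?_
  · simp only [Equiv.trans_apply, mergeEquiv_symm_attachEquiv, ← ha]
    rintro (x | (_ | _))
    · by_cases h1 : x = a
      · subst h1
        simp [Equiv.swap_apply_def, h.symm]
      · by_cases h2 : x = G.inv a
        · subst h2
          simp [Equiv.swap_apply_def, hi a, h.symm]
        · have h3 : G.inv x ≠ a := fun e => h2 (by rw [← e, hi x])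
          have h4 : G.inv x ≠ G.inv a := fun e => h1 (hi.injective e)
          simp [Equiv.swap_apply_def, h1, h2, h3, h4]
    · simp [Equiv.swap_apply_def, h, hi a]
    · simp [Equiv.swap_apply_def, h]
  · intro x hx
    have h1 : x ≠ a := fun e => h (e ▸ hx)
    have h2 : x ≠ G.inv a := by
      rintro rfl
      rw [hi] at hx
      exact h hx.symm
    rw [← Equiv.eq_symm_apply]
    simp [mergeEquiv_symm_attachEquiv, ← ha, Equiv.swap_apply_def, h1, h2]

/-- Rotating the new vertex by one puts `i` at its half-edge `2`, the place of an attached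
half-edge; `i + 1` comes to the half-edge `0`, so the vertex lies on the edge of `i + 1`. -/
theorem mergeEquiv_trans_vertexPerm {V : Type} [DecidableEq V] (i : Fin k) :
    (mergeEquiv i).trans (Equiv.sumCongr (Equiv.refl (Fin k))
      (vertexPerm 1 fun v : Option V => if v = none then 1 else 0)) =
    (Equiv.swap (Sum.inl (Sum.inl i.succ)) (Sum.inr false)).trans (attachEquiv i.castSucc) := by
  ext1 x
  rcases x with ((j | ⟨v, t⟩) | (_ | _))
  · rcases hj : finSuccEquiv' i.castSucc j with _ | j'
    · have hj' := hj
      rw [finSuccEquiv'_eq_none] at hj'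
      subst hj'
      simp [attachEquiv, mergeEquiv, Equiv.swap_apply_def, vertexPerm, Fin.castSucc_lt_succ.ne]
    · have hj' := hj
      rw [finSuccEquiv'_eq_some] at hj'
      by_cases h : j' = i
      · subst h
        simp only [Fin.succAbove_castSucc_self] at hj'
        subst hj'
        simp +decide [attachEquiv, mergeEquiv, hj, vertexPerm]
      · have hj'' : j ≠ i.succ := by
          rw [hj', ← Fin.succAbove_castSucc_self]
          exact fun e => h (Fin.succAbove_right_injective e)
        simp [attachEquiv, mergeEquiv, hj, hj'', h, Equiv.swap_apply_def]
  · simp [attachEquiv, mergeEquiv, Equiv.swap_apply_def, vertexPerm]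
  · have h2 : finSuccEquiv' i.castSucc i.succ = some i := by
      rw [finSuccEquiv'_eq_some]; simp
    simp [attachEquiv, mergeEquiv, h2]
  · simp [attachEquiv, mergeEquiv, Equiv.swap_apply_def, vertexPerm]

/-- Pulling out two consecutive half-edges at the white vertex attaches the first of them to the
edge of the second. -/
theorem mk_merge_eq_attach (G : BWGraph m (k + 1)) (i : Fin k) :
    (Quot.mk Move (G.merge i) : Diagram m k) =
      Quot.mk Move (G.attach i.castSucc (G.inv (Sum.inl i.succ))) := by
  rw [← mk_relabel_vertexPerm (G.merge i) 1 fun v : Option G.V => if v = none then 1 else 0]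
  congr 1
  refine (BWGraph.relabel_addEdge ..).trans ?_
  rw [BWGraph.attach, G.inv_inv]
  exact congrArg _ (mergeEquiv_trans_vertexPerm i)

/-- The former last half-edge has number `0` after the rotation; removing it shifts the other
numbers down again, so the rotation becomes invisible. -/
theorem attachEquiv_rotate {V : Type} (x : HalfEdge (k + 1) V ⊕ Bool) :
    attachEquiv 0 (Equiv.sumCongr (Equiv.sumCongr (finRotate (k + 1)) (Equiv.refl _))
      (Equiv.refl Bool) x) = attachEquiv (Fin.last k) x := by
  rcases x with ((j | ⟨v, t⟩) | (_ | _))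
  · induction j using Fin.lastCases with
    | last => simp [attachEquiv]
    | cast j =>
      have h1 : finSuccEquiv' 0 j.succ = some j := by rw [finSuccEquiv'_eq_some]; simp
      have h2 : finSuccEquiv' (Fin.last k) j.castSucc = some j := by
        rw [finSuccEquiv'_eq_some]; simp
      simp only [attachEquiv, Equiv.coe_fn_mk, Equiv.sumCongr_apply, Sum.map_inl]
      rw [h2, finRotate_apply, ← Fin.coeSucc_eq_succ] at *
      rw [h1]
  · rfl
  · rfl
  · rfl

theorem rotate_attach (G : BWGraph m (k + 1)) (p : HalfEdge (k + 1) G.V) :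
    G.rotate.attach 0 (Equiv.sumCongr (finRotate (k + 1)) (Equiv.refl _) p) =
      G.attach (Fin.last k) p := by
  refine (BWGraph.addEdge_relabel ..).trans (congrArg _ ?_)
  ext1 x
  rw [Equiv.trans_apply, Equiv.trans_apply, Equiv.trans_apply, ← attachEquiv_rotate]
  congr 1
  have e : (Equiv.sumCongr (Equiv.sumCongr (finRotate (k + 1)) (Equiv.refl (G.V × Fin 3)))
    (Equiv.refl Bool)) (Sum.inl (G.inv p)) = Sum.inl (G.rotate.inv
      (Equiv.sumCongr (finRotate (k + 1)) (Equiv.refl _) p)) := by simp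
  rw [← e]
  exact (Equiv.injective (Equiv.sumCongr (Equiv.sumCongr (finRotate (k + 1))
    (Equiv.refl (G.V × Fin 3))) (Equiv.refl Bool))).swap_apply (Sum.inl (G.inv p)) (Sum.inr false) x

/-- Rotating the white vertex and then pulling out the first two half-edges attaches the last
half-edge to the edge of the first. -/
theorem mk_rotate_merge_eq_attach (G : BWGraph m (k + 2)) :
    (Quot.mk Move (G.rotate.merge 0) : Diagram m (k + 1)) =
      Quot.mk Move (G.attach (Fin.last (k + 1)) (G.inv (Sum.inl 0))) := by
  rw [mk_merge_eq_attach, ← rotate_attach]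
  congr 2

/-! ### The graphs `μ_g` and `t_g` are cycles -/

/-- The half-edges `0, 2, …, 2n + 2` at the white vertex of `G` are connected by the planar tree
with the vertices `ι 0, …, ι (n - 1)`. -/
structure BWGraph.HasComb {n : ℕ} (G : BWGraph m (2 * (n + 1) + 1 + 1)) (ι : Fin n → G.V) : Prop where
  edge : n = 0 → G.inv (Sum.inl 0) = Sum.inl ⟨2 * n + 2, by omega⟩
  white : ∀ v : Fin n, G.inv (Sum.inl ⟨2 * v + 2, by omega⟩) = Sum.inr (ι v, 2)
  first : ∀ h : 0 < n, G.inv (Sum.inl 0) = Sum.inr (ι ⟨0, h⟩, 0)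
  last : ∀ h : 0 < n, G.inv (Sum.inl ⟨2 * n + 2, by omega⟩) = Sum.inr (ι ⟨n - 1, by omega⟩, 1)
  next : ∀ v (h : v + 1 < n), G.inv (Sum.inr (ι ⟨v, by omega⟩, 1)) = Sum.inr (ι ⟨v + 1, h⟩, 0)

theorem muGraph_hasComb (n : ℕ) : (muGraph n).HasComb id where
  edge h := by subst h; rfl
  white v := by simp [muGraph, muInv, v.2.ne]
  first h := by simp [muGraph, muInv, h]
  last h := by simp [muGraph, muInv, h]
  next v h := by simp [muGraph, muInv, h]

theorem tGraph_hasComb (n : ℕ) : (tGraph n).HasComb Sum.inl where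
  edge h := by subst h; rfl
  white v := by simp [tGraph, tInv, v.2.ne]
  first h := by simp [tGraph, tInv, h]
  last h := by simp [tGraph, tInv, h]
  next v h := by simp [tGraph, tInv, h]

namespace BWGraph.HasComb

variable {n : ℕ} {G : BWGraph m (2 * (n + 1) + 1 + 1)} {ι : Fin n → G.V}

theorem white' (hG : G.HasComb ι) {j : ℕ} (h0 : 0 < j) (hj : j ≤ n) :
    G.inv (Sum.inl ⟨2 * j, by omega⟩) = Sum.inr (ι ⟨j - 1, by omega⟩, 2) := by
  rw [← hG.white]
  congr 3
  simp only
  omega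

theorem inv_two (hG : G.HasComb ι) (v : Fin n) :
    G.inv (Sum.inr (ι v, 2)) = Sum.inl ⟨2 * v + 2, by omega⟩ := by
  rw [← hG.white, G.inv_inv]

theorem inv_one_ne (hG : G.HasComb ι) (v : Fin n) :
    G.inv (Sum.inr (ι v, 1)) ≠ Sum.inr (ι v, 1) := by
  obtain ⟨v, hv⟩ := v
  by_cases h : v + 1 < n
  · simp [hG.next v h]
  · obtain rfl : v = n - 1 := by omega
    rw [← hG.last (by omega), G.inv_inv, hG.last (by omega)]
    simp

theorem inv_zero_ne (hG : G.HasComb ι) (v : Fin n) :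
    G.inv (Sum.inr (ι v, 0)) ≠ Sum.inr (ι v, 0) := by
  obtain ⟨_ | v, hv⟩ := v
  · rw [← hG.first hv, G.inv_inv, hG.first hv]
    simp
  · rw [← hG.next v hv, G.inv_inv, hG.next v hv]
    simp

theorem inv_white_ne (hG : G.HasComb ι) {j : ℕ} (hj : j ≤ n + 1) :
    G.inv (Sum.inl ⟨2 * j, by omega⟩) ≠ Sum.inl ⟨2 * j, by omega⟩ := by
  rcases Nat.eq_zero_or_pos n with h | h
  · subst h
    have h1 := hG.edge rfl
    obtain rfl | rfl : j = 0 ∨ j = 1 := by omega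
    · change G.inv (Sum.inl 0) ≠ Sum.inl 0
      simp [h1]
    · change G.inv (Sum.inl ⟨2 * 0 + 2, _⟩) ≠ Sum.inl ⟨2 * 0 + 2, _⟩
      rw [← h1, G.inv_inv, h1]
      simp
  · rcases Nat.eq_zero_or_pos j with rfl | h0
    · change G.inv (Sum.inl 0) ≠ Sum.inl 0
      simp [hG.first h]
    · rcases Nat.lt_or_ge n j with h1 | h1
      · obtain rfl : j = n + 1 := by omega
        change G.inv (Sum.inl ⟨2 * n + 2, _⟩) ≠ Sum.inl ⟨2 * n + 2, _⟩
        simp [hG.last h]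
      · simp [hG.white' h0 h1]

/-- A half-edge between two consecutive teeth of the comb can slide from one to the other. -/
theorem mk_attach (hG : G.HasComb ι) (z : Fin (2 * (n + 1) + 1 + 1)) {j : ℕ} (hj : j ≤ n) :
    (Quot.mk Move (G.attach z (Sum.inl ⟨2 * j, by omega⟩)) : Diagram m _) =
      Quot.mk Move (G.attach z (G.inv (Sum.inl ⟨2 * j + 2, by omega⟩))) := by
  have h2 : ∀ v, G.inv (Sum.inr (ι v, 2)) ≠ Sum.inr (ι v, 2) := fun v => by simp [hG.inv_two]
  rcases Nat.eq_zero_or_pos j with rfl | h0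
  · rcases Nat.eq_zero_or_pos n with h | h
    · subst h
      rw [← hG.edge rfl, G.inv_inv]
      rfl
    · exact (mk_attach_of_inv_eq G z _ _ 0 (hG.first h) (h2 _)).trans
        (congrArg (fun p => Quot.mk _ (G.attach z p)) (hG.white ⟨0, h⟩).symm)
  -- Passing a vertex leads from its half-edge `t` to `t + 2` modulo `3`: in along the tooth `2` and
  -- out at `1`, then into the next vertex at `0` and out along its tooth `2`.
  · refine (mk_attach_of_inv_eq G z _ _ 2 (hG.white' h0 hj) (hG.inv_one_ne _)).trans ?_
    rcases hj.lt_or_eq with h | rfl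
    · have h1 := hG.next (j - 1) (by omega)
      refine (mk_attach_of_inv_eq G z _ _ 0 h1 (h2 _)).trans ?_
      refine congrArg (fun p => Quot.mk _ (G.attach z p)) ((hG.white ⟨j, h⟩).trans ?_).symm
      congr 3
      simp only [Fin.mk.injEq]
      omega
    · exact congrArg (fun p => Quot.mk _ (G.attach z p)) (hG.last h0).symm

/-- A half-edge before the last tooth of the comb can slide along its back. -/
theorem mk_attach_last (hG : G.HasComb ι) (z : Fin (2 * (n + 1) + 1 + 1)) :
    (Quot.mk Move (G.attach z (Sum.inl ⟨2 * n + 2, by omega⟩)) : Diagram m _) =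
      Quot.mk Move (G.attach z (G.inv (Sum.inl 0))) := by
  rcases Nat.eq_zero_or_pos n with h | h
  · subst h
    rw [hG.edge rfl]
  -- On the outer side every vertex is entered at `1` and left at `1 + 2 = 0`, so the half-edge runs
  -- down the back of the comb; `d` is the distance from the last vertex.
  · have key : ∀ d (hd : d < n),
        (Quot.mk Move (G.attach z (Sum.inl ⟨2 * n + 2, by omega⟩)) : Diagram m _) =
          Quot.mk Move (G.attach z (Sum.inr (ι ⟨n - 1 - d, by omega⟩, 0))) := by
      intro d
      induction d with
      | zero => exact fun _ => mk_attach_of_inv_eq G z _ _ 1 (hG.last h) (hG.inv_zero_ne _)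
      | succ d ih =>
        intro hd
        refine (ih (by omega)).trans (mk_attach_of_inv_eq G z _ _ 1 ?_ (hG.inv_zero_ne _))
        rw [← G.inv_inv (Sum.inr (ι ⟨n - 1 - (d + 1), _⟩, 1)), hG.next _ (by omega)]
        congr 5
        omega
    rw [key (n - 1) (by omega), hG.first h]
    congr 6
    omega

/-- The half-edge `2j + 1` is pulled out once with its left and once with its right neighbour.
Either way it becomes attached to a tooth, and it slides from the tooth `2j` to the tooth `2j + 2`.
-/
theorem merge_eq (hG : G.HasComb ι) {j : ℕ} (hj : j ≤ n) :
    Diagram.merge ⟨2 * j, by omega⟩ (Quot.mk _ G) =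
      Diagram.merge ⟨2 * j + 1, by omega⟩ (Quot.mk _ G) := by
  change (Quot.mk Move (G.merge _) : Diagram m _) = Quot.mk Move (G.merge _)
  rw [merge_eq_attach G ⟨2 * j, _⟩ (hG.inv_white_ne (j := j) (by omega))]
  exact (hG.mk_attach _ hj).trans (mk_merge_eq_attach G ⟨2 * j + 1, _⟩).symm

/-- The last half-edge lies outside the comb, between its last and its first tooth, and slides along
the whole back. -/
theorem merge_last_eq (hG : G.HasComb ι) :
    Diagram.merge (Fin.last (2 * (n + 1))) (Quot.mk _ G) =
      (Diagram.rotate (Quot.mk _ G)).merge 0 := by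
  change (Quot.mk Move (G.merge _) : Diagram m _) = Quot.mk Move (G.rotate.merge 0)
  rw [mk_rotate_merge_eq_attach,
    merge_eq_attach _ _ (hG.inv_white_ne (j := n + 1) le_rfl)]
  exact hG.mk_attach_last _

end BWGraph.HasComb

theorem sum_alternating_eq_zero {R α : Type*} [CommRing R] (E : ℕ → α) (N : ℕ)
    (h : ∀ j < N, E (2 * j) = E (2 * j + 1)) :
    ∑ i ∈ Finset.range (2 * N), Finsupp.single (E i) ((-1 : R) ^ i) = 0 := by
  induction N with
  | zero => simp
  | succ N ih =>
    rw [mul_add, mul_one, Finset.sum_range_succ, Finset.sum_range_succ,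
      ih fun j hj => h j (by omega), h N (by omega), zero_add, ← Finsupp.single_add]
    simp [pow_succ]

/-- The boundary of a diagram with a comb vanishes. -/
theorem BWGraph.HasComb.boundary_eq_zero (R : Type*) [CommRing R] {n : ℕ}
    {G : BWGraph m (2 * (n + 1) + 1 + 1)} {ι : Fin n → G.V} (hG : G.HasComb ι) :
    boundary R (2 * (n + 1) + 1)
      (Finsupp.single (Sum.inl (Quot.mk _ G) : Gen m (2 * (n + 1) + 1)) 1) = 0 := by
  let D : Diagram m (2 * (n + 1) + 1 + 1) := Quot.mk _ G
  let E : ℕ → Gen m (2 * (n + 1)) := fun i =>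
    if h : i < 2 * (n + 1) + 1 then Sum.inl (D.merge ⟨i, h⟩) else Sum.inl (D.rotate.merge 0)
  -- The rotated face is given the index `2n + 3`, which matches its sign. The `2n + 4` faces then
  -- cancel in the pairs `2j, 2j + 1`, and the last pair contains the rotated face.
  have h := sum_alternating_eq_zero (R := R) E (n + 2) fun j hj => by
    rcases Nat.lt_or_ge n j with h | h
    · obtain rfl : j = n + 1 := by omega
      simp only [E]
      rw [dif_pos (by omega), dif_neg (by omega)]
      exact congrArg Sum.inl hG.merge_last_eq
    · simp only [E]
      rw [dif_pos (by omega), dif_pos (by omega)]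
      exact congrArg Sum.inl (hG.merge_eq h)
  rw [show 2 * (n + 2) = 2 * (n + 1) + 1 + 1 by ring, Finset.sum_range_succ,
    ← Fin.sum_univ_eq_sum_range (fun i => Finsupp.single (E i) ((-1 : R) ^ i))] at h
  refine Eq.trans (b := boundaryGen R (2 * (n + 1)) (Sum.inl D)) ?_ (Eq.trans ?_ h)
  · rw [boundary, Finsupp.linearCombination_single, one_smul]
  rw [boundaryGen.eq_def]
  refine congrArg₂ (· + ·) ?_ ?_
  · refine Finset.sum_congr rfl fun i _ => ?_
    simp only [E]
    rw [dif_pos i.2]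
  · simp only [E]
    rw [dif_neg (by omega)]

/-! ### The topological types of `μ_g` and `t_g` -/

theorem nextPerm_inr {V : Type} (v : V) (t : Fin 3) :
    nextPerm k V (Sum.inr (v, t)) = Sum.inr (v, t + 1) := by
  simp [nextPerm]

theorem nextPerm_inl {V : Type} {i : ℕ} (h : i + 1 < k) :
    nextPerm k V (Sum.inl ⟨i, by omega⟩) = Sum.inl ⟨i + 1, h⟩ := by
  obtain _ | k := k
  · omega
  · simp [nextPerm, finRotate_of_lt (show i < k by omega)]

theorem nextPerm_inl_zero {V : Type} :
    nextPerm (k + 2) V (Sum.inl 0) = Sum.inl ⟨1, by omega⟩ :=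
  nextPerm_inl (i := 0) (by omega)

theorem nextPerm_inl_last {V : Type} :
    nextPerm (k + 1) V (Sum.inl ⟨k, by omega⟩) = Sum.inl 0 := by
  change Sum.inl (finRotate (k + 1) (Fin.last k)) = _
  simp

/-- Half-edges counted in two ways: by edges and leaves, and by vertices. -/
theorem BWGraph.two_mul_card_edges (G : BWGraph m k) :
    2 * G.edges.card + (Finset.univ.filter fun h => G.inv h = h).card =
      k + 3 * Fintype.card G.V := by
  have h1 : (Finset.univ.filter fun h => G.inv h ≠ h).card = 2 * G.edges.card := by
    rw [Finset.card_eq_sum_card_image (fun h => s(h, G.inv h)), ← BWGraph.edges, mul_comm,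
      ← smul_eq_mul, ← Finset.sum_const]
    refine Finset.sum_congr rfl fun e he => ?_
    obtain ⟨x, hx, rfl⟩ := Finset.mem_image.1 he
    have hx' := (Finset.mem_filter.1 hx).2
    have : ((Finset.univ.filter fun h => G.inv h ≠ h).filter
        fun h => s(h, G.inv h) = s(x, G.inv x)) = {x, G.inv x} := by
      ext h
      simp only [Finset.mem_filter, Finset.mem_univ, true_and, Finset.mem_insert,
        Finset.mem_singleton, Sym2.eq_iff]
      constructor
      · rintro ⟨-, ⟨h, -⟩ | ⟨h, -⟩⟩
        · exact Or.inl h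
        · exact Or.inr h
      · rintro (rfl | rfl)
        · exact ⟨hx', Or.inl ⟨rfl, rfl⟩⟩
        · rw [G.inv_inv]
          exact ⟨hx'.symm, Or.inr ⟨rfl, rfl⟩⟩
    rw [this, Finset.card_pair hx'.symm]
  have h2 := Finset.card_filter_add_card_filter_not (s := Finset.univ)
    (fun h : HalfEdge k G.V => G.inv h = h)
  rw [← h1, add_comm, h2]
  simp [mul_comm]

theorem BWGraph.card_fixed (G : BWGraph m k) (l : Fin m → HalfEdge k G.V)
    (hl : ∀ j, G.leaf j = some (l j)) :
    (Finset.univ.filter fun h => G.inv h = h).card = m := by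
  have h1 : (Finset.univ.filter fun h => G.inv h = h) = Finset.univ.image l := by
    ext h
    simp [G.inv_eq_self_iff, hl]
  rw [h1, Finset.card_image_of_injective, Finset.card_fin]
  intro i j hij
  exact G.leaf_inj i j _ (hl i) (by rw [hl, hij])

/-- A graph all of whose black vertices are joined to the white vertex by an edge is connected. -/
theorem BWGraph.connected (G : BWGraph m (k + 1)) (t : G.V → Fin 3) (w : G.V → Fin (k + 1))
    (hw : ∀ v, G.inv (Sum.inr (v, t v)) = Sum.inl (w v)) (h h' : HalfEdge (k + 1) G.V) :
    Relation.EqvGen (fun x y => y = nextPerm (k + 1) G.V x ∨ y = G.inv x) h h' := by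
  have key : ∀ h, Relation.EqvGen (fun x y => y = nextPerm (k + 1) G.V x ∨ y = G.inv x)
      (Sum.inl 0) h := by
    have hwhite : ∀ i, Relation.EqvGen
        (fun x y => y = nextPerm (k + 1) G.V x ∨ y = G.inv x) (Sum.inl 0) (Sum.inl i) := by
      rintro ⟨i, hi⟩
      induction i with
      | zero => exact .refl _
      | succ i ih => exact .trans _ _ _ (ih (by omega)) (.rel _ _ (.inl (nextPerm_inl hi).symm))
    have hblack : ∀ v (s : Fin 3), Relation.EqvGen
        (fun x y => y = nextPerm (k + 1) G.V x ∨ y = G.inv x)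
        (Sum.inl 0) (Sum.inr (v, t v + s)) := by
      intro v s
      have step : ∀ s, Relation.EqvGen
          (fun x y => y = nextPerm (k + 1) G.V x ∨ y = G.inv x)
          (Sum.inr (v, s)) (Sum.inr (v, s + 1)) := fun s => .rel _ _ (.inl (nextPerm_inr v s).symm)
      have h0 := (hwhite (w v)).trans _ _ _ (.symm _ _ (.rel _ _ (.inr (hw v).symm)))
      have h1 := h0.trans _ _ _ (step _)
      have h2 := h1.trans _ _ _ (step _)
      rw [add_assoc] at h2
      fin_cases s
      · simpa using h0
      · exact h1
      · exact h2
    rintro (i | ⟨v, s⟩)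
    · exact hwhite i
    · simpa using hblack v (s - t v)
  exact .trans _ _ _ (.symm _ _ (key h)) (key h')

theorem BWGraph.sameCycle_next (G : BWGraph m k) {a b : HalfEdge k G.V} (h : G.inv a = b) :
    G.boundaryPerm.SameCycle a (nextPerm k G.V b) :=
  ⟨1, by rw [← h]; rfl⟩

theorem BWGraph.sameCycle_next' (G : BWGraph m k) {a b : HalfEdge k G.V} (h : G.inv a = b) :
    G.boundaryPerm.SameCycle b (nextPerm k G.V a) :=
  G.sameCycle_next (by rw [← h, G.inv_inv])

theorem BWGraph.sameCycle_inr (G : BWGraph m k) {a : HalfEdge k G.V} {v : G.V} {t : Fin 3}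
    (h : G.inv a = Sum.inr (v, t)) : G.boundaryPerm.SameCycle a (Sum.inr (v, t + 1)) := by
  rw [← nextPerm_inr]
  exact G.sameCycle_next h

theorem BWGraph.sameCycle_inr' (G : BWGraph m k) {a : HalfEdge k G.V} {v : G.V} {t : Fin 3}
    (h : G.inv (Sum.inr (v, t)) = a) : G.boundaryPerm.SameCycle a (Sum.inr (v, t + 1)) := by
  rw [← nextPerm_inr]
  exact G.sameCycle_next' h

theorem apply_eq_of_sameCycle {α β : Type*} {σ : Equiv.Perm α} {f : α → β}
    (hf : ∀ x, f (σ x) = f x) {x y : α} (h : σ.SameCycle x y) : f x = f y := by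
  obtain ⟨i, rfl⟩ := h
  induction i using Int.induction_on generalizing x with
  | zero => rfl
  | succ i ih => rw [zpow_add_one, Equiv.Perm.mul_apply, ← ih, hf]
  | pred i ih =>
    rw [zpow_sub_one, Equiv.Perm.mul_apply, ← ih, ← hf (σ⁻¹ x), ← Equiv.Perm.mul_apply, mul_inv_cancel,
      Equiv.Perm.one_apply]

namespace BWGraph.HasComb

variable {n : ℕ} {G : BWGraph m (2 * (n + 1) + 1 + 1)} {ι : Fin n → G.V}

theorem sameCycle_zero (hG : G.HasComb ι) (v : Fin n) :
    G.boundaryPerm.SameCycle (Sum.inl ⟨2 * v + 2, by omega⟩) (Sum.inr (ι v, 0)) := by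
  exact G.sameCycle_inr (hG.white v)

theorem sameCycle_two (hG : G.HasComb ι) (v : Fin n) :
    G.boundaryPerm.SameCycle (Sum.inr (ι v, 2)) (Sum.inl ⟨2 * v + 3, by omega⟩) := by
  have := G.sameCycle_next' (hG.white v)
  rwa [nextPerm_inl (by omega)] at this

theorem sameCycle_one (hG : G.HasComb ι) (v : Fin n) :
    G.boundaryPerm.SameCycle (Sum.inl 0) (Sum.inr (ι v, 1)) := by
  obtain ⟨v, hv⟩ := v
  induction v with
  | zero => exact G.sameCycle_inr (hG.first hv)
  | succ v ih =>
    exact (ih (by omega)).trans (G.sameCycle_inr (hG.next v hv))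

theorem sameCycle_last (hG : G.HasComb ι) :
    G.boundaryPerm.SameCycle (Sum.inl 0) (Sum.inl ⟨2 * n + 3, by omega⟩) := by
  rcases Nat.eq_zero_or_pos n with h | h
  · have := G.sameCycle_next (hG.edge h)
    rwa [nextPerm_inl (by omega)] at this
  · refine (hG.sameCycle_one ⟨n - 1, by omega⟩).trans ?_
    have := G.sameCycle_next' (hG.last h)
    rwa [nextPerm_inl (by omega)] at this

/-- The boundary cycle follows the face between the teeth `2v` and `2v + 2`, in which the half-edge
`2v + 1` lies. -/
theorem sameCycle_white (hG : G.HasComb ι) {v : ℕ} (hv : v ≤ n) :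
    G.boundaryPerm.SameCycle (Sum.inl ⟨2 * v + 2, by omega⟩) (Sum.inl ⟨2 * v + 1, by omega⟩) := by
  rcases hv.lt_or_eq with hv | rfl
  · refine (hG.sameCycle_zero ⟨v, hv⟩).trans ?_
    rcases v with _ | v
    · have := G.sameCycle_next' (hG.first (by omega))
      rwa [nextPerm_inl_zero] at this
    · have h1 := G.sameCycle_inr' (hG.next v hv)
      exact h1.trans (hG.sameCycle_two ⟨v, by omega⟩)
  · rcases v with _ | v
    · have := G.sameCycle_next' (hG.edge rfl)
      rwa [nextPerm_inl_zero] at this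
    · have h1 := G.sameCycle_inr (hG.last (by omega))
      exact h1.trans (hG.sameCycle_two ⟨v, by omega⟩)

end BWGraph.HasComb

/-! ### The boundary cycles of `μ_g` -/

/-- The number of the leaf of `μ_g` in the boundary cycle of a half-edge. -/
def muFace (n : ℕ) : HalfEdge (2 * (n + 1) + 1 + 1) (Fin n) → ℕ
  | Sum.inl i => if i.val = 0 then n + 1 else (i.val - 1) / 2
  | Sum.inr (v, t) => if t = 0 then v.val else if t = 1 then n + 1 else v.val + 1

theorem muFace_lt (n : ℕ) (h : HalfEdge (2 * (n + 1) + 1 + 1) (Fin n)) : muFace n h < n + 2 := by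
  rcases h with i | ⟨v, t⟩
  · simp only [muFace]; split_ifs <;> omega
  · simp only [muFace]; split_ifs <;> omega

/-- The invariance of `muFace` under the boundary permutation, with `inv h` substituted for `h`, so
that the involution occurs only once. -/
theorem muFace_next (n : ℕ) (h : HalfEdge (2 * (n + 1) + 1 + 1) (Fin n)) :
    muFace n (nextPerm _ _ h) = muFace n (muInv n h) := by
  rcases h with ⟨i, hi⟩ | ⟨⟨v, hv⟩, t⟩
  · have h1 : muFace n (nextPerm _ _ (Sum.inl ⟨i, hi⟩)) = i / 2 := by
      rcases Nat.lt_or_ge (i + 1) (2 * (n + 1) + 1 + 1) with h | h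
      · rw [nextPerm_inl h]
        simp [muFace]
      · obtain rfl : i = 2 * (n + 1) + 1 := by omega
        rw [nextPerm_inl_last]
        simp [muFace]
        omega
    rw [h1]
    simp only [muInv]
    split_ifs <;> simp only [muFace] <;> (try split_ifs) <;> (first | omega | simp_all)
  · rw [nextPerm_inr]
    fin_cases t
    · simp [muFace, muInv]
      split_ifs <;> simp <;> omega
    · simp +decide [muFace, muInv]
      split_ifs <;> simp <;> omega
    · simp +decide [muFace, muInv]
      omega

theorem muFace_eq_of_sameCycle (n : ℕ) {h h' : HalfEdge (2 * (n + 1) + 1 + 1) (Fin n)}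
    (hh : (muGraph n).boundaryPerm.SameCycle h h') : muFace n h = muFace n h' := by
  refine apply_eq_of_sameCycle (f := muFace n) (fun x => ?_) hh
  exact (muFace_next n (muInv n x)).trans (congrArg _ (muInv_muInv n x))

/-- Complements the invariance of `muFace`: by both together, the leaves `2j + 1` represent each
boundary cycle exactly once. -/
theorem muGraph_sameCycle (n : ℕ) (h : HalfEdge (2 * (n + 1) + 1 + 1) (Fin n)) :
    (muGraph n).boundaryPerm.SameCycle
      (Sum.inl ⟨2 * muFace n h + 1, by have := muFace_lt n h; omega⟩) h := by
  have hG := muGraph_hasComb n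
  rcases h with ⟨i, hi⟩ | ⟨v, t⟩
  · rcases Nat.eq_zero_or_pos i with rfl | h0
    · exact hG.sameCycle_last.symm
    · obtain ⟨j, rfl | rfl⟩ : ∃ j, i = 2 * j + 1 ∨ i = 2 * j + 2 := ⟨(i - 1) / 2, by omega⟩
      · have : muFace n (Sum.inl ⟨2 * j + 1, hi⟩) = j := by simp [muFace]
        simp only [this]
        exact .refl _ _
      · have : muFace n (Sum.inl ⟨2 * j + 2, hi⟩) = j := by simp [muFace]; omega
        simp only [this]
        exact (hG.sameCycle_white (by omega)).symm
  · fin_cases t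
    · exact (hG.sameCycle_white v.2.le).symm.trans (hG.sameCycle_zero v)
    · exact hG.sameCycle_last.symm.trans (hG.sameCycle_one v)
    · exact (hG.sameCycle_two v).symm

theorem muGraph_isClosed (n : ℕ) : (muGraph n).IsClosed := by
  intro i j h h' hi hj hs
  have := muFace_eq_of_sameCycle n hs
  obtain rfl := Option.some_injective _ hi
  obtain rfl := Option.some_injective _ hj
  simp [muFace] at this
  exact Fin.ext this

theorem muGraph_hasType (n : ℕ) : (muGraph n).HasType 0 (n + 2) := by
  refine ⟨(muGraph n).connected (fun _ => 2) _ (muGraph_hasComb n).inv_two, by simp [muGraph],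
    ?_, ?_⟩
  · let f : Quotient (Equiv.Perm.SameCycle.setoid (muGraph n).boundaryPerm) → Fin (n + 2) :=
      Quotient.lift (fun h => ⟨muFace n h, muFace_lt n h⟩)
        fun _ _ h => Fin.ext (muFace_eq_of_sameCycle n h)
    have hf : Function.Bijective f := by
      constructor
      · rintro ⟨h⟩ ⟨h'⟩ e
        have e' : muFace n h = muFace n h' := congrArg Fin.val e
        refine Quotient.sound ((muGraph_sameCycle n h).symm.trans ?_)
        simp only [e']
        exact muGraph_sameCycle n h'
      · rintro ⟨j, hj⟩
        refine ⟨Quotient.mk _ (Sum.inl ⟨2 * j + 1, by omega⟩), Fin.ext ?_⟩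
        simp [f, muFace]
    rw [Nat.card_eq_of_bijective f hf, Nat.card_fin]
  -- From `2E + (n + 2) = (2n + 4) + 3n` one gets `E = 2n + 1`, hence Euler characteristic `-n - 1`.
  · have h1 := (muGraph n).two_mul_card_edges
    rw [(muGraph n).card_fixed _ fun _ => rfl] at h1
    have h2 : Fintype.card (muGraph n).V = n := Fintype.card_fin n
    rw [h2] at h1 ⊢
    push_cast
    omega

/-! ### The single boundary cycle of `t_g` -/

theorem tGraph_inv_second_two (n : ℕ) (v : ℕ) (hv : v < n + 1) :
    (tGraph n).inv (Sum.inr (Sum.inr ⟨v, hv⟩, 2)) = Sum.inl ⟨2 * v + 1, by omega⟩ := by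
  simp [tGraph, tInv]

theorem tGraph_inv_second_one (n : ℕ) (v : ℕ) (hv : v < n) :
    (tGraph n).inv (Sum.inr (Sum.inr ⟨v, by omega⟩, 1)) =
      Sum.inr (Sum.inr ⟨v + 1, by omega⟩, 0) := by
  simp [tGraph, tInv, hv]

theorem tGraph_inv_second_last (n : ℕ) :
    (tGraph n).inv (Sum.inr (Sum.inr ⟨n, by omega⟩, 1)) = Sum.inl ⟨2 * n + 3, by omega⟩ := by
  simp [tGraph, tInv]

theorem tGraph_inv_root (n : ℕ) :
    (tGraph n).inv (Sum.inr (Sum.inr 0, 0)) = Sum.inr (Sum.inr 0, 0) := by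
  simp [tGraph, tInv]

/-- The first tree ties `0` to the last half-edge and `2j + 2` to `2j + 1`, the second tree ties `2j
+ 3` to `2j + 2`. Walking down from the last half-edge thus reaches the whole white vertex, and
every half-edge of the trees is tied to it. -/
theorem tGraph_sameCycle (n : ℕ) (h : HalfEdge (2 * (n + 1) + 1 + 1) (tGraph n).V) :
    (tGraph n).boundaryPerm.SameCycle (Sum.inl 0) h := by
  have hG := tGraph_hasComb n
  have h2 : ∀ v (hv : v < n + 1), (tGraph n).boundaryPerm.SameCycle
      (Sum.inr (Sum.inr ⟨v, hv⟩, 2)) (Sum.inl ⟨2 * v + 2, by omega⟩) := fun v hv => by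
    have := (tGraph n).sameCycle_next (tGraph_inv_second_two n v hv)
    rwa [nextPerm_inl (by omega)] at this
  have h0 : ∀ v (hv : v < n + 1), (tGraph n).boundaryPerm.SameCycle
      (Sum.inl ⟨2 * v + 1, by omega⟩) (Sum.inr (Sum.inr ⟨v, hv⟩, 0)) := fun v hv => by
    exact (tGraph n).sameCycle_inr' (tGraph_inv_second_two n v hv)
  have step : ∀ i (hi : i + 2 < 2 * (n + 1) + 1 + 1), (tGraph n).boundaryPerm.SameCycle
      (Sum.inl ⟨i + 1, by omega⟩) (Sum.inl ⟨i + 2, hi⟩) := by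
    intro i hi
    obtain ⟨j, rfl | rfl⟩ : ∃ j, i = 2 * j ∨ i = 2 * j + 1 := ⟨i / 2, by omega⟩
    · exact (hG.sameCycle_white (by omega)).symm
    · refine .symm ?_
      rcases Nat.lt_or_ge j n with h | h
      · have h1 := (tGraph n).sameCycle_inr' (tGraph_inv_second_one n j h)
        exact (h0 (j + 1) (by omega)).trans (h1.trans (h2 j _))
      · obtain rfl : j = n := by omega
        have h1 := (tGraph j).sameCycle_inr' (tGraph_inv_second_last j)
        exact h1.trans (h2 j _)
  have hdown : ∀ d (hd : d ≤ 2 * n + 2), (tGraph n).boundaryPerm.SameCycle (Sum.inl 0)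
      (Sum.inl ⟨2 * n + 3 - d, by omega⟩) := by
    intro d
    induction d with
    | zero => exact fun _ => hG.sameCycle_last
    | succ d ih =>
      intro hd
      refine (ih (by omega)).trans ?_
      have := (step (2 * n + 1 - d) (by omega)).symm
      convert this using 3
      · omega
      · omega
  have hwhite : ∀ i, (tGraph n).boundaryPerm.SameCycle (Sum.inl 0) (Sum.inl i) := by
    rintro ⟨i, hi⟩
    rcases Nat.eq_zero_or_pos i with rfl | h
    · exact .refl _ _
    · have := hdown (2 * n + 3 - i) (by omega)
      convert this using 3
      omega
  rcases h with i | ⟨v | ⟨v, hv⟩, t⟩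
  · exact hwhite i
  · fin_cases t
    · exact (hwhite _).trans (hG.sameCycle_zero v)
    · exact hG.sameCycle_one v
    · exact (hwhite _).trans (hG.sameCycle_two v).symm
  · fin_cases t
    · exact (hwhite _).trans (h0 v hv)
    · change (tGraph n).boundaryPerm.SameCycle _ (Sum.inr (Sum.inr ⟨v, hv⟩, 1))
      induction v with
      | zero =>
        exact (hwhite _).trans ((h0 0 hv).trans ((tGraph n).sameCycle_inr (tGraph_inv_root n)))
      | succ v ih =>
        exact (ih (by omega)).trans
          ((tGraph n).sameCycle_inr (tGraph_inv_second_one n v (by omega)))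
    · exact (hwhite _).trans (h2 v hv).symm

theorem tGraph_isClosed (n : ℕ) : (tGraph n).IsClosed :=
  fun _ _ _ _ _ _ _ => Subsingleton.elim _ _

theorem tGraph_hasType (n : ℕ) : (tGraph n).HasType (n + 1) 1 := by
  refine ⟨(tGraph n).connected (fun _ => 2)
    (Sum.elim (fun v => ⟨2 * v + 2, by omega⟩) fun v => ⟨2 * v + 1, by omega⟩) ?_,
    by simp [tGraph], ?_, ?_⟩
  · rintro (v | v)
    · exact (tGraph_hasComb n).inv_two v
    · exact tGraph_inv_second_two n v v.2
  · rw [Nat.card_eq_one_iff_unique]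
    refine ⟨⟨?_⟩, ⟨Quotient.mk _ (Sum.inl 0)⟩⟩
    rintro ⟨h⟩ ⟨h'⟩
    exact Quotient.sound ((tGraph_sameCycle n h).symm.trans (tGraph_sameCycle n h'))
  -- From `2E + 1 = (2n + 4) + 3(2n + 1)` one gets `E = 4n + 3`, hence Euler characteristic `-2n -
  -- 2`.
  · have h1 := (tGraph n).two_mul_card_edges
    rw [(tGraph n).card_fixed _ fun _ => rfl] at h1
    have h2 : Fintype.card (tGraph n).V = n + (n + 1) := by
      change Fintype.card (Fin n ⊕ Fin (n + 1)) = _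
      simp
    rw [h2] at h1 ⊢
    push_cast
    omega

/-! ### A Hochschild class of `R[x]/(x²)` -/

section HochschildClass

/-- Each `E l` occurs twice, with opposite signs. This is the pattern of the coefficient of `1 ⊗ x ⊗
… ⊗ x` in a boundary, for Hochschild chains and for diagrams: the first and the last face see one
term, an inner face two. -/
theorem sum_telescoping {R : Type*} [CommRing R] {p : ℕ} (E : Fin (p + 1) → R) :
    E 0 + ∑ i : Fin p, (-1) ^ ((i : ℕ) + 1) * (E i.castSucc + E i.succ)
      + (-1) ^ (p + 1) * E (Fin.last p) = 0 := by
  induction p with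
  | zero => simp
  | succ p ih =>
    have h := ih fun i => E i.castSucc
    rw [Fin.sum_univ_castSucc]
    simp only [Fin.val_castSucc, Fin.val_last, Fin.succ_last, Fin.succ_castSucc, Fin.castSucc_zero,
      Nat.succ_eq_add_one] at h ⊢
    linear_combination h

variable (R : Type*) [CommRing R]

/-- The coefficient of `1 ⊗ x ⊗ … ⊗ x` in the basis of tensors of `1` and `x`. -/
def topCoeffPre (p : ℕ) : TPow R (DualNumber R) p →ₗ[R] R :=
  PiTensorProduct.lift ((MultilinearMap.mkPiAlgebra R (Fin (p + 1)) R).compLinearMap fun j =>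
    if j = 0 then (TrivSqZeroExt.fstHom R R R).toLinearMap else TrivSqZeroExt.sndHom R R)

theorem topCoeffPre_tprod {p : ℕ} (a : Fin (p + 1) → DualNumber R) :
    topCoeffPre R p (PiTensorProduct.tprod R a) =
      TrivSqZeroExt.fst (a 0) * ∏ j : Fin p, TrivSqZeroExt.snd (a j.succ) := by
  simp [topCoeffPre, Fin.prod_univ_succ]

/-- The coefficient of `1 ⊗ x ⊗ … ⊗ x` in a reduced Hochschild chain. -/
def topCoeff (p : ℕ) : RedChain R (DualNumber R) p →ₗ[R] R :=
  (degenerate R (DualNumber R) p).liftQ (topCoeffPre R p) (by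
    rw [degenerate, Submodule.span_le]
    rintro _ ⟨a, i, hi, ha, rfl⟩
    obtain ⟨i, rfl⟩ := Fin.exists_succ_eq.2 hi
    rw [SetLike.mem_coe, LinearMap.mem_ker, topCoeffPre_tprod,
      Finset.prod_eq_zero (Finset.mem_univ i) (by simp [ha]), mul_zero])

theorem topCoeff_of {p : ℕ} (a : Fin (p + 1) → DualNumber R) :
    topCoeff R p (RedChain.of R (DualNumber R) a) =
      TrivSqZeroExt.fst (a 0) * ∏ j : Fin p, TrivSqZeroExt.snd (a j.succ) :=
  topCoeffPre_tprod R a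

/-- The chain `1 ⊗ x ⊗ … ⊗ x`. -/
abbrev topChain (p : ℕ) : RedChain R (DualNumber R) p :=
  RedChain.of R (DualNumber R) (Fin.cons 1 fun _ => xElt R)

theorem topCoeff_topChain (p : ℕ) : topCoeff R p (topChain R p) = 1 := by
  simp [topCoeff_of]

theorem contractFun_succ_succ {A : Type*} [CommRing A] {p : ℕ} (i : Fin p) (a : Fin (p + 2) → A)
    (j : Fin p) :
    contractFun i.succ a j.succ =
      if j = i then a i.castSucc.succ * a i.succ.succ else a (i.castSucc.succAbove j).succ := by
  simp [contractFun, Fin.succ_inj, ← Fin.succ_castSucc]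

variable {R}

/-! ### Rotations with and without signs -/

/-- The last face, which involves the rotation, has the same effect on the coefficients at
`1 ⊗ x ⊗ … ⊗ x` and on the chains `1 ⊗ x ⊗ … ⊗ x` as for the rotation without signs. -/
structure Rotation.IsSphereLike (ρ : Rotation R (DualNumber R)) : Prop where
  topCoeffPre_contract : ∀ p (a : Fin (p + 2) → DualNumber R),
    topCoeffPre R p (contract R (DualNumber R) 0 (ρ.map (p + 1) (PiTensorProduct.tprod R a))) =
      TrivSqZeroExt.fst (a 0) * TrivSqZeroExt.fst (a (Fin.last _)) *
        ∏ j : Fin p, TrivSqZeroExt.snd (a j.castSucc.succ)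
  contract_one : ∀ a : Fin 2 → DualNumber R,
    contract R (DualNumber R) 0 (ρ.map 1 (PiTensorProduct.tprod R a)) =
      PiTensorProduct.tprod R fun _ => a 0 * a 1
  contract_top : ∀ q,
    contract R (DualNumber R) 0 (ρ.map (2 * q + 1)
        (PiTensorProduct.tprod R (Fin.cons 1 fun _ => xElt R))) =
      PiTensorProduct.tprod R fun _ => xElt R

theorem plainRotation_tprod {A : Type*} [CommRing A] [Algebra R A] {p : ℕ} (a : Fin (p + 1) → A) :
    (plainRotation R A).map p (PiTensorProduct.tprod R a) =
      PiTensorProduct.tprod R (Fin.cons (a (Fin.last p)) fun j : Fin p => a j.castSucc) := by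
  have h : (plainRotation R A).map p (PiTensorProduct.tprod R a) =
      PiTensorProduct.tprod R fun j => a ((finRotate (p + 1)).symm j) := by simp [plainRotation]
  rw [h]
  congr 1
  funext j
  refine Fin.cases ?_ (fun j => ?_) j
  · rw [finRotate_symm_zero]; rfl
  · rw [finRotate_symm_succ]; rfl

theorem contractFun_zero_cons {A : Type*} [CommRing A] {p : ℕ} (u : A) (a : Fin (p + 1) → A) :
    contractFun 0 (Fin.cons u a : Fin (p + 2) → A) =
      Fin.cons (u * a 0) fun j : Fin p => a j.succ := by
  funext j
  refine Fin.cases ?_ (fun j => ?_) j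
  · simp [contractFun]
  · simp [contractFun, Fin.succ_ne_zero]

theorem plainRotation_isSphereLike : (plainRotation R (DualNumber R)).IsSphereLike where
  topCoeffPre_contract p a := by
    rw [plainRotation_tprod, contract_tprod, contractFun_zero_cons, topCoeffPre_tprod]
    simp [mul_comm]
  contract_one a := by
    rw [plainRotation_tprod, contract_tprod, contractFun_zero_cons]
    congr 1
    funext j
    fin_cases j
    simp [mul_comm]
  contract_top q := by
    rw [plainRotation_tprod, contract_tprod, contractFun_zero_cons]
    congr 1
    funext j
    refine Fin.cases ?_ (fun j => ?_) j
    · simp [← Fin.succ_last]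
    · simp [← Fin.succ_castSucc]

theorem sphereRotation_tprod (N : ℕ) {p : ℕ} (a : Fin (p + 1) → DualNumber R) :
    (sphereRotation R N).map p (PiTensorProduct.tprod R a) =
      PiTensorProduct.tprod R (Fin.cons (TrivSqZeroExt.inl (TrivSqZeroExt.fst (a (Fin.last p))))
        fun j : Fin p => a j.castSucc) +
      PiTensorProduct.tprod R (Fin.cons (TrivSqZeroExt.inr (TrivSqZeroExt.snd (a (Fin.last p))))
        fun j : Fin p => signMap R N (a j.castSucc)) := by
  simp only [sphereRotation]
  rw [LinearMap.comp_apply, plainRotation_tprod, LinearMap.add_apply, PiTensorProduct.map_tprod,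
    PiTensorProduct.map_tprod]
  congr 2
  · funext j
    refine Fin.cases ?_ (fun j => ?_) j
    · simp
    · simp
  · funext j
    refine Fin.cases ?_ (fun j => ?_) j
    · simp
    · simp

theorem signMap_one (N : ℕ) : signMap R N 1 = 1 := by
  simp [signMap]

theorem signMap_xElt (N : ℕ) : signMap R N (xElt R) = (-1 : R) ^ N • xElt R := by
  simp [signMap]

/-- Signs come only with the `x`-part of the last factor. Moved to the front, this part has no
coefficient at a leading `1`; in degree one it meets only the unit part of `a 0`, as `x² = 0`; and
in `1 ⊗ x ⊗ … ⊗ x` it passes `2q` factors `x`, so the signs cancel. -/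
theorem sphereRotation_isSphereLike (N : ℕ) : (sphereRotation R N).IsSphereLike where
  topCoeffPre_contract p a := by
    rw [sphereRotation_tprod, map_add, contract_tprod, contract_tprod, contractFun_zero_cons,
      contractFun_zero_cons, map_add, topCoeffPre_tprod, topCoeffPre_tprod]
    simp [mul_comm]
  contract_one a := by
    rw [sphereRotation_tprod, map_add, contract_tprod, contract_tprod, contractFun_zero_cons,
      contractFun_zero_cons]
    have h' : ∀ u v : DualNumber R, PiTensorProduct.tprod R (fun _ : Fin 1 => u) +
        PiTensorProduct.tprod R (fun _ : Fin 1 => v) =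
          PiTensorProduct.tprod R fun _ : Fin 1 => u + v := by
      intro u v
      have e : ∀ u : DualNumber R, (fun _ : Fin 1 => u) =
          Function.update (fun _ : Fin 1 => (0 : DualNumber R)) 0 u := by
        intro u
        funext j
        fin_cases j
        simp
      rw [e u, e v, e (u + v), MultilinearMap.map_update_add]
    have e : ∀ (u : DualNumber R) (f : Fin 0 → DualNumber R),
        (Fin.cons u f : Fin 1 → DualNumber R) = fun _ => u := by
      intro u f
      funext j
      fin_cases j
      simp
    rw [e, e, h']
    congr 1
    funext
    ext <;> simp [signMap] <;> ring
  contract_top q := by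
    rw [sphereRotation_tprod, map_add, contract_tprod, contract_tprod, contractFun_zero_cons,
      contractFun_zero_cons, MultilinearMap.map_coord_zero _ (0 : Fin (2 * q + 1)), zero_add]
    · let c : Fin (2 * q + 1) → R := Fin.cons 1 fun _ => (-1) ^ N
      have hc : ∏ j, c j = 1 := by
        simp [c, Fin.prod_univ_succ, ← pow_mul, mul_comm 2 q, ← mul_assoc]
      rw [← one_smul R (PiTensorProduct.tprod R fun _ => xElt R), ← hc,
        ← MultilinearMap.map_smul_univ]
      congr 1
      funext j
      refine Fin.cases ?_ (fun j => ?_) j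
      · simp [c, ← Fin.succ_last, signMap_one]
      · simp [c, ← Fin.succ_castSucc, signMap_xElt]
    · simp [← Fin.succ_last]

/-! ### The class of `1 ⊗ x ⊗ … ⊗ x` and maps induced on homology -/

theorem hochPre_tprod (ρ : Rotation R (DualNumber R)) {p : ℕ} (a : Fin (p + 2) → DualNumber R) :
    hochPre ρ p (PiTensorProduct.tprod R a) =
      ∑ i : Fin (p + 1), (-1 : R) ^ (i : ℕ) • PiTensorProduct.tprod R (contractFun i a) +
        (-1 : R) ^ (p + 1) • contract R (DualNumber R) 0
          (ρ.map (p + 1) (PiTensorProduct.tprod R a)) := by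
  simp [hochPre, contract_tprod, LinearMap.sum_apply]

variable {ρ : Rotation R (DualNumber R)}

/-- `E l` is the coefficient with `1` at the places `0` and `l + 1` and `x` elsewhere. The unit at
the start of the first or of the rotated face must be `1 · 1`, giving `E 0` or the last term; an `x`
produced by an inner face is `1 · x` or `x · 1`, giving two neighbouring terms. -/
theorem Rotation.IsSphereLike.topCoeffPre_hochPre (hρ : ρ.IsSphereLike) (p : ℕ) :
    topCoeffPre R p ∘ₗ hochPre ρ p = 0 := by
  refine PiTensorProduct.ext (MultilinearMap.ext fun a => ?_)
  let E : Fin (p + 1) → R := fun l => TrivSqZeroExt.fst (a 0) * TrivSqZeroExt.fst (a l.succ) *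
    ∏ j : Fin p, TrivSqZeroExt.snd (a (l.succAbove j).succ)
  refine Eq.trans ?_ (sum_telescoping E)
  simp only [LinearMap.compMultilinearMap_apply, LinearMap.comp_apply, hochPre_tprod, map_add,
    map_sum, map_smul, smul_eq_mul, hρ.topCoeffPre_contract]
  congr 1
  · rw [Fin.sum_univ_succ]
    congr 1
    · simp [topCoeffPre_tprod, E, contractFun, Fin.succ_ne_zero]
    · refine Finset.sum_congr rfl fun i _ => ?_
      rw [Fin.val_succ, topCoeffPre_tprod]
      congr 1
      have h0 : contractFun i.succ a 0 = a 0 := by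
        simp [contractFun, (Fin.succ_ne_zero i).symm]
      -- Omitting the place `i` or the place `i + 1` leaves the same factors, apart from the one at
      -- `i`.
      have hp : ∀ l : Fin (p + 1), (∀ j, j ≠ i → l.succAbove j = i.castSucc.succAbove j) →
          ∏ j : Fin p, TrivSqZeroExt.snd (a (l.succAbove j).succ) =
            TrivSqZeroExt.snd (a (l.succAbove i).succ) * ∏ j ∈ Finset.univ.erase i,
              TrivSqZeroExt.snd (a (i.castSucc.succAbove j).succ) := by
        intro l hl
        rw [← Finset.mul_prod_erase _ _ (Finset.mem_univ i)]
        congr 1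
        exact Finset.prod_congr rfl fun j hj => by rw [hl j (Finset.ne_of_mem_erase hj)]
      simp only [E]
      rw [h0, hp _ fun _ _ => rfl, hp _ fun _ h => succ_succAbove_of_ne h,
        ← Finset.mul_prod_erase _ _ (Finset.mem_univ i),
        Finset.prod_congr (g := fun j => TrivSqZeroExt.snd (a (i.castSucc.succAbove j).succ)) rfl
          fun j hj => by rw [contractFun_succ_succ, if_neg (Finset.ne_of_mem_erase hj)],
        contractFun_succ_succ, if_pos rfl, Fin.succAbove_castSucc_self, Fin.succAbove_succ_self,
        TrivSqZeroExt.snd_mul]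
      simp
      ring
  · simp [E]

/-- The coefficient of `1 ⊗ x ⊗ … ⊗ x` on Hochschild homology. -/
def Rotation.IsSphereLike.topCoeffHH (hρ : ρ.IsSphereLike) (p : ℕ) : HH ρ p →ₗ[R] R :=
  Submodule.liftQ _ (topCoeff R p ∘ₗ (hochCycles ρ p).subtype) (by
    rintro ⟨c, hc⟩ ⟨b, hb⟩
    obtain ⟨t, rfl⟩ := Submodule.mkQ_surjective _ b
    have h := LinearMap.congr_fun (hρ.topCoeffPre_hochPre p) t
    rw [LinearMap.mem_ker]
    change topCoeff R p c = 0
    rw [← show _ = c from hb]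
    exact h)

/-- The first and the rotated face both equal `x ⊗ … ⊗ x`, and in odd degree their signs are
opposite. The inner faces contain `x² = 0`. -/
theorem Rotation.IsSphereLike.topChain_mem (hρ : ρ.IsSphereLike) (q : ℕ) :
    topChain R (2 * q + 1) ∈ hochCycles ρ (2 * q + 1) := by
  rw [hochCycles, LinearMap.mem_ker]
  change (degenerate R (DualNumber R) (2 * q)).mkQ (hochPre ρ (2 * q) _) = 0
  rw [hochPre_tprod, hρ.contract_top, Fin.sum_univ_succ, Finset.sum_eq_zero, contractFun_zero_cons]
  · have h : (Fin.cons (xElt R) fun _ => xElt R : Fin (2 * q + 1) → DualNumber R) =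
        fun _ => xElt R := by
      funext j
      refine Fin.cases ?_ (fun j => ?_) j <;> simp
    simp [h, pow_succ]
  · intro i _
    rw [(PiTensorProduct.tprod R).map_coord_zero i.succ (by simp [contractFun, ← Fin.succ_castSucc]),
      smul_zero]

/-- The coefficient of `x` on `HH₀`. -/
def Rotation.IsSphereLike.sndHH (hρ : ρ.IsSphereLike) : HH ρ 0 →ₗ[R] R :=
  Submodule.liftQ _ ((Submodule.liftQ (degenerate R (DualNumber R) 0)
    (PiTensorProduct.lift ((MultilinearMap.mkPiAlgebra R (Fin 1) R).compLinearMap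
      fun _ => TrivSqZeroExt.sndHom R R)) (by
        rw [degenerate, Submodule.span_le]
        rintro _ ⟨a, i, hi, -, rfl⟩
        exact (hi (Subsingleton.elim (α := Fin 1) _ _)).elim)) ∘ₗ (hochCycles ρ 0).subtype) (by
    rintro ⟨c, hc⟩ ⟨b, hb⟩
    obtain ⟨t, rfl⟩ := Submodule.mkQ_surjective _ b
    rw [LinearMap.mem_ker]
    rw [Submodule.subtype_apply] at hb
    rw [LinearMap.comp_apply, Submodule.subtype_apply, ← hb]
    -- Both faces in degree one are the product `a 0 * a 1`, so there are no nonzero boundaries in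
    -- degree zero.
    suffices h : hochPre ρ 0 = 0 by
      change Submodule.liftQ _ _ _ ((degenerate R (DualNumber R) 0).mkQ (hochPre ρ 0 t)) = 0
      rw [h, LinearMap.zero_apply, map_zero, map_zero]
    refine PiTensorProduct.ext (MultilinearMap.ext fun a => ?_)
    have h : contractFun (0 : Fin 1) a = fun _ => a 0 * a 1 := by
      funext j
      fin_cases j
      simp [contractFun]
    simp [hochPre_tprod, hρ.contract_one, h])

theorem Rotation.IsSphereLike.sndHH_zeroClass (hρ : ρ.IsSphereLike) (a : DualNumber R) :
    hρ.sndHH (HH.zeroClass ρ a) = TrivSqZeroExt.snd a := by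
  change PiTensorProduct.lift _ (PiTensorProduct.tprod R fun _ => a) = _
  simp

/-- The Hochschild homology class of `1 ⊗ x ⊗ … ⊗ x`, with an odd number of factors `x`. -/
def Rotation.IsSphereLike.topClass (hρ : ρ.IsSphereLike) (q : ℕ) : HH ρ (2 * q + 1) :=
  HH.mk ρ (topChain R (2 * q + 1)) (hρ.topChain_mem q)

theorem Rotation.IsSphereLike.topCoeffHH_topClass (hρ : ρ.IsSphereLike) (q : ℕ) :
    hρ.topCoeffHH _ (hρ.topClass q) = 1 :=
  topCoeff_topChain R _

theorem HH.mk_smul {p : ℕ} (c : RedChain R (DualNumber R) p) (hc : c ∈ hochCycles ρ p) (r : R) :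
    HH.mk ρ (r • c) (Submodule.smul_mem _ r hc) = r • HH.mk ρ c hc :=
  Submodule.Quotient.mk_smul _ (r := r) (x := (⟨c, hc⟩ : hochCycles ρ p))

theorem Rotation.IsSphereLike.smul_topClass (hρ : ρ.IsSphereLike) {q : ℕ} {r : R}
    {c : RedChain R (DualNumber R) (2 * q + 1)} (hc : c = r • topChain R (2 * q + 1))
    (h : c ∈ hochCycles ρ (2 * q + 1)) : r • hρ.topClass q = HH.mk ρ c h := by
  subst hc
  exact (HH.mk_smul _ _ _).symm

/-- Evaluating at `y` and then applying `φ` gives `±1`. -/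
theorem smulRight_smul_ne_zero {R M N : Type*} [CommRing R] [Nontrivial R] [AddCommMonoid M]
    [Module R M] [AddCommGroup N] [Module R N] (T : M →ₗ[R] R) {y : M} (hy : T y = 1)
    (φ : N →ₗ[R] R) {z : N} (hz : φ z = 1) (u : ℤˣ) :
    T.smulRight (((u : ℤ) : R) • z) ≠ 0 := by
  intro h
  have h1 := congrArg φ (LinearMap.congr_fun h y)
  rcases Int.units_eq_one_or u with rfl | rfl <;> simp [hy, hz] at h1

/-- By `hf` the operation factors through the coefficient of `x`, which is already defined on `HH₀`,
so the induced map can be written down directly. On the class of `x` its value is, up to sign, the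
class of `1 ⊗ x ⊗ … ⊗ x`. -/
theorem Rotation.IsSphereLike.inducesNonzero [Nontrivial R] (hρ : ρ.IsSphereLike) {q : ℕ} (u : ℤˣ)
    {f : MultilinearMap R (fun _ : Fin 1 => DualNumber R) (RedChain R (DualNumber R) (2 * q + 1))}
    (hf : ∀ a, f a = (((u : ℤ) : R) * ∏ j, TrivSqZeroExt.snd (a j)) • topChain R (2 * q + 1)) :
    InducesNonzero ρ f := by
  refine ⟨hρ.sndHH.smulRight (((u : ℤ) : R) • hρ.topClass q), fun a => ?_, ?_⟩
  · have hm : f (fun _ => a) ∈ hochCycles ρ (2 * q + 1) := by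
      rw [hf]
      exact Submodule.smul_mem _ _ (hρ.topChain_mem q)
    refine ⟨hm, ?_⟩
    rw [LinearMap.smulRight_apply, hρ.sndHH_zeroClass, smul_smul]
    exact hρ.smul_topClass (by rw [hf, mul_comm ((u : ℤ) : R)]; simp) hm
  · exact smulRight_smul_ne_zero _ ((hρ.sndHH_zeroClass (xElt R)).trans (by simp)) _
      (hρ.topCoeffHH_topClass q) u

theorem Rotation.IsSphereLike.inducesNonzeroTensor [Nontrivial R] (hρ : ρ.IsSphereLike)
    {m q : ℕ} (u : ℤˣ)
    {f : MultilinearMap R (fun _ : Fin m => DualNumber R) (RedChain R (DualNumber R) (2 * q + 1))}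
    (hf : ∀ a, f a = (((u : ℤ) : R) * ∏ j, TrivSqZeroExt.snd (a j)) • topChain R (2 * q + 1)) :
    InducesNonzeroTensor ρ f := by
  let T : (⨂[R] _ : Fin m, HH ρ 0) →ₗ[R] R := PiTensorProduct.lift
    ((MultilinearMap.mkPiAlgebra R (Fin m) R).compLinearMap fun _ => hρ.sndHH)
  have hT : ∀ a : Fin m → DualNumber R,
      T (PiTensorProduct.tprod R fun j => HH.zeroClass ρ (a j)) =
        ∏ j, TrivSqZeroExt.snd (a j) := fun a => by
    simp [T, hρ.sndHH_zeroClass]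
  refine ⟨T.smulRight (((u : ℤ) : R) • hρ.topClass q), fun a => ?_, ?_⟩
  · have hm : f a ∈ hochCycles ρ (2 * q + 1) := by
      rw [hf]
      exact Submodule.smul_mem _ _ (hρ.topChain_mem q)
    refine ⟨hm, ?_⟩
    rw [LinearMap.smulRight_apply, hT, smul_smul]
    exact hρ.smul_topClass (by rw [hf, mul_comm ((u : ℤ) : R)]) hm
  · have h1 : T (PiTensorProduct.tprod R fun _ => HH.zeroClass ρ (xElt R)) = 1 :=
      (hT fun _ => xElt R).trans (by simp)
    exact smulRight_smul_ne_zero T h1 _ (hρ.topCoeffHH_topClass q) u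

end HochschildClass

/-! ### The action on `R[x]/(x²)` as a count of labellings -/

section Weights

variable (R : Type*) [CommRing R]

@[simp]
theorem dualBasis_false : dualBasis R false = 1 := by
  simp [dualBasis, Module.Basis.coe_ofEquivFun]

@[simp]
theorem dualBasis_true : dualBasis R true = xElt R := by
  simp [dualBasis, Module.Basis.coe_ofEquivFun]

theorem dualBasis_coord_true (a : DualNumber R) :
    (dualBasis R).coord true a = TrivSqZeroExt.snd a := by
  simp [dualBasis, Module.Basis.coord_apply]

theorem dualFrobenius_copairing (i j : Bool) :
    (dualFrobenius R).copairing (dualBasis R) i j = if i ≠ j then 1 else 0 := by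
  have h : (dualFrobenius R).comul 1 = dualBasis R false ⊗ₜ[R] dualBasis R true +
      dualBasis R true ⊗ₜ[R] dualBasis R false := by
    simp [dualFrobenius]
  rw [Frobenius.copairing, h, map_add, Finsupp.add_apply,
    Module.Basis.tensorProduct_repr_tmul_apply, Module.Basis.tensorProduct_repr_tmul_apply]
  cases i <;> cases j <;> simp [-dualBasis_false, -dualBasis_true, Finsupp.single_apply]

theorem dualFrobenius_vertex (i j l : Bool) :
    (dualFrobenius R).vertex (dualBasis R) i j l =
      if i.toNat + j.toNat + l.toNat = 1 then 1 else 0 := by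
  rw [Frobenius.vertex]
  cases i <;> cases j <;> cases l <;> simp [dualFrobenius]

/-- A labelling of the half-edges by `1` and `x` contributes to the action if each edge has one
half labelled by `x`, and each black vertex has one half-edge labelled by `x`. -/
structure BWGraph.IsAdmissible (G : BWGraph m k) (c : HalfEdge k G.V → Bool) : Prop where
  edge : ∀ h, G.inv h ≠ h → c h ≠ c (G.inv h)
  vertex : ∀ v, (c (Sum.inr (v, 0))).toNat + (c (Sum.inr (v, 1))).toNat +
    (c (Sum.inr (v, 2))).toNat = 1

-- All structure constants are `0` or `1`: `ν(1)` selects two different labels on an edge, and `ε`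
-- of a product of three basis elements is `1` exactly if one and only one of them is `x`. The
-- product of the weights is therefore an indicator function.
open Classical in
theorem weight_eq (G : BWGraph m k) (μ : Fin k → Bool) (β : G.V × Fin 3 → Bool) :
    edgeWeight (dualFrobenius R) (dualBasis R) G (Sum.elim μ β) *
      vertexWeight (dualFrobenius R) (dualBasis R) β =
    if G.IsAdmissible (Sum.elim μ β) then 1 else 0 := by
  have h1 : edgeWeight (dualFrobenius R) (dualBasis R) G (Sum.elim μ β) =
      if ∀ h, G.inv h ≠ h → Sum.elim μ β h ≠ Sum.elim μ β (G.inv h) then 1 else 0 := by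
    rw [edgeWeight]
    split_ifs with h
    · refine Finset.prod_eq_one fun e he => ?_
      obtain ⟨x, hx, rfl⟩ := Finset.mem_image.1 he
      refine (dualFrobenius_copairing R _ _).trans (if_pos (h x (Finset.mem_filter.1 hx).2))
    · push Not at h
      obtain ⟨x, hx, hc⟩ := h
      refine Finset.prod_eq_zero (i := s(x, G.inv x))
        (Finset.mem_image_of_mem _ (Finset.mem_filter.2 ⟨Finset.mem_univ _, hx⟩)) ?_
      exact (dualFrobenius_copairing R _ _).trans (if_neg (not_not.2 hc))
  have h2 : vertexWeight (dualFrobenius R) (dualBasis R) β =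
      if ∀ v, (Sum.elim μ β (Sum.inr (v, 0))).toNat + (Sum.elim μ β (Sum.inr (v, 1))).toNat +
        (Sum.elim μ β (Sum.inr (v, 2))).toNat = 1 then 1 else 0 := by
    rw [vertexWeight]
    simp only [dualFrobenius_vertex]
    rw [Finset.prod_ite_zero]
    simp
    congr
  rw [h1, h2]
  by_cases h : G.IsAdmissible (Sum.elim μ β)
  · rw [if_pos h, if_pos h.edge, if_pos h.vertex, mul_one]
  · rw [if_neg h]
    by_cases he : ∀ h, G.inv h ≠ h → Sum.elim μ β h ≠ Sum.elim μ β (G.inv h)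
    · rw [if_neg fun hv => h ⟨he, hv⟩, mul_zero]
    · rw [if_neg he, zero_mul]

end Weights

/-! ### The standard labelling of `μ_g` and `t_g` -/

/-- The label of the half-edge `0` at the white vertex is `1`, those of the other half-edges at the
white vertex are `x`; the label of the first half-edge of each black vertex is `x`, and those of its
other half-edges are `1`. -/
def stdLabel {V : Type} : HalfEdge (k + 1) V → Bool
  | Sum.inl i => decide (i ≠ 0)
  | Sum.inr (_, t) => decide (t = 0)

theorem stdLabel_mk {V : Type} {i : ℕ} (hi : i < k + 1) :
    stdLabel (Sum.inl ⟨i, hi⟩ : HalfEdge (k + 1) V) = decide (i ≠ 0) := by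
  simp [stdLabel, Fin.ext_iff]

theorem stdLabel_zero {V : Type} : stdLabel (Sum.inl 0 : HalfEdge (k + 1) V) = false := rfl

theorem stdLabel_inr {V : Type} (x : V × Fin 3) :
    stdLabel (Sum.inr x : HalfEdge (k + 1) V) = decide (x.2 = 0) := rfl

/-- The standard labelling is the only one that contributes to the coefficients of `1 ⊗ x ⊗ … ⊗ x`
and `x ⊗ x ⊗ … ⊗ x`, and it has the label `x` at all leaves. -/
structure BWGraph.HasStdLabel (G : BWGraph m (k + 1)) : Prop where
  admissible : G.IsAdmissible stdLabel
  unique : ∀ c, G.IsAdmissible c → (∀ i, i ≠ 0 → c (Sum.inl i) = true) → c = stdLabel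
  leaf : ∀ j, ∃ h, G.leaf j = some h ∧ stdLabel h = true

namespace BWGraph.HasComb

variable {n : ℕ} {G : BWGraph m (2 * (n + 1) + 1 + 1)} {ι : Fin n → G.V}
  {c : HalfEdge (2 * (n + 1) + 1 + 1) G.V → Bool}

theorem label_two (hG : G.HasComb ι) (hc : G.IsAdmissible c)
    (h : ∀ i, i ≠ 0 → c (Sum.inl i) = true) (v : Fin n) : c (Sum.inr (ι v, 2)) = false := by
  have h1 := hc.edge (Sum.inl ⟨2 * v + 2, by omega⟩) (by simp [hG.white])
  rw [hG.white, h _ (by simp [Fin.ext_iff])] at h1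
  simpa using h1.symm

theorem label_aux (hG : G.HasComb ι) (hc : G.IsAdmissible c)
    (h : ∀ i, i ≠ 0 → c (Sum.inl i) = true) (v : Fin n) (h1 : c (Sum.inr (ι v, 1)) = false) :
    c (Sum.inr (ι v, 0)) = true := by
  have := hc.vertex (ι v)
  rw [h1, hG.label_two hc h] at this
  simpa using this

/-- Labels are forced from the far end of the comb. The outputs `x` at the teeth put the label `1`
on the half-edges `1` and `2` of the last vertex, so its half-edge `0` is `x`; the half-edge `1` of
the vertex before it is then labelled `1`, and so on. -/
theorem label_one (hG : G.HasComb ι) (hc : G.IsAdmissible c)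
    (h : ∀ i, i ≠ 0 → c (Sum.inl i) = true) (v : Fin n) : c (Sum.inr (ι v, 1)) = false := by
  obtain ⟨v, hv⟩ := v
  have key : ∀ d (hd : d < n), c (Sum.inr (ι ⟨n - 1 - d, by omega⟩, 1)) = false := by
    intro d
    induction d with
    | zero =>
      intro hd
      have h1 := hc.edge (Sum.inl ⟨2 * n + 2, by omega⟩) (by simp [hG.last hd])
      rw [hG.last hd, h _ (by simp [Fin.ext_iff])] at h1
      simpa using h1.symm
    | succ d ih =>
      intro hd
      have h0 := hG.label_aux hc h _ (ih (by omega))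
      have e := hG.next (n - 1 - (d + 1)) (by omega)
      have h1 := hc.edge (Sum.inr (ι ⟨n - 1 - (d + 1), by omega⟩, 1)) (by simp [e])
      have e' : (⟨n - 1 - (d + 1) + 1, by omega⟩ : Fin n) = ⟨n - 1 - d, by omega⟩ := by
        rw [Fin.mk.injEq]; omega
      rw [e, e', h0] at h1
      simpa using h1
  have e : (⟨v, hv⟩ : Fin n) = ⟨n - 1 - (n - 1 - v), by omega⟩ := by rw [Fin.mk.injEq]; omega
  rw [e]
  exact key _ (by omega)

theorem label_zero (hG : G.HasComb ι) (hc : G.IsAdmissible c)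
    (h : ∀ i, i ≠ 0 → c (Sum.inl i) = true) (v : Fin n) : c (Sum.inr (ι v, 0)) = true :=
  hG.label_aux hc h v (hG.label_one hc h v)

theorem label_start (hG : G.HasComb ι) (hc : G.IsAdmissible c)
    (h : ∀ i, i ≠ 0 → c (Sum.inl i) = true) : c (Sum.inl 0) = false := by
  have h1 := hc.edge (Sum.inl 0) (hG.inv_white_ne (j := 0) (by omega))
  rcases Nat.eq_zero_or_pos n with hn | hn
  · rw [hG.edge hn, h ⟨2 * n + 2, _⟩ (by simp [Fin.ext_iff])] at h1
    simpa using h1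
  · rw [hG.first hn, hG.label_zero hc h] at h1
    simpa using h1

end BWGraph.HasComb

theorem muGraph_hasStdLabel (n : ℕ) : (muGraph n).HasStdLabel where
  admissible := by
    refine ⟨?_, fun v => by simp [stdLabel]⟩
    rintro (⟨i, hi⟩ | ⟨⟨v, hv⟩, t⟩) h
    · simp only [muGraph, muInv] at h ⊢
      split_ifs at h ⊢ <;> simp_all [stdLabel_mk, stdLabel_zero, stdLabel_inr]
    · fin_cases t
      · simp only [muGraph, muInv]
        simp
        split_ifs <;> simp_all [stdLabel_mk, stdLabel_zero, stdLabel_inr]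
      · simp only [muGraph, muInv]
        simp
        split_ifs <;> simp_all [stdLabel_mk, stdLabel_zero, stdLabel_inr]
      · simp [muGraph, muInv, stdLabel_mk, stdLabel_inr]
  unique c hc h := by
    have hG := muGraph_hasComb n
    funext x
    rcases x with i | ⟨v, t⟩
    · by_cases hi : i = 0
      · subst hi
        exact hG.label_start hc h
      · simp [stdLabel, hi, h i hi]
    · fin_cases t
      · exact hG.label_zero hc h v
      · exact hG.label_one hc h v
      · exact hG.label_two hc h v
  leaf j := ⟨_, rfl, (stdLabel_mk _).trans (by simp)⟩

/-- The second tree propagates the labels like the first, but its chain ends at the root instead of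
the start. So the root, which is the only leaf, is forced to carry `x`. -/
theorem tGraph_hasStdLabel (n : ℕ) : (tGraph n).HasStdLabel where
  admissible := by
    refine ⟨?_, fun v => by simp [stdLabel]⟩
    rintro (⟨i, hi⟩ | ⟨⟨v, hv⟩ | ⟨v, hv⟩, t⟩) h
    · simp only [tGraph, tInv] at h ⊢
      split_ifs at h ⊢ <;> simp_all [stdLabel_mk, stdLabel_zero, stdLabel_inr] <;> omega
    · fin_cases t
      · simp only [tGraph, tInv]
        simp
        split_ifs <;> simp_all [stdLabel_mk, stdLabel_zero, stdLabel_inr]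
      · simp only [tGraph, tInv]
        simp
        split_ifs <;> simp_all [stdLabel_mk, stdLabel_zero, stdLabel_inr]
      · simp [tGraph, tInv, stdLabel_mk, stdLabel_inr]
    · fin_cases t
      · simp only [tGraph, tInv] at h ⊢
        simp at h ⊢
        split_ifs at h ⊢ <;> simp_all [stdLabel_mk, stdLabel_zero, stdLabel_inr]
      · simp only [tGraph, tInv]
        simp
        split_ifs <;> simp_all [stdLabel_mk, stdLabel_zero, stdLabel_inr]
      · simp [tGraph, tInv, stdLabel_mk, stdLabel_inr]
  unique c hc h := by
    have hG := tGraph_hasComb n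
    have h2 : ∀ v (hv : v < n + 1), c (Sum.inr (Sum.inr ⟨v, hv⟩, 2)) = false := fun v hv => by
      have e := tGraph_inv_second_two n v hv
      have h1 := hc.edge _ (by rw [e]; simp)
      rw [e, h _ (by simp [Fin.ext_iff])] at h1
      simpa using h1
    have h0 : ∀ v (hv : v < n + 1), c (Sum.inr (Sum.inr ⟨v, hv⟩, 1)) = false →
        c (Sum.inr (Sum.inr ⟨v, hv⟩, 0)) = true := fun v hv h1 => by
      have := hc.vertex (Sum.inr ⟨v, hv⟩)
      rw [h1, h2] at this
      simpa using this
    have h1 : ∀ d (hd : d < n + 1), c (Sum.inr (Sum.inr ⟨n - d, by omega⟩, 1)) = false := by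
      intro d
      induction d with
      | zero =>
        intro hd
        have e := tGraph_inv_second_last n
        have h1 := hc.edge _ (by rw [e]; simp)
        rw [e, h _ (by simp [Fin.ext_iff])] at h1
        simpa using h1
      | succ d ih =>
        intro hd
        have h3 := h0 _ _ (ih (by omega))
        have e := tGraph_inv_second_one n (n - (d + 1)) (by omega)
        have h1 := hc.edge (Sum.inr (Sum.inr ⟨n - (d + 1), by omega⟩, 1)) (by
          rw [e]
          exact fun h => absurd (congrArg Prod.snd (Sum.inr_injective h)) (by decide : (0 : Fin 3) ≠ 1))
        have e' : (⟨n - (d + 1) + 1, by omega⟩ : Fin (n + 1)) = ⟨n - d, by omega⟩ := by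
          rw [Fin.mk.injEq]; omega
        rw [e, e'] at h1
        exact Bool.eq_false_of_not_eq_true fun h => h1 (h.trans h3.symm)
    have h1' : ∀ v (hv : v < n + 1), c (Sum.inr (Sum.inr ⟨v, hv⟩, 1)) = false := fun v hv => by
      have e : (⟨v, hv⟩ : Fin (n + 1)) = ⟨n - (n - v), by omega⟩ := by rw [Fin.mk.injEq]; omega
      rw [e]
      exact h1 _ (by omega)
    funext x
    rcases x with i | ⟨v | ⟨v, hv⟩, t⟩
    · by_cases hi : i = 0
      · subst hi
        exact hG.label_start hc h
      · simp [stdLabel, hi, h i hi]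
    · fin_cases t
      · exact hG.label_zero hc h v
      · exact hG.label_one hc h v
      · exact hG.label_two hc h v
    · fin_cases t
      · exact h0 v hv (h1' v hv)
      · exact h1' v hv
      · exact h2 v hv
  leaf j := ⟨_, rfl, by simp [stdLabel]⟩

/-! ### The values of the operations -/

section Action

variable {R : Type*} [CommRing R] {p : ℕ} {G : BWGraph m (p + 1)}

-- Only the standard labelling can contribute, and only if `μ` is its restriction to the white
-- vertex. Signs therefore enter through the single value `s stdLabel`.
open Classical in
theorem sum_signed_weight (hG : G.HasStdLabel) (s : (HalfEdge (p + 1) G.V → Bool) → ℤˣ)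
    (μ : Fin (p + 1) → Bool) (hμ : ∀ i, i ≠ 0 → μ i = true) (a : Fin m → DualNumber R) :
    (∑ β : G.V × Fin 3 → Bool,
      (((s (Sum.elim μ β) : ℤ) : R) * (edgeWeight (dualFrobenius R) (dualBasis R) G (Sum.elim μ β) *
        vertexWeight (dualFrobenius R) (dualBasis R) β)) •
          leafWeight (dualFrobenius R) (dualBasis R) G (Sum.elim μ β)) a =
      if μ 0 = false then ((s stdLabel : ℤ) : R) * ∏ j, TrivSqZeroExt.snd (a j) else 0 := by
  have hl : leafWeight (dualFrobenius R) (dualBasis R) G stdLabel a =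
      ∏ j, TrivSqZeroExt.snd (a j) := by
    rw [leafWeight, MultilinearMap.compLinearMap_apply, MultilinearMap.mkPiAlgebra_apply]
    refine Finset.prod_congr rfl fun j _ => ?_
    obtain ⟨h, h1, h2⟩ := hG.leaf j
    rw [h1]
    change (dualBasis R).coord (stdLabel h) (a j) = _
    rw [h2, dualBasis_coord_true]
  simp only [weight_eq]
  rw [sum_apply]
  split_ifs with h0
  · have hstd : Sum.elim μ (fun x => stdLabel (Sum.inr x : HalfEdge (p + 1) G.V)) = (stdLabel : HalfEdge (p + 1) G.V → Bool) := by
      funext x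
      rcases x with i | x
      · by_cases hi : i = 0
        · subst hi; simpa [stdLabel] using h0
        · simp [stdLabel, hi, hμ i hi]
      · rfl
    rw [Finset.sum_eq_single fun x => stdLabel (Sum.inr x : HalfEdge (p + 1) G.V)]
    · rw [hstd, if_pos hG.admissible, mul_one, smul_apply, hl, smul_eq_mul]
    · intro β _ hβ
      rw [if_neg, mul_zero, zero_smul, zero_apply]
      intro hc
      refine hβ (funext fun x => ?_)
      exact congrFun (hG.unique _ hc hμ) (Sum.inr x)
    · simp
  · refine Finset.sum_eq_zero fun β _ => ?_
    rw [if_neg, mul_zero, zero_smul, zero_apply]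
    intro hc
    exact h0 (congrFun (hG.unique _ hc hμ) (Sum.inl 0))

/-- The action of a graph with standard labelling. -/
theorem signedAction_eq (hG : G.HasStdLabel) (s : (HalfEdge (p + 1) G.V → Bool) → ℤˣ)
    (a : Fin m → DualNumber R) :
    signedAction R G s a =
      (((s stdLabel : ℤ) : R) * ∏ j, TrivSqZeroExt.snd (a j)) • topChain R p := by
  rw [signedAction, sum_apply,
    Finset.sum_eq_single fun i : Fin (p + 1) => decide (i ≠ 0)]
  · rw [MultilinearMap.smulRight_apply, sum_signed_weight hG s _ (by simp), if_pos (by simp)]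
    congr 2
    funext i
    refine Fin.cases ?_ (fun i => ?_) i
    · simp
    · simp [Fin.succ_ne_zero]
  · intro μ _ hμ
    rw [MultilinearMap.smulRight_apply]
    by_cases h : ∀ i, i ≠ 0 → μ i = true
    · rw [sum_signed_weight hG s μ h, if_neg, zero_smul]
      intro h0
      refine hμ (funext fun i => ?_)
      by_cases hi : i = 0
      · subst hi; simpa using h0
      · simp [hi, h i hi]
    -- An output `1` away from the start makes the tensor degenerate.
    · push Not at h
      obtain ⟨i, hi, hi'⟩ := h
      have : RedChain.of R (DualNumber R) (fun i => dualBasis R (μ i)) = 0 := by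
        rw [RedChain.of, Submodule.mkQ_apply, Submodule.Quotient.mk_eq_zero]
        exact Submodule.subset_span ⟨_, i, hi, by simp [Bool.eq_false_of_not_eq_true hi'], rfl⟩
      rw [this, smul_zero]
  · simp

theorem dualAction_single_eq (hG : G.HasStdLabel) (a : Fin m → DualNumber R) :
    dualAction R (Finsupp.single (Sum.inl (Quot.mk _ G) : Gen m p) 1) a =
      (∏ j, TrivSqZeroExt.snd (a j)) • topChain R p := by
  have h : dualAction R (Finsupp.single (Sum.inl (Quot.mk _ G) : Gen m p) 1) =
      signedAction R G fun _ => 1 := by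
    rw [dualAction, action, Finsupp.linearCombination_single, one_smul, signedAction]
    refine Finset.sum_congr rfl fun μ _ => ?_
    congr 1
    refine Finset.sum_congr rfl fun β _ => ?_
    simp
  rw [h, signedAction_eq hG]
  simp

end Action

/-! ### The action is compatible with the differentials -/

section Merge

variable {R A : Type*} [CommRing R] [CommRing A] [Algebra R A] {ι : Type}
  (Φ : Frobenius R A) (b : Module.Basis ι R A)

theorem edges_addEdge {k' : ℕ} (G : BWGraph m k) (W : Type) [Fintype W] [DecidableEq W]
    (e : HalfEdge k G.V ⊕ Bool ≃ HalfEdge k' W) :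
    (G.addEdge W e).edges =
      insert s(e (Sum.inr false), e (Sum.inr true))
        (G.edges.image (Sym2.map fun h => e (Sum.inl h))) := by
  ext x
  simp only [BWGraph.edges, Finset.mem_insert, Finset.mem_image, Finset.mem_filter,
    Finset.mem_univ, true_and]
  constructor
  · rintro ⟨h, hh, rfl⟩
    obtain ⟨y, rfl⟩ := e.surjective h
    rcases y with y | (_ | _)
    · refine Or.inr ⟨_, ⟨y, fun h' => hh ?_, rfl⟩, by simp⟩
      simp [h']
    · exact Or.inl (by simp)
    · exact Or.inl (by simp [Sym2.eq_swap])
  · rintro (rfl | ⟨_, ⟨h, hh, rfl⟩, rfl⟩)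
    · exact ⟨e (Sum.inr false), by simp, by simp⟩
    · exact ⟨e (Sum.inl h), by simpa using hh, by simp⟩

theorem edgeWeight_addEdge {k' : ℕ} (G : BWGraph m k) (W : Type) [Fintype W] [DecidableEq W]
    (e : HalfEdge k G.V ⊕ Bool ≃ HalfEdge k' W) (c : HalfEdge k' W → ι) :
    edgeWeight Φ b (G.addEdge W e) c =
      Φ.copairing b (c (e (Sum.inr false))) (c (e (Sum.inr true))) *
        edgeWeight Φ b G fun h => c (e (Sum.inl h)) := by
  rw [edgeWeight, edges_addEdge, Finset.prod_insert, Finset.prod_image]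
  · simp only [edgeWeight, Sym2.map_map]
    rfl
  · exact fun x _ y _ h => Sym2.map.injective (e.injective.comp Sum.inl_injective) h
  · intro h
    obtain ⟨x, -, hx⟩ := Finset.mem_image.1 h
    have h1 : e (Sum.inr false) ∈ Sym2.map (fun h => e (Sum.inl h)) x := by simp [hx]
    obtain ⟨y, -, hy⟩ := Sym2.mem_map.1 h1
    simp at hy

theorem leafWeight_addEdge {k' : ℕ} (G : BWGraph m k) (W : Type) [Fintype W] [DecidableEq W]
    (e : HalfEdge k G.V ⊕ Bool ≃ HalfEdge k' W) (c : HalfEdge k' W → ι) :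
    leafWeight Φ b (G.addEdge W e) c = leafWeight Φ b G fun h => c (e (Sum.inl h)) := by
  rw [leafWeight, leafWeight]
  congr 1
  funext j
  change ((G.leaf j).map _).elim _ _ = _
  rcases G.leaf j with _ | h <;> rfl

/-- Split off the labels at the vertex `none`. -/
def optionVertexEquiv (V ι : Type) :
    (ι × ι × ι) × (V × Fin 3 → ι) ≃ (Option V × Fin 3 → ι) where
  toFun q
    | (none, t) => ![q.1.1, q.1.2.1, q.1.2.2] t
    | (some v, t) => q.2 (v, t)
  invFun β := ((β (none, 0), β (none, 1), β (none, 2)), fun x => β (some x.1, x.2))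
  left_inv q := rfl
  right_inv β := by
    funext ⟨v, t⟩
    rcases v with _ | v
    · fin_cases t <;> rfl
    · rfl

/-- The coefficients of the action after two neighbouring outputs have been multiplied. -/
theorem amplitude_merge [Fintype ι] (G : BWGraph m (k + 1)) (i : Fin k) (μ : Fin k → ι) :
    amplitude Φ b (G.merge i) μ =
      ∑ r : ι × ι × ι, (Φ.copairing b (μ i) r.1 * Φ.vertex b r.1 r.2.1 r.2.2) •
        amplitude Φ b G
          (Fin.insertNth (α := fun _ => ι) i.castSucc r.2.1 (Function.update μ i r.2.2)) := by
  simp only [amplitude, Finset.smul_sum]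
  rw [← Fintype.sum_prod_type']
  refine (Fintype.sum_equiv (optionVertexEquiv G.V ι) _ _ fun q => ?_).symm
  obtain ⟨⟨x, y, z⟩, β⟩ := q
  -- Seen from `G`, the half-edges `i` and `i + 1` carry the labels `y` and `z` of the half-edges
  -- `1` and `2` of the new vertex; the other outputs keep their labels.
  have hc : (fun h => Sum.elim μ (optionVertexEquiv G.V ι ((x, y, z), β))
      (mergeEquiv i (Sum.inl h))) =
      Sum.elim (Fin.insertNth (α := fun _ => ι) i.castSucc y (Function.update μ i z)) β := by
    funext h
    rcases h with j | ⟨v, t⟩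
    · rcases hj : finSuccEquiv' i.castSucc j with _ | j'
      · have hj' := hj
        rw [finSuccEquiv'_eq_none] at hj'
        subst hj'
        simp only [mergeEquiv, Equiv.coe_fn_mk, hj, Sum.elim_inl, Fin.insertNth_apply_same]
        rfl
      · have hj' := hj
        rw [finSuccEquiv'_eq_some] at hj'
        subst hj'
        by_cases h : j' = i
        · subst h
          simp only [mergeEquiv, Equiv.coe_fn_mk, hj]
          simp only [Sum.elim_inl, Fin.insertNth_apply_succAbove]
          rw [if_pos trivial, Function.update_self]
          rfl
        · simp only [mergeEquiv, Equiv.coe_fn_mk, hj]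
          simp only [Sum.elim_inl, Fin.insertNth_apply_succAbove]
          simp [h]
    · rfl
  rw [edgeWeight_addEdge, leafWeight_addEdge, hc, smul_smul]
  congr 1
  have h1 : vertexWeight Φ b (optionVertexEquiv G.V ι ((x, y, z), β)) =
      Φ.vertex b x y z * vertexWeight Φ b β := by
    rw [vertexWeight, Fintype.prod_option]
    rfl
  rw [h1]
  change _ = Φ.copairing b (μ i) x * _ * _
  ring

end Merge

/-! ### The functional on Sullivan diagrams that detects the classes -/

section Coefficient

variable (R : Type*) [CommRing R]

/-- The coefficient of the action of a graph at the tensor with labels `μ`, with `x` placed at all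
leaves. -/
def xAmplitude (D : Diagram m k) (μ : Fin k → Bool) : R :=
  D.amplitude (dualFrobenius R) (dualBasis R) μ fun _ => xElt R

/-- The multiplication of `R[x]/(x²)` read backwards: among products of basis elements, `x` arises
as `1 · x` and `x · 1`, and `1` only as `1 · 1`. -/
theorem xAmplitude_merge (D : Diagram m (k + 1)) (i : Fin k) (μ : Fin k → Bool) :
    xAmplitude R (D.merge i) μ =
      if μ i then
        xAmplitude R D
          (Fin.insertNth (α := fun _ => Bool) i.castSucc false (Function.update μ i true)) +
        xAmplitude R D
          (Fin.insertNth (α := fun _ => Bool) i.castSucc true (Function.update μ i false))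
      else
        xAmplitude R D
          (Fin.insertNth (α := fun _ => Bool) i.castSucc false (Function.update μ i false)) := by
  induction D using Quot.ind with | mk G => ?_
  change amplitude _ _ (G.merge i) μ _ = if μ i then amplitude _ _ G _ _ + amplitude _ _ G _ _
    else amplitude _ _ G _ _
  rw [amplitude_merge]
  simp only [dualFrobenius_copairing, dualFrobenius_vertex, Fintype.sum_prod_type, Fintype.sum_bool]
  rcases μ i <;> simp [add_comm]

theorem xAmplitude_rotate (D : Diagram m k) (μ : Fin k → Bool) :
    xAmplitude R D.rotate μ = xAmplitude R D (μ ∘ finRotate k) := by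
  induction D using Quot.ind with | mk G => ?_
  change amplitude _ _ G.rotate μ _ = amplitude _ _ G _ _
  rw [amplitude, amplitude]
  congr 1
  refine Finset.sum_congr rfl fun β _ => ?_
  have h : Sum.elim μ β ∘ Equiv.sumCongr (finRotate k) (Equiv.refl (G.V × Fin 3)) =
      Sum.elim (μ ∘ finRotate k) β := by
    funext x
    rcases x with x | x <;> rfl
  rw [← h, ← edgeWeight_relabel, ← leafWeight_relabel]

/-- The tuple with all entries `x`, except for the entry `1` at the place `i`. -/
def oneAt (i : Fin k) : Fin k → Bool := fun j => decide (j ≠ i)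

/-- The tuple with all entries `x`, except for the entries `1` at the places `0` and `i + 1`. -/
def oneAtZeroAnd (i : Fin k) : Fin (k + 1) → Bool := fun j => decide (j ≠ 0 ∧ j ≠ i.succ)

theorem xAmplitude_merge_zero_oneAt {p : ℕ} (D : Diagram m (p + 2)) :
    xAmplitude R (D.merge 0) (oneAt 0) = xAmplitude R D (oneAtZeroAnd 0) := by
  rw [xAmplitude_merge, if_neg (by simp [oneAt])]
  congr 1
  rw [Fin.insertNth_eq_iff]
  refine ⟨by simp [oneAtZeroAnd], ?_⟩
  funext j
  have h1 : j.succ = 1 ↔ j = 0 := by rw [← Fin.succ_zero_eq_one, Fin.succ_inj]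
  by_cases hj : j = 0 <;> simp [Fin.removeNth, oneAtZeroAnd, oneAt, hj, h1, Function.update_apply]

theorem xAmplitude_merge_succ_oneAt {p : ℕ} (D : Diagram m (p + 2)) (i : Fin p) :
    xAmplitude R (D.merge i.succ) (oneAt 0) =
      xAmplitude R D (oneAtZeroAnd i.castSucc) + xAmplitude R D (oneAtZeroAnd i.succ) := by
  rw [xAmplitude_merge, if_pos (by simp [oneAt])]
  have h0 : i.succ.castSucc ≠ 0 := by simp
  congr 2
  · rw [Fin.insertNth_eq_iff]
    refine ⟨by simp [oneAtZeroAnd], ?_⟩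
    funext j
    have h1 := Fin.succAbove_ne i.succ.castSucc j
    rw [← Fin.succ_castSucc] at h0 h1
    simp only [Fin.removeNth, oneAtZeroAnd, ← Fin.succ_castSucc, ne_eq,
      Fin.succAbove_eq_zero_iff h0, h1, Function.update_apply, oneAt]
    by_cases hj : j = i.succ <;> simp [hj]
  · rw [Fin.insertNth_eq_iff]
    refine ⟨by simp [oneAtZeroAnd, Fin.castSucc_lt_succ.ne], ?_⟩
    funext j
    have h1 : i.succ.castSucc.succAbove j = i.succ.succ ↔ j = i.succ := by
      rw [← Fin.succAbove_castSucc_self i.succ, Fin.succAbove_right_inj]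
    simp only [Fin.removeNth, oneAtZeroAnd, ne_eq, Fin.succAbove_eq_zero_iff h0, h1,
      Function.update_apply, oneAt]
    by_cases hj : j = i.succ <;> simp [hj]

theorem xAmplitude_merge_true {p : ℕ} (D : Diagram m (p + 1)) (i : Fin p) :
    xAmplitude R (D.merge i) (fun _ => true) =
      xAmplitude R D (oneAt i.castSucc) + xAmplitude R D (oneAt i.succ) := by
  rw [xAmplitude_merge, if_pos rfl]
  congr 2
  · rw [Fin.insertNth_eq_iff]
    refine ⟨by simp [oneAt], ?_⟩
    funext j
    simp [Fin.removeNth, oneAt, Fin.succAbove_ne]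
  · rw [Fin.insertNth_eq_iff]
    refine ⟨by simp [oneAt, Fin.castSucc_lt_succ.ne], ?_⟩
    funext j
    have h1 : i.castSucc.succAbove j = i.succ ↔ j = i := by
      rw [← Fin.succAbove_castSucc_self i, Fin.succAbove_right_inj]
    by_cases hj : j = i <;> simp [Fin.removeNth, oneAt, h1, hj]

theorem oneAt_comp_finRotate {p : ℕ} :
    oneAt (0 : Fin (p + 1)) ∘ finRotate (p + 1) = oneAt (Fin.last p) := by
  funext j
  have h : finRotate (p + 1) j = 0 ↔ j = Fin.last p := by
    rw [← Equiv.eq_symm_apply, finRotate_symm_zero]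
  simp only [oneAt, Function.comp_apply, ne_eq, h]

/-- The rotation moves the last place to `0` and `0` to `1`, so units at `0` and `1` stem from units
at the last place and at `0`. -/
theorem oneAtZeroAnd_comp_finRotate {p : ℕ} :
    oneAtZeroAnd (0 : Fin (p + 1)) ∘ finRotate (p + 2) = oneAtZeroAnd (Fin.last p) := by
  funext j
  have h1 : finRotate (p + 2) j = 0 ↔ j = (Fin.last p).succ := by
    rw [← Equiv.eq_symm_apply, finRotate_symm_zero, Fin.succ_last]
  have h2 : finRotate (p + 2) j = Fin.succ 0 ↔ j = 0 := by
    rw [← Equiv.eq_symm_apply, finRotate_symm_succ]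
    rfl
  simp only [oneAtZeroAnd, Function.comp_apply, ne_eq, h1, h2, and_comm]

/-- The coefficient of `1 ⊗ x ⊗ … ⊗ x` in the action of a generator on `x, …, x`. -/
def topAmplitude (p : ℕ) : Gen m p → R
  | Sum.inl D => xAmplitude R D (oneAt 0)
  | Sum.inr D => xAmplitude R D fun _ => true

/-- The analogue for diagrams of `topCoeffPre_hochPre`, since pulling out two half-edges multiplies
two outputs. Without a start leaf, the terms have units at `0` and at one further place; an
unlabelled start leaf supplies the first unit itself, so only one unit remains among the outputs of
the diagram. -/
theorem topAmplitude_boundaryGen (p : ℕ) (γ : Gen m (p + 1)) :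
    Finsupp.linearCombination R (topAmplitude R p) (boundaryGen R p γ) = 0 := by
  rcases γ with D | D
  · rw [boundaryGen.eq_def, ← sum_telescoping fun i => xAmplitude R D (oneAtZeroAnd i)]
    simp only [map_add, map_sum, Finsupp.linearCombination_single, smul_eq_mul, topAmplitude]
    rw [Fin.sum_univ_succ, xAmplitude_merge_zero_oneAt, xAmplitude_merge_zero_oneAt,
      xAmplitude_rotate, oneAtZeroAnd_comp_finRotate]
    simp [xAmplitude_merge_succ_oneAt]
  · rw [boundaryGen.eq_def, ← sum_telescoping fun i => xAmplitude R D (oneAt i)]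
    simp only [map_add, map_sum, Finsupp.linearCombination_single, smul_eq_mul, topAmplitude]
    rw [xAmplitude_rotate, oneAt_comp_finRotate, one_mul]
    simp [xAmplitude_merge_true]

theorem topAmplitude_boundary (p : ℕ) (c : Gen m (p + 1) →₀ R) :
    Finsupp.linearCombination R (topAmplitude R p) (boundary R (p + 1) c) = 0 := by
  have h : Finsupp.linearCombination R (topAmplitude R p) ∘ₗ
      (Finsupp.linearCombination R (boundaryGen R p) : (Gen m (p + 1) →₀ R) →ₗ[R] _) = 0 := by
    refine Finsupp.lhom_ext' fun γ => LinearMap.ext_ring ?_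
    simp [topAmplitude_boundaryGen]
  exact LinearMap.congr_fun h c

theorem topAmplitude_of_hasStdLabel {p : ℕ} {G : BWGraph m (p + 1)} (hG : G.HasStdLabel) :
    topAmplitude R p (Sum.inl (Quot.mk _ G)) = 1 := by
  have h := sum_signed_weight (R := R) hG (fun _ => 1) (oneAt 0)
    (fun i hi => by simp [oneAt, hi]) fun _ => xElt R
  refine Eq.trans ?_ (h.trans (by simp [oneAt]))
  change amplitude _ _ G (oneAt 0) _ = _
  rw [amplitude]
  congr 1
  refine Finset.sum_congr rfl fun β _ => ?_
  simp

/-- The homology class of a diagram with a comb and with standard labelling is not zero. -/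
theorem SD.isNonzeroClass [Nontrivial R] {n : ℕ} {G : BWGraph m (2 * (n + 1) + 1 + 1)}
    {ι : Fin n → G.V} (hc : G.IsClosed) (hG : G.HasComb ι) (hl : G.HasStdLabel) :
    SD.IsNonzeroClass
      (Finsupp.single (Sum.inl (Quot.mk _ G) : Gen m (2 * (n + 1) + 1)) (1 : R)) := by
  refine ⟨⟨Submodule.subset_span ⟨_, Or.inl ⟨G, hc, rfl⟩, rfl⟩, hG.boundary_eq_zero R⟩, ?_⟩
  -- A functional that vanishes on boundaries but is `1` on the diagram separates the two.
  rintro ⟨c, -, h⟩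
  have h1 := topAmplitude_boundary R _ c
  rw [h, Finsupp.linearCombination_single, one_smul, topAmplitude_of_hasStdLabel R hl] at h1
  exact one_ne_zero h1

end Coefficient

end Sullivan

end

/-! ### The theorem -/

/-- Here `g = n + 1 ≥ 1`. -/
theorem proposition3 (n : ℕ) :
    -- the topological types of `t_g` and `μ_g`, all of whose leaves mark closed boundary components
    ((Sullivan.tGraph n).IsClosed ∧ (Sullivan.tGraph n).HasType (n + 1) 1) ∧
    ((Sullivan.muGraph n).IsClosed ∧ (Sullivan.muGraph n).HasType 0 (n + 2)) ∧
    -- `F(t_g ⊗ x) = 1 ⊗ x ⊗ … ⊗ x`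
    Sullivan.dualAction ℤ (Sullivan.tChain ℤ n) (fun _ => Sullivan.xElt ℤ) =
      Sullivan.RedChain.of ℤ (DualNumber ℤ) (Fin.cons 1 fun _ => Sullivan.xElt ℤ) ∧
    -- `t_g` induces a nonzero map on Hochschild homology, also rationally
    Sullivan.InducesNonzero (Sullivan.plainRotation ℤ (DualNumber ℤ))
      (Sullivan.dualAction ℤ (Sullivan.tChain ℤ n)) ∧
    Sullivan.InducesNonzero (Sullivan.plainRotation ℚ (DualNumber ℚ))
      (Sullivan.dualAction ℚ (Sullivan.tChain ℚ n)) ∧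
    -- `μ_g` induces a nonzero map on Hochschild homology, also rationally
    Sullivan.InducesNonzeroTensor (Sullivan.plainRotation ℤ (DualNumber ℤ))
      (Sullivan.dualAction ℤ (Sullivan.muChain ℤ n)) ∧
    Sullivan.InducesNonzeroTensor (Sullivan.plainRotation ℚ (DualNumber ℚ))
      (Sullivan.dualAction ℚ (Sullivan.muChain ℚ n)) ∧
    -- the homology classes of the Sullivan diagrams `t_g` and `μ_g` are nonzero, also rationally
    Sullivan.SD.IsNonzeroClass (Sullivan.tChain ℤ n) ∧
    Sullivan.SD.IsNonzeroClass (Sullivan.tChain ℚ n) ∧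
    Sullivan.SD.IsNonzeroClass (Sullivan.muChain ℤ n) ∧
    Sullivan.SD.IsNonzeroClass (Sullivan.muChain ℚ n) ∧
    -- the operations on the Hochschild homology of the cohomology algebra of the sphere of
    -- dimension `N` are nonzero, whatever the signs
    ∀ N : ℕ, 2 ≤ N →
      (∀ s, Sullivan.InducesNonzero (Sullivan.sphereRotation ℚ N)
        (Sullivan.signedAction ℚ (Sullivan.tGraph n) s)) ∧
      (∀ s, Sullivan.InducesNonzeroTensor (Sullivan.sphereRotation ℚ N)
        (Sullivan.signedAction ℚ (Sullivan.muGraph n) s)) := by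
  have hT := Sullivan.tGraph_hasStdLabel n
  have hM := Sullivan.muGraph_hasStdLabel n
  refine ⟨⟨Sullivan.tGraph_isClosed n, Sullivan.tGraph_hasType n⟩,
    ⟨Sullivan.muGraph_isClosed n, Sullivan.muGraph_hasType n⟩, ?_,
    Sullivan.plainRotation_isSphereLike.inducesNonzero 1 fun a => ?_,
    Sullivan.plainRotation_isSphereLike.inducesNonzero 1 fun a => ?_,
    Sullivan.plainRotation_isSphereLike.inducesNonzeroTensor 1 fun a => ?_,
    Sullivan.plainRotation_isSphereLike.inducesNonzeroTensor 1 fun a => ?_,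
    Sullivan.SD.isNonzeroClass ℤ (Sullivan.tGraph_isClosed n) (Sullivan.tGraph_hasComb n) hT,
    Sullivan.SD.isNonzeroClass ℚ (Sullivan.tGraph_isClosed n) (Sullivan.tGraph_hasComb n) hT,
    Sullivan.SD.isNonzeroClass ℤ (Sullivan.muGraph_isClosed n) (Sullivan.muGraph_hasComb n) hM,
    Sullivan.SD.isNonzeroClass ℚ (Sullivan.muGraph_isClosed n) (Sullivan.muGraph_hasComb n) hM,
    -- The global sign of the operation is the value of `s` at the standard labelling.
    fun N _ => ⟨fun s => (Sullivan.sphereRotation_isSphereLike N).inducesNonzero _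
      (Sullivan.signedAction_eq hT s), fun s =>
      (Sullivan.sphereRotation_isSphereLike N).inducesNonzeroTensor _
        (Sullivan.signedAction_eq hM s)⟩⟩
  · exact (Sullivan.dualAction_single_eq hT _).trans (by simp)
  · exact (Sullivan.dualAction_single_eq hT a).trans (by simp)
  · exact (Sullivan.dualAction_single_eq hT a).trans (by simp)
  · exact (Sullivan.dualAction_single_eq hM a).trans (by simp)
  · exact (Sullivan.dualAction_single_eq hM a).trans (by simp)
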